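/- Let $l\ge 2$ and let $(M_1^{m_1},g_1),\dots,(M_l^{m_l},g_l)$ be closed (compact, without boundary) connected smooth Riemannian manifolds of dimensions $m_1,\dots,m_l\ge 1$. Let $(M^m,g)=(M_1\times\cdots\times M_l,\ g_1\oplus\cdots\oplus g_l)$ be their direct product, $m=m_1+\cdots+m_l$, and let $$[\![g]\!]=\{f_1^2g_1\oplus\cdots\oplus f_l^2g_l \mid f_1,\dots,f_l\in C^\infty(M),\ f_1,\dots,f_l>0\}$$ be its multiconformal class. For a Riemannian metric $\tilde g$ on $M$ with scalar curvature $R^{\tilde g}$ and volume measure $\mu^{\tilde g}$, let $$E(\tilde g)=\frac{\int_M R^{\tilde g}\,d\mu^{\tilde g}}{\bigl(\int_M d\mu^{\tilde g}\bigr)^{(m-2)/m}}$$ be the normalized Einstein--Hilbert functional. Let $\mathcal P_i\colon TM\to TM$ be the projection onto the tangent directions of $M_i$. Put $R_i^g=\operatorname{tr}^g\bigl(\operatorname{Ric}^g(\mathcal P_i\,\cdot,\mathcal P_i\,\cdot)\bigr)$ and, for $\varphi\in C^\infty(M)$, $\operatorname{grad}_i\varphi=\mathcal P_i\operatorname{grad}^g\varphi$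 and $\Delta_i\varphi=\operatorname{tr}^g\bigl(\operatorname{Hess}^g\varphi(\mathcal P_i\,\cdot,\mathcal P_i\,\cdot)\bigr)$. For positive smooth functions $f_1,\dots,f_l$ on $M$ define $$\begin{aligned}\rho_i={}&-2(m_i-1)\frac{\Delta_if_i}{f_i}-2\sum_{j\ne i}m_j\frac{\Delta_if_j}{f_j}-(m_i-1)(m_i-4)\frac{|\operatorname{grad}_if_i|^2}{f_i^2}\\&-2(m_i-2)\sum_{j\ne i}m_j\frac{\langle\operatorname{grad}_if_i,\operatorname{grad}_if_j\rangle}{f_if_j}-\sum_{j\ne i}m_j(m_j-1)\frac{|\operatorname{grad}_if_j|^2}{f_j^2}\\&-\sum_{j\ne i,\ k\ne i,\ j\ne k}m_jm_k\frac{\langle\operatorname{grad}_if_j,\operatorname{grad}_if_k\rangle}{f_jf_k}.\end{aligned}$$ If there exist $i\in\{1,\dots,l\}$ and positive smooth functions $f_1,\dots,f_l$ on $M$ such that $$\int_M\frac{R_i^g+\rho_i}{f_i^2}\,f_1^{m_1}\cdots f_l^{m_l}\,d\mu^g<0,$$ then $$\inf_{\tilde g\in[\![g]\!]}E(\tilde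 g)=-\infty.$$ -/

import Mathlib

open scoped Manifold ContDiff Topology
open Set MeasureTheory Module

noncomputable section

namespace Multiconformal

/-- The pullback `(v, w) ↦ B (D v) (D w)` of a bilinear form `B` along a linear map `D`. -/
def pullbackForm {V W : Type*} [AddCommGroup V] [Module ℝ V] [TopologicalSpace V]
    [IsTopologicalAddGroup V] [ContinuousSMul ℝ V]
    [AddCommGroup W] [Module ℝ W] [TopologicalSpace W]
    [IsTopologicalAddGroup W] [ContinuousSMul ℝ W]
    (B : V →L[ℝ] V →L[ℝ] ℝ) (D : W →L[ℝ] V) : W →L[ℝ] W →L[ℝ] ℝ :=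
  (ContinuousLinearMap.precomp ℝ D).comp (B.comp D)

/-! ### Riemannian geometry of a metric `G` on an open subset of a vector space -/

section Local

variable {E : Type*} [NormedAddCommGroup E] [NormedSpace ℝ E] [FiniteDimensional ℝ E]

/-- The Gram matrix `(B(e_a, e_b))` of a bilinear form in the fixed basis `finBasis ℝ E`. -/
def gram (B : E →L[ℝ] E →L[ℝ] ℝ) : Matrix (Fin (finrank ℝ E)) (Fin (finrank ℝ E)) ℝ :=
  Matrix.of fun a b => B (finBasis ℝ E a) (finBasis ℝ E b)

/-- The vector `α^♯` with `B(α^♯, w) = α w`, for an inner product `B` and a linear form `α`. -/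
def sharp (B : E →L[ℝ] E →L[ℝ] ℝ) (α : E → ℝ) : E :=
  ∑ a, ∑ b, ((gram B)⁻¹ a b * α (finBasis ℝ E b)) • finBasis ℝ E a

/-- The trace `B^{ab} S_{ab}` of a bilinear form `S` with respect to an inner product `B`. -/
def metricTrace (B : E →L[ℝ] E →L[ℝ] ℝ) (S : E → E → ℝ) : ℝ :=
  ∑ a, ∑ b, (gram B)⁻¹ a b * S (finBasis ℝ E a) (finBasis ℝ E b)

/-- The Christoffel symbols `Γ_y(u, v) = ∇_u v` (`u`, `v` constant vector fields) of the
Levi-Civita connection of `G`, by the Koszul formula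
`2 G(∇_u v, w) = ∂_u G(v, w) + ∂_v G(u, w) - ∂_w G(u, v)`. -/
def christoffel (G : E → E →L[ℝ] E →L[ℝ] ℝ) (y u v : E) : E :=
  sharp (G y) fun w =>
    (1 / 2 : ℝ) * (fderiv ℝ G y u v w + fderiv ℝ G y v u w - fderiv ℝ G y w u v)

/-- The Riemann curvature tensor
`R(u, v) w = ∇_u ∇_v w - ∇_v ∇_u w` (`u`, `v`, `w` constant vector fields) of `G`. -/
def curvature (G : E → E →L[ℝ] E →L[ℝ] ℝ) (y u v w : E) : E :=
  fderiv ℝ (fun z => christoffel G z v w) y u - fderiv ℝ (fun z => christoffel G z u w) y v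
    + christoffel G y u (christoffel G y v w) - christoffel G y v (christoffel G y u w)

/-- The Ricci tensor `Ric(v, w) = tr (u ↦ R(u, v) w)` of `G`. -/
def ricci (G : E → E →L[ℝ] E →L[ℝ] ℝ) (y v w : E) : ℝ :=
  ∑ a, (finBasis ℝ E).coord a (curvature G y (finBasis ℝ E a) v w)

/-- The Hessian `Hess φ (u, v) = ∂_u ∂_v φ - dφ(∇_u v)`. -/
def hessian (G : E → E →L[ℝ] E →L[ℝ] ℝ) (φ : E → ℝ) (y u v : E) : ℝ :=
  fderiv ℝ (fderiv ℝ φ) y u v - fderiv ℝ φ y (christoffel G y u v)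

/-- The gradient of `φ`. -/
def gradient (G : E → E →L[ℝ] E →L[ℝ] ℝ) (φ : E → ℝ) (y : E) : E :=
  sharp (G y) (fderiv ℝ φ y)

end Local

/-! ### Riemannian manifolds -/

section Manifold

variable {E : Type*} [NormedAddCommGroup E] [NormedSpace ℝ E]
  {H : Type*} [TopologicalSpace H] (I : ModelWithCorners ℝ E H)
  (M : Type*) [TopologicalSpace M] [ChartedSpace H M] [IsManifold I ∞ M]

/-- Smooth Riemannian metrics on the manifold `M`. -/
abbrev RiemannianMetricOn : Type _ :=
  Bundle.ContMDiffRiemannianMetric I ∞ E (fun x : M => TangentSpace I x)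

variable {I M}

/-- The coordinate expression of `g` in the chart `extChartAt I p`, i.e. the pullback of `g` under
the inverse of that chart. -/
def chartMetric (g : RiemannianMetricOn I M) (p : M) (y : E) : E →L[ℝ] E →L[ℝ] ℝ :=
  pullbackForm (V := TangentSpace I ((extChartAt I p).symm y)) (W := TangentSpace 𝓘(ℝ, E) y)
    (g.inner ((extChartAt I p).symm y))
    (mfderivWithin 𝓘(ℝ, E) I (extChartAt I p).symm (range I) y)

variable [FiniteDimensional ℝ E]

/-- The scalar curvature `R^g`, computed at `x` in the chart `extChartAt I x`. -/
def scalarCurvature (g : RiemannianMetricOn I M) (x : M) : ℝ :=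
  metricTrace (chartMetric g x (extChartAt I x x))
    (ricci (chartMetric g x) (extChartAt I x x))

/-- The restriction of the Riemannian volume to the domain of the chart `extChartAt I p`: in that
chart it is `√(det g_{ab}) dy`, where `dy` is the Lebesgue measure for which the parallelepiped
spanned by the basis `finBasis ℝ E` has volume `1`. -/
def chartVolume [MeasurableSpace E] [BorelSpace E] [MeasurableSpace M]
    (g : RiemannianMetricOn I M) (p : M) : Measure M :=
  (((finBasis ℝ E).addHaar.restrict (extChartAt I p).target).withDensity
    fun y => ENNReal.ofReal (Real.sqrt (gram (chartMetric g p y)).det)).map (extChartAt I p).symm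

/-- The Riemannian volume measure `μ^g`. The measures `chartVolume g p` are its restrictions to the
chart domains; as countably many of these cover a second countable manifold, it is their
supremum (in the complete lattice of measures). -/
def riemannianVolume [MeasurableSpace E] [BorelSpace E] [MeasurableSpace M]
    (g : RiemannianMetricOn I M) : Measure M :=
  ⨆ p : M, chartVolume g p

/-- The normalized Einstein-Hilbert functional `E(g) = ∫ R^g dμ^g / (∫ dμ^g)^{(m - 2) / m}`,
`m = dim M`. (Here `(m - 2) / m = 2 / p_m` for `p_m = 2 m / (m - 2)`, if `m ≥ 3`.) -/
def einsteinHilbert [MeasurableSpace E] [BorelSpace E] [MeasurableSpace M]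
    (g : RiemannianMetricOn I M) : ℝ :=
  (∫ x, scalarCurvature g x ∂riemannianVolume g) /
    (riemannianVolume g).real univ ^ (((finrank ℝ E : ℝ) - 2) / (finrank ℝ E : ℝ))

end Manifold

/-! ### Products of manifolds -/

section Pi
variable {ι : Type*} [Fintype ι]
  {E : ι → Type*} [∀ i, NormedAddCommGroup (E i)] [∀ i, NormedSpace ℝ (E i)]
  {H : ι → Type*} [∀ i, TopologicalSpace (H i)] {I : ∀ i, ModelWithCorners ℝ (E i) (H i)}
  {M : ι → Type*} [∀ i, TopologicalSpace (M i)] [∀ i, ChartedSpace (H i) (M i)]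

/-- A finite product of `C^n` manifolds is a `C^n` manifold. -/
instance isManifold_pi {n : ℕ∞ω} [∀ i, IsManifold (I i) n (M i)] :
    IsManifold (ModelWithCorners.pi I) n (∀ i, M i) := by
  apply isManifold_of_contDiffOn
  rintro _ _ ⟨e, he, rfl⟩ ⟨e', he', rfl⟩
  rw [contDiffOn_pi]
  intro i
  have h := (mem_groupoid_of_pregroupoid.1
    (StructureGroupoid.compatible (contDiffGroupoid n (I i))
      (he i (mem_univ i)) (he' i (mem_univ i)))).1
  refine h.comp (ContinuousLinearMap.proj (R := ℝ) (φ := E) i).contDiff.contDiffOn ?_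
  rintro y ⟨hy, z, rfl⟩
  refine ⟨?_, mem_range_self _⟩
  have hy1 := hy.1
  have hy2 := hy.2
  exact ⟨hy1 i (mem_univ i), hy2 i (mem_univ i)⟩

/-- A finite product of manifolds without boundary has no boundary. -/
instance boundaryless_pi [∀ i, (I i).Boundaryless] : (ModelWithCorners.pi I).Boundaryless where
  range_eq_univ := by
    have : range (ModelWithCorners.pi I) = Set.pi univ (fun i => range (I i)) :=
      Set.range_piMap _
    rw [this]
    simp [ModelWithCorners.range_eq_univ]

lemma extChartAt_pi_apply (x y : ∀ i, M i) (i : ι) :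
    extChartAt (ModelWithCorners.pi I) x y i = extChartAt (I i) (x i) (y i) := rfl

lemma extChartAt_pi_symm_apply (x : ∀ i, M i) (z : ∀ i, E i) (i : ι) :
    (extChartAt (ModelWithCorners.pi I) x).symm z i = (extChartAt (I i) (x i)).symm (z i) := rfl

lemma contMDiff_eval {n : ℕ∞ω} [∀ i, IsManifold (I i) n (M i)] (i : ι) :
    ContMDiff (ModelWithCorners.pi I) (I i) n (fun x : ∀ j, M j => x i) := by
  intro x
  rw [contMDiffAt_iff]
  refine ⟨(continuous_apply i).continuousAt, ?_⟩
  have hc : ContDiff ℝ n (fun z : ∀ j, E j => z i) :=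
    (ContinuousLinearMap.proj (R := ℝ) (φ := E) i).contDiff
  refine (hc.contDiffWithinAt (x := extChartAt (ModelWithCorners.pi I) x x)
    (s := range (ModelWithCorners.pi I))).congr_of_eventuallyEq ?_ ?_
  · filter_upwards [extChartAt_target_mem_nhdsWithin (I := ModelWithCorners.pi I) x] with z hz
    have := (extChartAt (ModelWithCorners.pi I) x).right_inv hz
    exact congrFun this i
  · have := extChartAt_to_inv (I := ModelWithCorners.pi I) x
    exact congrArg (fun y => extChartAt (I i) (x i) (y i)) this

lemma tangentCoordChange_pi [∀ i, IsManifold (I i) 1 (M i)] (x y z : ∀ i, M i)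
    (hx : z ∈ (extChartAt (ModelWithCorners.pi I) x).source)
    (hy : z ∈ (extChartAt (ModelWithCorners.pi I) y).source) (v : ∀ i, E i) (i : ι) :
    tangentCoordChange (ModelWithCorners.pi I) x y z v i
      = tangentCoordChange (I i) (x i) (y i) (z i) (v i) := by
  have h1 := hasFDerivWithinAt_tangentCoordChange (I := ModelWithCorners.pi I) ⟨hx, hy⟩
  have h2 := (hasFDerivWithinAt_pi'.1 h1) i
  have hxi : z i ∈ (extChartAt (I i) (x i)).source := by
    simp only [extChartAt_source] at hx ⊢
    exact hx i (mem_univ i)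
  have hyi : z i ∈ (extChartAt (I i) (y i)).source := by
    simp only [extChartAt_source] at hy ⊢
    exact hy i (mem_univ i)
  have h3 := hasFDerivWithinAt_tangentCoordChange (I := I i) ⟨hxi, hyi⟩
  have h4 := h3.comp (s := range (ModelWithCorners.pi I)) (f := fun u : ∀ j, E j => u i)
    (extChartAt (ModelWithCorners.pi I) x z) (hasFDerivWithinAt_apply i _ _) (by
      rintro _ ⟨u, rfl⟩; exact mem_range_self _)
  have h5 := ((ModelWithCorners.pi I).uniqueDiffOn _ (by
    exact mem_range_self _)).eq h2 h4
  exact congrArg (fun L => L v) h5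

/-- The differential of the `i`-th projection is the `i`-th component. -/
lemma mfderiv_eval [∀ i, IsManifold (I i) 1 (M i)] (x : ∀ i, M i) (i : ι)
    (v : TangentSpace (ModelWithCorners.pi I) x) :
    mfderiv (ModelWithCorners.pi I) (I i) (fun y : ∀ j, M j => y i) x v = (v : ∀ j, E j) i := by
  have : HasMFDerivAt (ModelWithCorners.pi I) (I i) (fun y : ∀ j, M j => y i) x
      (ContinuousLinearMap.proj (R := ℝ) (φ := E) i) := by
    refine ⟨(continuous_apply i).continuousAt, ?_⟩
    refine (hasFDerivWithinAt_apply (𝕜 := ℝ) i (extChartAt (ModelWithCorners.pi I) x x)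
      (range (ModelWithCorners.pi I))).congr_of_eventuallyEq ?_ ?_
    · filter_upwards [extChartAt_target_mem_nhdsWithin (I := ModelWithCorners.pi I) x] with z hz
      have := (extChartAt (ModelWithCorners.pi I) x).right_inv hz
      exact congrFun this i
    · have := extChartAt_to_inv (I := ModelWithCorners.pi I) x
      exact congrArg (fun y => extChartAt (I i) (x i) (y i)) this
  rw [this.mfderiv]
  rfl

/-- The symmetric bilinear form `f_1² g_1 ⊕ ⋯ ⊕ f_l² g_l = ∑ i, f_i² π_i^* g_i` on the product
manifold, where `π_i` is the projection onto the `i`-th factor. -/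
def multiconformalForm [∀ i, IsManifold (I i) ∞ (M i)]
    (g : ∀ i, RiemannianMetricOn (I i) (M i))
    (f : ι → (∀ j, M j) → ℝ) (x : ∀ j, M j) :
    TangentSpace (ModelWithCorners.pi I) x →L[ℝ] TangentSpace (ModelWithCorners.pi I) x →L[ℝ] ℝ :=
  ∑ i, (f i x) ^ 2 • pullbackForm ((g i).inner (x i))
    (mfderiv (ModelWithCorners.pi I) (I i) (fun y : ∀ j, M j => y i) x)

lemma multiconformalForm_apply [∀ i, IsManifold (I i) ∞ (M i)]
    (g : ∀ i, RiemannianMetricOn (I i) (M i))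
    (f : ι → (∀ j, M j) → ℝ) (x : ∀ j, M j) (v w : TangentSpace (ModelWithCorners.pi I) x) :
    multiconformalForm g f x v w =
      ∑ i, (f i x) ^ 2 * (g i).inner (x i) ((v : ∀ j, E j) i) ((w : ∀ j, E j) i) := by
  simp only [multiconformalForm, sum_apply, smul_apply, smul_eq_mul]
  refine Finset.sum_congr rfl fun i _ => ?_
  rw [← mfderiv_eval x i v, ← mfderiv_eval x i w]
  rfl

lemma multiconformalForm_contMDiff [∀ i, IsManifold (I i) ∞ (M i)]
    (g : ∀ i, RiemannianMetricOn (I i) (M i))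
    (f : ι → (∀ j, M j) → ℝ)
    (hf : ∀ i, ContMDiff (ModelWithCorners.pi I) 𝓘(ℝ, ℝ) ∞ (f i)) :
    ContMDiff (ModelWithCorners.pi I)
      ((ModelWithCorners.pi I).prod 𝓘(ℝ, (∀ i, E i) →L[ℝ] (∀ i, E i) →L[ℝ] ℝ)) ∞
      (fun x => Bundle.TotalSpace.mk' ((∀ i, E i) →L[ℝ] (∀ i, E i) →L[ℝ] ℝ)
        (E := fun x : (∀ j, M j) => TangentSpace (ModelWithCorners.pi I) x →L[ℝ]
          TangentSpace (ModelWithCorners.pi I) x →L[ℝ] ℝ) x (multiconformalForm g f x)) := by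
  intro x₀
  rw [contMDiffAt_hom_bundle]
  refine ⟨contMDiffAt_id, ?_⟩
  have hg : ∀ i, ContMDiffAt (I i) 𝓘(ℝ, E i →L[ℝ] E i →L[ℝ] ℝ) ∞
      (fun y : M i => ContinuousLinearMap.inCoordinates (E i)
        (fun y : M i => TangentSpace (I i) y) (E i →L[ℝ] ℝ)
        (fun y : M i => TangentSpace (I i) y →L[ℝ] ℝ)
        (x₀ i) y (x₀ i) y ((g i).inner y)) (x₀ i) := fun i =>
    ((contMDiffAt_hom_bundle _).1 ((g i).contMDiff (x₀ i))).2
  have hL : ∀ i, ContDiff ℝ ∞ (fun B : E i →L[ℝ] E i →L[ℝ] ℝ =>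
      pullbackForm B (ContinuousLinearMap.proj (R := ℝ) (φ := E) i)) := by
    intro i
    unfold pullbackForm
    exact contDiff_const.clm_comp (contDiff_id.clm_comp contDiff_const)
  have hsum : ContMDiffAt (ModelWithCorners.pi I) 𝓘(ℝ, (∀ i, E i) →L[ℝ] (∀ i, E i) →L[ℝ] ℝ) ∞
      (fun x : ∀ j, M j => ∑ i, (f i x) ^ 2 • pullbackForm
        (ContinuousLinearMap.inCoordinates (E i)
        (fun y : M i => TangentSpace (I i) y) (E i →L[ℝ] ℝ)
        (fun y : M i => TangentSpace (I i) y →L[ℝ] ℝ)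
        (x₀ i) (x i) (x₀ i) (x i) ((g i).inner (x i)))
        (ContinuousLinearMap.proj (R := ℝ) (φ := E) i)) x₀ := by
    refine contMDiffAt_finsetSum fun i _ => ?_
    refine ((hf i x₀).pow 2).smul ?_
    exact (hL i).contMDiff.contMDiffAt.comp x₀ ((hg i).comp x₀ (contMDiff_eval i x₀))
  refine hsum.congr_of_eventuallyEq ?_
  have hmem : ∀ᶠ x in nhds x₀, x ∈ (extChartAt (ModelWithCorners.pi I) x₀).source :=
    extChartAt_source_mem_nhds x₀
  filter_upwards [hmem] with x hx
  have hx' : x ∈ (chartAt (ModelPi H) x₀).source := by simpa only [extChartAt_source] using hx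
  have hxi : ∀ i, x i ∈ (chartAt (H i) (x₀ i)).source := fun i => hx' i (mem_univ i)
  ext v w
  rw [inCoordinates_apply_eq₂ (by simpa using hx') (by simpa using hx') (by simp)]
  simp only [sum_apply, smul_apply, smul_eq_mul]
  have key : ∀ (u : ∀ j, E j) (i : ι),
      ((trivializationAt (∀ j, E j) (TangentSpace (ModelWithCorners.pi I)) x₀).symm x u :
        ∀ j, E j) i
      = (trivializationAt (E i) (TangentSpace (I i)) (x₀ i)).symm (x i) (u i) := by
    intro u i
    rw [← Bundle.Trivialization.symmL_apply (R := ℝ) _ (by simpa using hx'),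
      ← Bundle.Trivialization.symmL_apply (R := ℝ) _ (by simpa using hxi i),
      TangentBundle.symmL_trivializationAt_eq_core hx',
      TangentBundle.symmL_trivializationAt_eq_core (hxi i)]
    exact tangentCoordChange_pi x₀ x x hx (mem_extChartAt_source x) u i
  have hR : ∀ i, pullbackForm (ContinuousLinearMap.inCoordinates (E i)
        (fun y : M i => TangentSpace (I i) y) (E i →L[ℝ] ℝ)
        (fun y : M i => TangentSpace (I i) y →L[ℝ] ℝ)
        (x₀ i) (x i) (x₀ i) (x i) ((g i).inner (x i)))
        (ContinuousLinearMap.proj (R := ℝ) (φ := E) i) v w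
      = (g i).inner (x i) ((trivializationAt (E i) (TangentSpace (I i)) (x₀ i)).symm (x i) (v i))
        ((trivializationAt (E i) (TangentSpace (I i)) (x₀ i)).symm (x i) (w i)) := by
    intro i
    change (ContinuousLinearMap.inCoordinates (E i)
        (fun y : M i => TangentSpace (I i) y) (E i →L[ℝ] ℝ)
        (fun y : M i => TangentSpace (I i) y →L[ℝ] ℝ)
        (x₀ i) (x i) (x₀ i) (x i) ((g i).inner (x i))) (v i) (w i) = _
    rw [inCoordinates_apply_eq₂ (by simpa using hxi i) (by simpa using hxi i) (by simp)]
    simp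
  rw [Finset.sum_congr rfl fun i _ => by rw [hR i, ← key v i, ← key w i]]
  simp [multiconformalForm_apply]

/-- The Riemannian metric `f_1² g_1 ⊕ ⋯ ⊕ f_l² g_l`, for smooth positive functions `f_i` on the
product manifold. -/
def multiconformalMetric [∀ i, IsManifold (I i) ∞ (M i)]
    (g : ∀ i, RiemannianMetricOn (I i) (M i))
    (f : ι → (∀ j, M j) → ℝ)
    (hf : ∀ i, ContMDiff (ModelWithCorners.pi I) 𝓘(ℝ, ℝ) ∞ (f i)) (hpos : ∀ i x, 0 < f i x) :
    RiemannianMetricOn (ModelWithCorners.pi I) (∀ i, M i) where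
  inner := multiconformalForm g f
  symm x v w := by
    simp only [multiconformalForm_apply]
    exact Finset.sum_congr rfl fun i _ => congrArg _ ((g i).symm _ _ _)
  pos x v hv := by
    rw [multiconformalForm_apply]
    obtain ⟨i, hi⟩ := Function.ne_iff.1 hv
    refine Finset.sum_pos' (fun j _ => ?_) ⟨i, Finset.mem_univ i,
      mul_pos (pow_pos (hpos i x) 2) ((g i).pos _ _ hi)⟩
    refine mul_nonneg (sq_nonneg _) ?_
    by_cases hj : (v : ∀ j, E j) j = 0
    · have h0 : (g j).inner (x j) (0 : TangentSpace (I j) (x j)) = 0 := map_zero _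
      exact le_of_eq (by rw [hj]; exact (congrArg (fun L => L (0 : TangentSpace (I j) (x j))) h0).symm)
    · exact ((g j).pos _ _ hj).le
  isVonNBounded x := by
    have hnn : ∀ j (u : TangentSpace (I j) (x j)), 0 ≤ (g j).inner (x j) u u := by
      intro j u
      by_cases hu : u = 0
      · simp [hu]
      · exact ((g j).pos _ _ hu).le
    refine (Bornology.isVonNBounded_pi_iff (𝕜 := ℝ) (E := E)).2 fun i => ?_
    have hb := ((g i).isVonNBounded (x i)).image
      ((f i x)⁻¹ • ContinuousLinearMap.id ℝ (TangentSpace (I i) (x i)))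
    refine hb.subset ?_
    rintro _ ⟨v, hv, rfl⟩
    have hfi := hpos i x
    refine ⟨f i x • (v i : TangentSpace (I i) (x i)), ?_, ?_⟩
    · have hv' := (multiconformalForm_apply g f x v v).symm.trans_lt hv
      have hle := Finset.single_le_sum (f := fun j => (f j x) ^ 2 * (g j).inner (x j)
        ((v : ∀ j, E j) j) ((v : ∀ j, E j) j))
        (fun j _ => mul_nonneg (sq_nonneg _) (hnn j _)) (Finset.mem_univ i)
      refine lt_of_eq_of_lt ?_ (hle.trans_lt hv')
      have h1 : ∀ (c : ℝ) (u : TangentSpace (I i) (x i)),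
          (g i).inner (x i) (c • u) (c • u) = c ^ 2 * (g i).inner (x i) u u := by
        intro c u
        rw [map_smul, map_smul, smul_apply, smul_eq_mul, smul_eq_mul]
        ring
      exact h1 _ _
    · change (f i x)⁻¹ • (f i x • (v i : E i)) = v i
      rw [smul_smul, inv_mul_cancel₀ hfi.ne', one_smul]
  contMDiff := multiconformalForm_contMDiff g f hf

/-- The direct product metric `g_1 ⊕ ⋯ ⊕ g_l`. -/
def productMetric [∀ i, IsManifold (I i) ∞ (M i)] (g : ∀ i, RiemannianMetricOn (I i) (M i)) :
    RiemannianMetricOn (ModelWithCorners.pi I) (∀ i, M i) :=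
  multiconformalMetric g (fun _ _ => 1) (fun _ => contMDiff_const) (fun _ _ => one_pos)

/-- The multiconformal class `{f_1² g_1 ⊕ ⋯ ⊕ f_l² g_l | f_1, …, f_l ∈ C^∞_+(M)}` of the direct
product metric `g_1 ⊕ ⋯ ⊕ g_l` on `M = M_1 × ⋯ × M_l`. -/
def multiconformalClass [∀ i, IsManifold (I i) ∞ (M i)]
    (g : ∀ i, RiemannianMetricOn (I i) (M i)) :
    Set (RiemannianMetricOn (ModelWithCorners.pi I) (∀ i, M i)) :=
  {h | ∃ (f : ι → (∀ j, M j) → ℝ)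
    (hf : ∀ i, ContMDiff (ModelWithCorners.pi I) 𝓘(ℝ, ℝ) ∞ (f i)) (hpos : ∀ i x, 0 < f i x),
    h = multiconformalMetric g f hf hpos}

variable [DecidableEq ι]

variable (E) in
/-- The projection `P_i` of the tangent space `∏ j, E j` of the product manifold onto its `i`-th
summand, as an endomorphism. The charts of the product manifold are products of charts of the
factors, so this is its expression in all of them. -/
def factorProj (i : ι) : (∀ j, E j) →L[ℝ] ∀ j, E j :=
  (ContinuousLinearMap.single ℝ E i).comp (ContinuousLinearMap.proj i)

variable [∀ i, IsManifold (I i) ∞ (M i)] [∀ i, FiniteDimensional ℝ (E i)]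

/-- `R_i^g = tr^g (Ric^g(P_i ·, P_i ·))`. -/
def partialScalarCurvature (g : RiemannianMetricOn (ModelWithCorners.pi I) (∀ i, M i)) (i : ι)
    (x : ∀ i, M i) : ℝ :=
  metricTrace (chartMetric g x (extChartAt (ModelWithCorners.pi I) x x)) fun u v =>
    ricci (chartMetric g x) (extChartAt (ModelWithCorners.pi I) x x)
      (factorProj E i u) (factorProj E i v)

/-- `Δ_i^g φ = tr^g (Hess^g φ (P_i ·, P_i ·))`. -/
def partialLaplacian (g : RiemannianMetricOn (ModelWithCorners.pi I) (∀ i, M i)) (i : ι)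
    (φ : (∀ i, M i) → ℝ) (x : ∀ i, M i) : ℝ :=
  metricTrace (chartMetric g x (extChartAt (ModelWithCorners.pi I) x x)) fun u v =>
    hessian (chartMetric g x) (φ ∘ (extChartAt (ModelWithCorners.pi I) x).symm)
      (extChartAt (ModelWithCorners.pi I) x x) (factorProj E i u) (factorProj E i v)

/-- `⟨grad_i^g φ, grad_i^g ψ⟩`, where `grad_i^g φ = P_i (grad^g φ)`. -/
def partialGradInner (g : RiemannianMetricOn (ModelWithCorners.pi I) (∀ i, M i)) (i : ι)
    (φ ψ : (∀ i, M i) → ℝ) (x : ∀ i, M i) : ℝ :=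
  chartMetric g x (extChartAt (ModelWithCorners.pi I) x x)
    (factorProj E i (gradient (chartMetric g x)
      (φ ∘ (extChartAt (ModelWithCorners.pi I) x).symm)
      (extChartAt (ModelWithCorners.pi I) x x)))
    (factorProj E i (gradient (chartMetric g x)
      (ψ ∘ (extChartAt (ModelWithCorners.pi I) x).symm)
      (extChartAt (ModelWithCorners.pi I) x x)))

/-- The function `ρ_i^g(f_1, …, f_l)` on the product manifold (`m_j = dim M_j`). -/
def rho (g : RiemannianMetricOn (ModelWithCorners.pi I) (∀ i, M i))
    (f : ι → (∀ j, M j) → ℝ) (i : ι) (x : ∀ i, M i) : ℝ :=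
  let m : ι → ℝ := (fun j => (finrank ℝ (E j) : ℝ));
  -2 * (m i - 1) * (partialLaplacian g i (f i) x / f i x)
    - 2 * (∑ j ∈ Finset.univ.erase i, m j * (partialLaplacian g i (f j) x / f j x))
    - (m i - 1) * (m i - 4) * (partialGradInner g i (f i) (f i) x / f i x ^ 2)
    - 2 * (m i - 2) * (∑ j ∈ Finset.univ.erase i,
        m j * (partialGradInner g i (f i) (f j) x / (f i x * f j x)))
    - (∑ j ∈ Finset.univ.erase i,
        m j * (m j - 1) * (partialGradInner g i (f j) (f j) x / f j x ^ 2))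
    - (∑ j ∈ Finset.univ.erase i, ∑ k ∈ (Finset.univ.erase i).erase j,
        m j * m k * (partialGradInner g i (f j) (f k) x / (f j x * f k x)))

end Pi

end Multiconformal

end

/-! The scalar curvature of `f_1² g_1 ⊕ ⋯ ⊕ f_l² g_l` splits as `∑ k, (R_k + ρ_k) / f_k²`
(`scalarCurvature_multiconformalMetric`). Each `ρ_k` is homogeneous of degree zero in every `f_j`
separately, so it does not change when `f_j` is replaced by `c_j f_j` with constants `c_j`
(`rho_smul`), while the volume measure is multiplied by `∏ c_j ^ m_j`
(`riemannianVolume_multiconformalMetric`). With `n = ∑_{j ≠ i} m_j`, take `c_i = t^{-n}` and `c_j =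
t^{m_i}` for `j ≠ i`. Then the volume measure is fixed, the `i`-th curvature term is multiplied by
`t^{2n}` and all the others by `t^{-2 m_i} ≤ 1`. The integral of the `i`-th term is negative, so the
functional tends to `-∞` as `t → ∞` (`exists_einsteinHilbert_lt`).

The work lies in the curvature formula. Scalar curvature, the partial traces of Ricci and Hessian,
and gradients are compatible with product changes of coordinates. On each factor there are
coordinates in which the first derivatives of `g_k` vanish at a given point
(`IsMetricOn.exists_normal_coordinates`). In an orthonormal basis at that point the Christoffel
symbols of the multiconformal metric involve only the logarithmic derivatives of the `f_k`, and its
second derivatives separate into an intrinsic part, which gives `R_k`, and a part in the `f_k`.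
Summing over the basis turns the latter into `ρ_k`, one basis vector at a time (`rhoForm_mul_self`).

On the measure side, chart densities transform by Jacobians. This gives the volume factor and, on a
compact manifold, finiteness of the volume (`isFiniteMeasure_riemannianVolume`), which is needed for
the integrals to split. -/

noncomputable section

namespace Multiconformal

/-! ### Inner products, orthonormal bases and contractions -/

section LinearAlgebra

variable {E : Type*} [NormedAddCommGroup E] [NormedSpace ℝ E]

/-- `B` is a (symmetric positive definite) inner product. -/
structure IsInnerForm (B : E →L[ℝ] E →L[ℝ] ℝ) : Prop where
  symm : ∀ u v, B u v = B v u
  pos : ∀ v, v ≠ 0 → 0 < B v v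

lemma pullbackForm_apply {W : Type*} [NormedAddCommGroup W] [NormedSpace ℝ W]
    (B : E →L[ℝ] E →L[ℝ] ℝ) (D : W →L[ℝ] E) (v w : W) :
    pullbackForm B D v w = B (D v) (D w) := rfl

lemma IsInnerForm.pullback {W : Type*} [NormedAddCommGroup W] [NormedSpace ℝ W]
    {B : E →L[ℝ] E →L[ℝ] ℝ} (hB : IsInnerForm B) {D : W →L[ℝ] E}
    (hD : Function.Injective D) : IsInnerForm (pullbackForm B D) where
  symm _ _ := hB.symm _ _
  pos _ hv := hB.pos _ fun h => hv (hD (h.trans (map_zero D).symm))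

lemma IsInnerForm.eq_of_inner {B : E →L[ℝ] E →L[ℝ] ℝ} (hB : IsInnerForm B) {u v : E}
    (h : ∀ w, B u w = B v w) : u = v := by
  by_contra hne
  have := hB.pos _ (sub_ne_zero.2 hne)
  rw [map_sub B, sub_apply, h, sub_self] at this
  exact lt_irrefl _ this

/-- `e` is an orthonormal basis for the inner product `B`. -/
def IsOrthonormalBasis {κ : Type*} [DecidableEq κ] (B : E →L[ℝ] E →L[ℝ] ℝ)
    (e : Basis κ ℝ E) : Prop :=
  ∀ a b, B (e a) (e b) = if a = b then 1 else 0

lemma IsInnerForm.exists_isOrthonormalBasis [FiniteDimensional ℝ E] {B : E →L[ℝ] E →L[ℝ] ℝ}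
    (hB : IsInnerForm B) : ∃ e : Basis (Fin (finrank ℝ E)) ℝ E, IsOrthonormalBasis B e := by
  let B' : LinearMap.BilinForm ℝ E := LinearMap.mk₂ ℝ (fun u v => B u v)
    (by simp) (by simp) (by simp) (by simp)
  have hs : LinearMap.IsSymm B' := ⟨fun u v => hB.symm u v⟩
  obtain ⟨v, hv⟩ := LinearMap.BilinForm.exists_orthogonal_basis hs
  have hpos : ∀ a, 0 < B (v a) (v a) := fun a => hB.pos _ (v.ne_zero a)
  have hu : ∀ a, IsUnit (Real.sqrt (B (v a) (v a)))⁻¹ := fun a =>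
    (inv_ne_zero (Real.sqrt_pos.2 (hpos a)).ne').isUnit
  refine ⟨v.isUnitSMul hu, fun a b => ?_⟩
  rw [Basis.isUnitSMul_apply, Basis.isUnitSMul_apply]
  simp only [map_smul, smul_apply, smul_eq_mul]
  split_ifs with h
  · subst h
    have h1 := Real.mul_self_sqrt (hpos a).le
    have h2 := (Real.sqrt_pos.2 (hpos a)).ne'
    field_simp
    nlinarith
  · have : B (v a) (v b) = 0 := hv h
    rw [this]; simp

section Orthonormal

variable {κ : Type*} [Fintype κ] [DecidableEq κ] {B : E →L[ℝ] E →L[ℝ] ℝ} {e : Basis κ ℝ E}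

lemma IsOrthonormalBasis.repr_eq (he : IsOrthonormalBasis B e) (v : E)
    (a : κ) : e.repr v a = B v (e a) := by
  conv_rhs => rw [← e.sum_repr v]
  simp only [map_sum, map_smul, sum_apply, smul_apply, he _ _, smul_eq_mul, mul_ite, mul_one,
    mul_zero, Finset.sum_ite_eq', Finset.mem_univ, if_true]

lemma IsOrthonormalBasis.sum_smul (he : IsOrthonormalBasis B e) (v : E) :
    ∑ a, B v (e a) • e a = v := by
  conv_rhs => rw [← e.sum_repr v]
  simp only [he.repr_eq]

lemma IsOrthonormalBasis.inner_eq (he : IsOrthonormalBasis B e) (v w : E) :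
    B v w = ∑ a, B v (e a) * B w (e a) := by
  conv_lhs => rw [← he.sum_smul w]
  simp [mul_comm]

variable [FiniteDimensional ℝ E]

/-- The inverse metric is the tensor `∑ a, e_a ⊗ e_a`, here written in the basis `finBasis`.
Multiplying by the Gram matrix gives the expansion of `finBasis ℝ E i` in the orthonormal basis,
hence the identity matrix. -/
lemma IsOrthonormalBasis.gram_inv (he : IsOrthonormalBasis B e)
    (i j : Fin (finrank ℝ E)) :
    (gram B)⁻¹ i j = ∑ a, (finBasis ℝ E).repr (e a) i * (finBasis ℝ E).repr (e a) j := by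
  have key : gram B * (Matrix.of fun i j => ∑ a, (finBasis ℝ E).repr (e a) i *
      (finBasis ℝ E).repr (e a) j) = 1 := by
    ext i k
    simp only [Matrix.mul_apply, gram, Matrix.of_apply, Finset.mul_sum]
    rw [Finset.sum_comm]
    have h1 : ∀ a, ∑ x, B (finBasis ℝ E i) (finBasis ℝ E x) *
        ((finBasis ℝ E).repr (e a) x * (finBasis ℝ E).repr (e a) k) =
        B (finBasis ℝ E i) (e a) * (finBasis ℝ E).repr (e a) k := by
      intro a
      conv_rhs => rw [← (finBasis ℝ E).sum_repr (e a)]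
      simp only [map_sum, map_smul, smul_eq_mul, Finset.sum_mul, Basis.repr_self]
      refine Finset.sum_congr rfl fun x _ => ?_
      rw [Finsupp.coe_finsetSum, Finset.sum_apply]
      simp only [Finsupp.smul_apply, Finsupp.single_apply, smul_eq_mul, mul_ite, mul_one, mul_zero,
        Finset.sum_ite_eq', Finset.mem_univ, if_true]
      ring
    rw [Finset.sum_congr rfl fun a _ => h1 a]
    have h2 := congrArg (fun v => (finBasis ℝ E).repr v k) (he.sum_smul (finBasis ℝ E i))
    simp only [map_sum, map_smul, Basis.repr_self] at h2
    rw [Finsupp.coe_finsetSum, Finset.sum_apply] at h2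
    simp only [Finsupp.smul_apply, smul_eq_mul] at h2
    rw [h2, Finsupp.single_apply, Matrix.one_apply]
  rw [Matrix.inv_eq_right_inv key]
  rfl

/-- Contraction with the inverse metric may be computed in any orthonormal basis. Values in a
general `W` cover both traces (`W = ℝ`) and the operation `sharp` (`W = E`). -/
lemma IsOrthonormalBasis.sum_gram_inv (he : IsOrthonormalBasis B e)
    {W : Type*} [AddCommGroup W] [Module ℝ W] (S : E →ₗ[ℝ] E →ₗ[ℝ] W) :
    ∑ i, ∑ j, (gram B)⁻¹ i j • S (finBasis ℝ E i) (finBasis ℝ E j) = ∑ a, S (e a) (e a) := by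
  have h : ∀ a, S (e a) (e a) = ∑ i, ∑ j, ((finBasis ℝ E).repr (e a) i *
      (finBasis ℝ E).repr (e a) j) • S (finBasis ℝ E i) (finBasis ℝ E j) := by
    intro a
    conv_lhs => rw [← (finBasis ℝ E).sum_repr (e a)]
    simp only [map_sum, map_smul, LinearMap.sum_apply, LinearMap.smul_apply, Finset.smul_sum,
      smul_smul]
    rw [Finset.sum_comm]
    refine Finset.sum_congr rfl fun i _ => Finset.sum_congr rfl fun j _ => ?_
    rw [mul_comm]
  rw [Finset.sum_congr rfl fun a _ => h a, Finset.sum_comm (s := (Finset.univ : Finset κ))]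
  refine Finset.sum_congr rfl fun i _ => ?_
  rw [Finset.sum_comm]
  refine Finset.sum_congr rfl fun j _ => ?_
  rw [he.gram_inv, Finset.sum_smul]

lemma IsOrthonormalBasis.metricTrace_eq (he : IsOrthonormalBasis B e)
    (S : E →ₗ[ℝ] E →ₗ[ℝ] ℝ) : metricTrace B (fun u v => S u v) = ∑ a, S (e a) (e a) :=
  he.sum_gram_inv S

lemma IsOrthonormalBasis.sharp_eq (he : IsOrthonormalBasis B e)
    (α : E →ₗ[ℝ] ℝ) : sharp B α = ∑ a, α (e a) • e a := by
  have := he.sum_gram_inv (LinearMap.mk₂ ℝ (fun u v => α v • u) (by simp)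
    (by intros; exact smul_comm _ _ _) (by simp [add_smul]) (by simp [mul_smul]))
  simp only [LinearMap.mk₂_apply, smul_smul] at this
  exact this

end Orthonormal

variable [FiniteDimensional ℝ E] {B : E →L[ℝ] E →L[ℝ] ℝ}

lemma IsInnerForm.inner_sharp (hB : IsInnerForm B) (α : E →ₗ[ℝ] ℝ) (w : E) :
    B (sharp B α) w = α w := by
  obtain ⟨e, he⟩ := hB.exists_isOrthonormalBasis
  rw [he.sharp_eq]
  conv_rhs => rw [← he.sum_smul w]
  simp only [map_sum, map_smul, sum_apply, smul_apply, smul_eq_mul]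
  exact Finset.sum_congr rfl fun a _ => by rw [hB.symm w, mul_comm]

lemma IsInnerForm.gram_det_pos (hB : IsInnerForm B) : 0 < (gram B).det := by
  have hP : (gram B).PosDef := by
    refine Matrix.PosDef.of_dotProduct_mulVec_pos ?_ ?_
    · ext a b
      simp [gram, hB.symm (finBasis ℝ E b)]
    · intro x hx
      have hne : ∑ a, x a • finBasis ℝ E a ≠ 0 := by
        intro h0
        exact hx (funext fun a => Fintype.linearIndependent_iff.1
          (finBasis ℝ E).linearIndependent x h0 a)
      have := hB.pos _ hne
      simp only [map_sum, map_smul, sum_apply, smul_apply, smul_eq_mul] at this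
      simp only [dotProduct, Matrix.mulVec, gram, Matrix.of_apply, star_trivial]
      refine lt_of_lt_of_eq this ?_
      simp only [Finset.mul_sum]
      rw [Finset.sum_comm]
      exact Finset.sum_congr rfl fun a _ => Finset.sum_congr rfl fun b _ => by ring
  exact hP.det_pos

/-- The Gram matrix changes by congruence with the matrix of `D`. This serves twice: for the
Jacobian in a change of charts, and for the volume factor of a multiconformal metric. -/
lemma gram_pullbackForm_det (B : E →L[ℝ] E →L[ℝ] ℝ) (D : E →L[ℝ] E) :
    (gram (pullbackForm B D)).det = D.det ^ 2 * (gram B).det := by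
  have h : gram (pullbackForm B D) =
      (LinearMap.toMatrix (finBasis ℝ E) (finBasis ℝ E) D.toLinearMap).transpose * gram B *
        LinearMap.toMatrix (finBasis ℝ E) (finBasis ℝ E) D.toLinearMap := by
    ext a b
    simp only [gram, Matrix.of_apply, pullbackForm_apply, Matrix.mul_apply, Matrix.transpose_apply,
      LinearMap.toMatrix_apply, ContinuousLinearMap.coe_coe]
    conv_lhs => rw [← (finBasis ℝ E).sum_repr (D (finBasis ℝ E a)),
      ← (finBasis ℝ E).sum_repr (D (finBasis ℝ E b))]
    simp only [map_sum, map_smul, sum_apply, smul_apply, smul_eq_mul,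
      Finset.mul_sum, Finset.sum_mul]
    refine Finset.sum_congr rfl fun i _ => Finset.sum_congr rfl fun j _ => ?_
    ring
  rw [h, Matrix.det_mul, Matrix.det_mul, Matrix.det_transpose, LinearMap.det_toMatrix]
  change LinearMap.det D.toLinearMap * _ * LinearMap.det D.toLinearMap =
    (LinearMap.det D.toLinearMap) ^ 2 * _
  ring

end LinearAlgebra

/-! ### Levi-Civita connection and curvature in coordinates -/

section LocalGeometry

variable {E : Type*} [NormedAddCommGroup E] [NormedSpace ℝ E]

/-- `G` is a smooth Riemannian metric on the open set `U` of the vector space `E`. -/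
structure IsMetricOn (U : Set E) (G : E → E →L[ℝ] E →L[ℝ] ℝ) : Prop where
  isOpen : IsOpen U
  contDiffOn : ContDiffOn ℝ ∞ G U
  inner : ∀ y ∈ U, IsInnerForm (G y)

lemma _root_.ContDiffOn.fderiv_top {F : Type*} [NormedAddCommGroup F] [NormedSpace ℝ F] {U : Set E}
    {f : E → F} (hf : ContDiffOn ℝ ∞ f U) (hU : IsOpen U) : ContDiffOn ℝ ∞ (fderiv ℝ f) U :=
  hf.fderiv_of_isOpen hU (by simp)

lemma _root_.ContDiffOn.hasFDerivAt_top {F : Type*} [NormedAddCommGroup F] [NormedSpace ℝ F]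
    {U : Set E} {f : E → F} (hf : ContDiffOn ℝ ∞ f U) (hU : IsOpen U) {y : E} (hy : y ∈ U) :
    HasFDerivAt f (fderiv ℝ f y) y :=
  ((hf.contDiffAt (hU.mem_nhds hy)).differentiableAt (by simp)).hasFDerivAt

lemma _root_.ContDiffOn.fderiv_fderiv_comm {F : Type*} [NormedAddCommGroup F] [NormedSpace ℝ F]
    {U : Set E} {f : E → F} (hf : ContDiffOn ℝ ∞ f U) (hU : IsOpen U) {y : E} (hy : y ∈ U)
    (u v : E) : fderiv ℝ (fderiv ℝ f) y u v = fderiv ℝ (fderiv ℝ f) y v u :=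
  (hf.contDiffAt (hU.mem_nhds hy)).isSymmSndFDerivAt (by
    rw [minSmoothness_of_isRCLikeNormedField]
    exact WithTop.coe_le_coe.2 (le_top : (2 : ℕ∞) ≤ ⊤)) u v

lemma contDiffOn_matrix_det {n : Type*} [Fintype n] [DecidableEq n] {U : Set E}
    {A : E → Matrix n n ℝ} (hA : ∀ i j, ContDiffOn ℝ ∞ (fun z => A z i j) U) :
    ContDiffOn ℝ ∞ (fun z => (A z).det) U := by
  simp only [Matrix.det_apply]
  exact ContDiffOn.sum fun σ _ => (contDiffOn_prod fun i _ => hA _ _).const_smul _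

lemma contDiffOn_matrix_inv {n : Type*} [Fintype n] [DecidableEq n] {U : Set E}
    {A : E → Matrix n n ℝ} (hA : ∀ i j, ContDiffOn ℝ ∞ (fun z => A z i j) U)
    (h0 : ∀ z ∈ U, (A z).det ≠ 0) (i j : n) : ContDiffOn ℝ ∞ (fun z => (A z)⁻¹ i j) U := by
  simp only [Matrix.inv_def, Matrix.smul_apply, Matrix.adjugate_apply, Ring.inverse_eq_inv',
    smul_eq_mul]
  refine ((contDiffOn_matrix_det hA).inv h0).mul (contDiffOn_matrix_det fun k l => ?_)
  simp only [Matrix.updateRow_apply]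
  split_ifs
  · exact contDiffOn_const
  · exact hA k l

/-- The second derivatives `∂_u ∂_v (G(w, z))` of the metric coefficients. -/
def metricHess (G : E → E →L[ℝ] E →L[ℝ] ℝ) (y u v w z : E) : ℝ :=
  fderiv ℝ (fderiv ℝ fun x => G x w z) y u v

/-- The Christoffel symbols of the first kind. -/
def koszul (G : E → E →L[ℝ] E →L[ℝ] ℝ) (y u v : E) : E →ₗ[ℝ] ℝ where
  toFun w := (1 / 2 : ℝ) * (fderiv ℝ G y u v w + fderiv ℝ G y v u w - fderiv ℝ G y w u v)
  map_add' w w' := by simp; ring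
  map_smul' c w := by simp; ring

lemma koszul_apply (G : E → E →L[ℝ] E →L[ℝ] ℝ) (y u v w : E) :
    koszul G y u v w =
      (1 / 2 : ℝ) * (fderiv ℝ G y u v w + fderiv ℝ G y v u w - fderiv ℝ G y w u v) := rfl

namespace IsMetricOn

variable {U : Set E} {G : E → E →L[ℝ] E →L[ℝ] ℝ} (hG : IsMetricOn U G) {y : E} (hy : y ∈ U)

include hG in
lemma contDiffOn_apply_apply (v w : E) : ContDiffOn ℝ ∞ (fun z => G z v w) U :=
  (hG.contDiffOn.clm_apply contDiffOn_const).clm_apply contDiffOn_const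

include hG hy

lemma metricHess_comm (u v w z : E) : metricHess G y u v w z = metricHess G y v u w z :=
  (hG.contDiffOn_apply_apply w z).fderiv_fderiv_comm hG.isOpen hy u v

lemma metricHess_symm (u v w z : E) : metricHess G y u v w z = metricHess G y u v z w := by
  have : (fun x => G x w z) =ᶠ[𝓝 y] fun x => G x z w := by
    filter_upwards [hG.isOpen.mem_nhds hy] with x hx
    exact (hG.inner x hx).symm w z
  rw [metricHess, this.fderiv.fderiv_eq, metricHess]

lemma fderiv_apply_apply (u v w : E) :
    fderiv ℝ (fun z => G z v w) y u = fderiv ℝ G y u v w := by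
  have h := hG.contDiffOn.hasFDerivAt_top hG.isOpen hy
  have := ((h.clm_apply (hasFDerivAt_const v y)).clm_apply (hasFDerivAt_const w y)).fderiv
  rw [this]; simp

lemma fderiv_symm (u v w : E) : fderiv ℝ G y u v w = fderiv ℝ G y u w v := by
  rw [← hG.fderiv_apply_apply hy, ← hG.fderiv_apply_apply hy]
  congr 1
  refine Filter.EventuallyEq.fderiv_eq ?_
  filter_upwards [hG.isOpen.mem_nhds hy] with z hz
  exact (hG.inner z hz).symm v w

/-- This is metric compatibility of the connection. Conversely to the Koszul formula, it recovers
the first derivatives of the metric from the Christoffel symbols. -/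
lemma koszul_add_koszul (u v w : E) :
    koszul G y u v w + koszul G y u w v = fderiv ℝ G y u v w := by
  rw [koszul_apply, koszul_apply, hG.fderiv_symm hy u w v]
  ring

lemma koszul_symm (u v w : E) : koszul G y u v w = koszul G y v u w := by
  rw [koszul_apply, koszul_apply, hG.fderiv_symm hy w v u]
  ring

end IsMetricOn

variable [FiniteDimensional ℝ E]

lemma sharp_add (B : E →L[ℝ] E →L[ℝ] ℝ) (α β : E → ℝ) :
    sharp B (fun w => α w + β w) = sharp B α + sharp B β := by
  simp [sharp, mul_add, add_smul, Finset.sum_add_distrib]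

lemma sharp_smul (B : E →L[ℝ] E →L[ℝ] ℝ) (c : ℝ) (α : E → ℝ) :
    sharp B (fun w => c * α w) = c • sharp B α := by
  simp only [sharp, Finset.smul_sum, smul_smul]
  exact Finset.sum_congr rfl fun a _ => Finset.sum_congr rfl fun b _ => by congr 1; ring

/-- The Christoffel symbols as a bilinear map. -/
def christoffelL (G : E → E →L[ℝ] E →L[ℝ] ℝ) (y : E) : E →L[ℝ] E →L[ℝ] E :=
  (LinearMap.mk₂ ℝ (fun u v => christoffel G y u v)
    (fun u u' v => by
      rw [christoffel, christoffel, christoffel, ← sharp_add]; congr 1; ext w; simp; ring)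
    (fun c u v => by
      rw [christoffel, christoffel, ← sharp_smul]; congr 1; ext w; simp; ring)
    (fun u v v' => by
      rw [christoffel, christoffel, christoffel, ← sharp_add]; congr 1; ext w; simp; ring)
    (fun c u v => by
      rw [christoffel, christoffel, ← sharp_smul]; congr 1; ext w; simp; ring)
    ).toContinuousBilinearMap

lemma christoffelL_apply (G : E → E →L[ℝ] E →L[ℝ] ℝ) (y u v : E) :
    christoffelL G y u v = christoffel G y u v := rfl

lemma christoffel_congr {G G' : E → E →L[ℝ] E →L[ℝ] ℝ} {y : E} (h : G =ᶠ[𝓝 y] G') (u v : E) :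
    christoffel G y u v = christoffel G' y u v := by
  rw [christoffel, christoffel, h.fderiv_eq, h.eq_of_nhds]

lemma curvature_congr {G G' : E → E →L[ℝ] E →L[ℝ] ℝ} {y : E} (h : G =ᶠ[𝓝 y] G') (u v w : E) :
    curvature G y u v w = curvature G' y u v w := by
  have h1 : ∀ u v, (fun z => christoffel G z u v) =ᶠ[𝓝 y] fun z => christoffel G' z u v :=
    fun u v => h.eventually_nhds.mono fun z hz => christoffel_congr hz u v
  simp only [curvature, (h1 _ _).fderiv_eq, christoffel_congr h]

lemma ricci_congr {G G' : E → E →L[ℝ] E →L[ℝ] ℝ} {y : E} (h : G =ᶠ[𝓝 y] G') (v w : E) :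
    ricci G y v w = ricci G' y v w := by
  simp only [ricci, curvature_congr h]

lemma hessian_congr {G G' : E → E →L[ℝ] E →L[ℝ] ℝ} {φ φ' : E → ℝ} {y : E} (h : G =ᶠ[𝓝 y] G')
    (hφ : φ =ᶠ[𝓝 y] φ') (v w : E) :
    hessian G φ y v w = hessian G' φ' y v w := by
  simp only [hessian, christoffel_congr h, hφ.fderiv_eq, hφ.fderiv.fderiv_eq]

namespace IsMetricOn

variable {U : Set E} {G : E → E →L[ℝ] E →L[ℝ] ℝ} (hG : IsMetricOn U G)

include hG

lemma contDiffOn_gram (a b : Fin (finrank ℝ E)) : ContDiffOn ℝ ∞ (fun z => gram (G z) a b) U :=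
  (hG.contDiffOn.clm_apply contDiffOn_const).clm_apply contDiffOn_const

lemma contDiffOn_gram_inv (a b : Fin (finrank ℝ E)) :
    ContDiffOn ℝ ∞ (fun z => (gram (G z))⁻¹ a b) U :=
  contDiffOn_matrix_inv hG.contDiffOn_gram (fun z hz => (hG.inner z hz).gram_det_pos.ne') a b

lemma contDiffOn_christoffelL : ContDiffOn ℝ ∞ (christoffelL G) U := by
  rw [contDiffOn_clm_apply]
  intro u
  rw [contDiffOn_clm_apply]
  intro v
  have hD := hG.contDiffOn.fderiv_top hG.isOpen
  have hD' : ∀ a b c : E, ContDiffOn ℝ ∞ (fun z => fderiv ℝ G z a b c) U := fun a b c =>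
    ((hD.clm_apply contDiffOn_const).clm_apply contDiffOn_const).clm_apply contDiffOn_const
  simp only [christoffelL_apply, christoffel, sharp]
  refine ContDiffOn.sum fun a _ => ContDiffOn.sum fun b _ => ContDiffOn.smul ?_ contDiffOn_const
  exact (hG.contDiffOn_gram_inv a b).mul (contDiffOn_const.mul
    (((hD' _ _ _).add (hD' _ _ _)).sub (hD' _ _ _)))

variable {y : E} (hy : y ∈ U)

include hy

lemma inner_christoffelL (u v w : E) : G y (christoffelL G y u v) w = koszul G y u v w :=
  (hG.inner y hy).inner_sharp (koszul G y u v) w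

lemma christoffelL_symm (u v : E) : christoffelL G y u v = christoffelL G y v u :=
  (hG.inner y hy).eq_of_inner fun w => by
    rw [hG.inner_christoffelL hy, hG.inner_christoffelL hy, hG.koszul_symm hy]

lemma hasFDerivAt_christoffelL :
    HasFDerivAt (christoffelL G) (fderiv ℝ (christoffelL G) y) y :=
  hG.contDiffOn_christoffelL.hasFDerivAt_top hG.isOpen hy

/-- Derivatives of `christoffel` on fixed vectors become one derivative of the bilinear-map-valued
function `christoffelL`; in this form linearity of the curvature in each argument is visible. -/
lemma curvature_eq (u v w : E) : curvature G y u v w =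
    fderiv ℝ (christoffelL G) y u v w - fderiv ℝ (christoffelL G) y v u w
      + christoffelL G y u (christoffelL G y v w) - christoffelL G y v (christoffelL G y u w) := by
  have h := hG.hasFDerivAt_christoffelL hy
  have h1 : ∀ a b c, fderiv ℝ (fun z => christoffel G z b c) y a =
      fderiv ℝ (christoffelL G) y a b c := fun a b c => by
    have := ((h.clm_apply (hasFDerivAt_const b y)).clm_apply (hasFDerivAt_const c y)).fderiv
    simp only [christoffelL_apply] at this
    rw [this]; simp
  rw [curvature, h1, h1]
  rfl

/-- The derivative of the Christoffel symbols of the first kind. -/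
lemma inner_fderiv_christoffelL (u v w z : E) :
    G y (fderiv ℝ (christoffelL G) y u v w) z =
      (1 / 2 : ℝ) * (metricHess G y u v w z + metricHess G y u w v z
        - metricHess G y u z v w)
      - G y (christoffelL G y u (christoffelL G y v w)) z
      - G y (christoffelL G y u z) (christoffelL G y v w) := by
  have hΓ := hG.hasFDerivAt_christoffelL hy
  have hG1 := hG.contDiffOn.hasFDerivAt_top hG.isOpen hy
  have hL := (hG1.clm_apply ((hΓ.clm_apply (hasFDerivAt_const v y)).clm_apply
    (hasFDerivAt_const w y))).clm_apply (hasFDerivAt_const z y)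
  have hD : ∀ a b c : E, HasFDerivAt (fun x => fderiv ℝ (fun x' => G x' b c) x a) _ y :=
    fun a b c => (((hG.contDiffOn_apply_apply b c).fderiv_top hG.isOpen).hasFDerivAt_top
      hG.isOpen hy).clm_apply (hasFDerivAt_const a y)
  have hR := (((hD v w z).add (hD w v z)).sub (hD z v w)).const_mul (1 / 2 : ℝ)
  -- The defining identity of the Christoffel symbols holds on all of `U`, so both sides can be
  -- differentiated at `y`.
  have hEq : (fun x => G x (christoffelL G x v w) z) =ᶠ[𝓝 y]
      fun x => (1 / 2 : ℝ) * (fderiv ℝ (fun x' => G x' w z) x v + fderiv ℝ (fun x' => G x' v z) x w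
        - fderiv ℝ (fun x' => G x' v w) x z) := by
    filter_upwards [hG.isOpen.mem_nhds hy] with x hx
    rw [hG.inner_christoffelL hx, hG.fderiv_apply_apply hx, hG.fderiv_apply_apply hx,
      hG.fderiv_apply_apply hx]
    rfl
  have hu := congrArg (fun L => L u) (hL.unique (hR.congr_of_eventuallyEq hEq))
  simp [← metricHess.eq_def] at hu
  -- The product rule leaves a term `∂_u G` applied to `Γ(v, w)` and `z`; metric compatibility
  -- rewrites it in Christoffel symbols.
  have hc := hG.koszul_add_koszul hy u (christoffelL G y v w) z
  rw [← hG.inner_christoffelL hy, ← hG.inner_christoffelL hy] at hc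
  linarith

/-- The curvature tensor with all indices lowered. -/
lemma inner_curvature (u v w z : E) :
    G y (curvature G y u v w) z =
      (1 / 2 : ℝ) * (metricHess G y u v w z + metricHess G y u w v z
        - metricHess G y u z v w)
      - (1 / 2 : ℝ) * (metricHess G y v u w z + metricHess G y v w u z
        - metricHess G y v z u w)
      - G y (christoffelL G y u z) (christoffelL G y v w)
      + G y (christoffelL G y v z) (christoffelL G y u w) := by
  rw [hG.curvature_eq hy]
  simp only [map_add, map_sub, add_apply, sub_apply]
  rw [hG.inner_fderiv_christoffelL hy, hG.inner_fderiv_christoffelL hy]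
  ring

/-- The Ricci tensor as a bilinear map. -/
def ricciL : E →ₗ[ℝ] E →ₗ[ℝ] ℝ :=
  LinearMap.mk₂ ℝ (ricci G y)
    (fun v v' w => by
      simp only [ricci, hG.curvature_eq hy, ← Finset.sum_add_distrib]
      refine Finset.sum_congr rfl fun a _ => ?_
      rw [← map_add]; congr 1; simp; abel)
    (fun c v w => by
      simp only [ricci, hG.curvature_eq hy, smul_eq_mul, Finset.mul_sum]
      refine Finset.sum_congr rfl fun a _ => ?_
      rw [← smul_eq_mul, ← map_smul]; congr 1; simp [smul_sub, smul_add])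
    (fun v w w' => by
      simp only [ricci, hG.curvature_eq hy, ← Finset.sum_add_distrib]
      refine Finset.sum_congr rfl fun a _ => ?_
      rw [← map_add]; congr 1; simp; abel)
    (fun c v w => by
      simp only [ricci, hG.curvature_eq hy, smul_eq_mul, Finset.mul_sum]
      refine Finset.sum_congr rfl fun a _ => ?_
      rw [← smul_eq_mul, ← map_smul]; congr 1; simp [smul_sub, smul_add])

variable {κ : Type*} [Fintype κ] [DecidableEq κ] {e : Basis κ ℝ E}

/-- The Ricci tensor is the trace of an endomorphism, which does not depend on the basis; in an
orthonormal basis the coordinates are inner products. -/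
lemma ricci_eq_sum (he : IsOrthonormalBasis (G y) e) (v w : E) :
    ricci G y v w = ∑ a, G y (curvature G y (e a) v w) (e a) := by
  let L : E →ₗ[ℝ] E :=
    { toFun := fun u => curvature G y u v w
      map_add' := fun u u' => by simp only [hG.curvature_eq hy]; simp; abel
      map_smul' := fun c u => by
        simp only [hG.curvature_eq hy]; simp [smul_sub, smul_add] }
  have h1 : ricci G y v w = LinearMap.trace ℝ E L := by
    rw [LinearMap.trace_eq_matrix_trace ℝ (finBasis ℝ E), Matrix.trace]
    simp only [Matrix.diag_apply, LinearMap.toMatrix_apply]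
    rfl
  rw [h1, LinearMap.trace_eq_matrix_trace ℝ e, Matrix.trace]
  simp only [Matrix.diag_apply, LinearMap.toMatrix_apply, he.repr_eq]
  rfl

lemma metricTrace_ricci_eq_sum (he : IsOrthonormalBasis (G y) e) :
    metricTrace (G y) (ricci G y) =
      ∑ b, ∑ a, G y (curvature G y (e a) (e b) (e b)) (e a) := by
  have := he.metricTrace_eq (hG.ricciL hy)
  refine this.trans (Finset.sum_congr rfl fun b _ => hG.ricci_eq_sum hy he _ _)

end IsMetricOn

end LocalGeometry

/-! ### Behaviour under local isometries -/

section ChangeOfCoordinates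

variable {E : Type*} [NormedAddCommGroup E] [NormedSpace ℝ E] [FiniteDimensional ℝ E]

/-- The map `f`, an immersion of the open set `V` into `U`, pulls the metric `G` on `U` back to the
metric `G'` on `V`. -/
structure IsLocalIsometry (V : Set E) (G' : E → E →L[ℝ] E →L[ℝ] ℝ) (f : E → E) (U : Set E)
    (G : E → E →L[ℝ] E →L[ℝ] ℝ) : Prop where
  isMetricOn : IsMetricOn U G
  isOpen : IsOpen V
  contDiffOn : ContDiffOn ℝ ∞ f V
  mapsTo : MapsTo f V U
  injective : ∀ z ∈ V, Function.Injective (fderiv ℝ f z)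
  pullback : ∀ z ∈ V, G' z = pullbackForm (G (f z)) (fderiv ℝ f z)

namespace IsLocalIsometry

variable {V U : Set E} {G' G : E → E →L[ℝ] E →L[ℝ] ℝ} {f : E → E}
  (h : IsLocalIsometry V G' f U G)

include h

lemma isMetricOn_pullback : IsMetricOn V G' where
  isOpen := h.isOpen
  contDiffOn := by
    have hD := h.contDiffOn.fderiv_top h.isOpen
    have hG := h.isMetricOn.contDiffOn.comp h.contDiffOn h.mapsTo
    refine contDiffOn_clm_apply.2 fun v => contDiffOn_clm_apply.2 fun w => ?_
    refine ContDiffOn.congr (f := fun z => G (f z) (fderiv ℝ f z v) (fderiv ℝ f z w)) ?_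
      fun z hz => by rw [h.pullback z hz]; rfl
    exact (hG.clm_apply (hD.clm_apply contDiffOn_const)).clm_apply (hD.clm_apply contDiffOn_const)
  inner y hy := by
    rw [h.pullback y hy]
    exact (h.isMetricOn.inner _ (h.mapsTo hy)).pullback (h.injective y hy)

variable {y : E} (hy : y ∈ V)

include hy

lemma fderiv_pullback (u v w : E) : fderiv ℝ G' y u v w =
    fderiv ℝ G (f y) (fderiv ℝ f y u) (fderiv ℝ f y v) (fderiv ℝ f y w)
      + G (f y) (fderiv ℝ (fderiv ℝ f) y u v) (fderiv ℝ f y w)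
      + G (f y) (fderiv ℝ f y v) (fderiv ℝ (fderiv ℝ f) y u w) := by
  rw [← h.isMetricOn_pullback.fderiv_apply_apply hy]
  have hEq : (fun z => G' z v w) =ᶠ[𝓝 y]
      fun z => G (f z) (fderiv ℝ f z v) (fderiv ℝ f z w) := by
    filter_upwards [h.isOpen.mem_nhds hy] with z hz
    rw [h.pullback z hz]; rfl
  rw [hEq.fderiv_eq]
  have hf := h.contDiffOn.hasFDerivAt_top h.isOpen hy
  have hf2 := (h.contDiffOn.fderiv_top h.isOpen).hasFDerivAt_top h.isOpen hy
  have hG := (h.isMetricOn.contDiffOn.hasFDerivAt_top h.isMetricOn.isOpen (h.mapsTo hy)).comp y hf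
  have hD := (hG.clm_apply (hf2.clm_apply (hasFDerivAt_const v y))).clm_apply
    (hf2.clm_apply (hasFDerivAt_const w y))
  have := congrArg (fun L => L u) hD.fderiv
  simp at this
  refine this.trans ?_
  ring

/-- The transformation law of the connection. It suffices to pair with vectors `Df w`, since an
injective endomorphism is onto in finite dimension. In the Koszul formula for the pulled-back metric
the second derivatives of `f` combine, by their symmetry, to the single term `G(D²f(u, v), Df w)`.
-/
lemma fderiv_christoffelL_pullback (u v : E) : fderiv ℝ f y (christoffelL G' y u v) =
    christoffelL G (f y) (fderiv ℝ f y u) (fderiv ℝ f y v) + fderiv ℝ (fderiv ℝ f) y u v := by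
  refine (h.isMetricOn.inner _ (h.mapsTo hy)).eq_of_inner fun w' => ?_
  obtain ⟨w, rfl⟩ := LinearMap.surjective_of_injective (f := (fderiv ℝ f y).toLinearMap)
    (h.injective y hy) w'
  have h1 : G (f y) (fderiv ℝ f y (christoffelL G' y u v)) (fderiv ℝ f y w) =
      G' y (christoffelL G' y u v) w := by rw [h.pullback y hy]; rfl
  have hs := h.contDiffOn.fderiv_fderiv_comm h.isOpen hy
  have hi := (h.isMetricOn.inner _ (h.mapsTo hy)).symm
  rw [ContinuousLinearMap.coe_coe, h1, h.isMetricOn_pullback.inner_christoffelL hy, map_add,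
    add_apply, h.isMetricOn.inner_christoffelL (h.mapsTo hy), koszul_apply, koszul_apply,
    h.fderiv_pullback hy, h.fderiv_pullback hy, h.fderiv_pullback hy, hs w u, hs w v, hs v u,
    hi (fderiv ℝ f y u), hi (fderiv ℝ f y v)]
  ring

/-- Differentiate the transformation law of the connection and antisymmetrise in `u` and `v`: the
third derivatives of `f` drop out by symmetry, and the second derivatives cancel against those
produced by the quadratic Christoffel terms. -/
lemma fderiv_curvature_pullback (u v w : E) : fderiv ℝ f y (curvature G' y u v w) =
    curvature G (f y) (fderiv ℝ f y u) (fderiv ℝ f y v) (fderiv ℝ f y w) := by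
  have hf := h.contDiffOn.hasFDerivAt_top h.isOpen hy
  have hf2 := (h.contDiffOn.fderiv_top h.isOpen).hasFDerivAt_top h.isOpen hy
  have hΓ := HasFDerivAt.comp (g := christoffelL G) (g' := fderiv ℝ (christoffelL G) (f y)) y
    (h.isMetricOn.hasFDerivAt_christoffelL (h.mapsTo hy)) hf
  have hΓ' := h.isMetricOn_pullback.hasFDerivAt_christoffelL hy
  have hf3 : ∀ v w : E, HasFDerivAt (fun z => fderiv ℝ (fun z' => fderiv ℝ f z' w) z v) _ y :=
    fun v w => ((((h.contDiffOn.fderiv_top h.isOpen).clm_apply contDiffOn_const).fderiv_top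
      h.isOpen).hasFDerivAt_top h.isOpen hy).clm_apply (hasFDerivAt_const v y)
  have hf3s : ∀ u v w : E, fderiv ℝ (fderiv ℝ (fun z' => fderiv ℝ f z' w)) y u v =
      fderiv ℝ (fderiv ℝ (fun z' => fderiv ℝ f z' w)) y v u := fun u v w =>
    ((h.contDiffOn.fderiv_top h.isOpen).clm_apply contDiffOn_const).fderiv_fderiv_comm h.isOpen hy
      u v
  have key : ∀ u v w : E, fderiv ℝ f y (fderiv ℝ (christoffelL G') y u v w) =
      - fderiv ℝ (fderiv ℝ f) y u (christoffelL G' y v w)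
      + fderiv ℝ (christoffelL G) (f y) (fderiv ℝ f y u) (fderiv ℝ f y v) (fderiv ℝ f y w)
      + christoffelL G (f y) (fderiv ℝ (fderiv ℝ f) y u v) (fderiv ℝ f y w)
      + christoffelL G (f y) (fderiv ℝ f y v) (fderiv ℝ (fderiv ℝ f) y u w)
      + fderiv ℝ (fderiv ℝ (fun z' => fderiv ℝ f z' w)) y u v := by
    intro u v w
    have hL := hf2.clm_apply ((hΓ'.clm_apply (hasFDerivAt_const v y)).clm_apply
      (hasFDerivAt_const w y))
    have hR := ((hΓ.clm_apply (hf2.clm_apply (hasFDerivAt_const v y))).clm_apply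
      (hf2.clm_apply (hasFDerivAt_const w y))).add (hf3 v w)
    have hEq : (fun z => fderiv ℝ f z (christoffelL G' z v w)) =ᶠ[𝓝 y] fun z =>
        christoffelL G (f z) (fderiv ℝ f z v) (fderiv ℝ f z w)
          + fderiv ℝ (fun z' => fderiv ℝ f z' w) z v := by
      filter_upwards [h.isOpen.mem_nhds hy] with z hz
      rw [h.fderiv_christoffelL_pullback hz]
      congr 1
      have := ((((h.contDiffOn.fderiv_top h.isOpen).hasFDerivAt_top h.isOpen hz).clm_apply
        (hasFDerivAt_const w z))).fderiv
      rw [this]; simp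
    have hu := congrArg (fun L => L u) (hL.unique (hR.congr_of_eventuallyEq hEq))
    simp at hu
    rw [← sub_eq_zero] at hu ⊢
    rw [← hu]
    abel
  rw [h.isMetricOn_pullback.curvature_eq hy, h.isMetricOn.curvature_eq (h.mapsTo hy)]
  simp only [map_add, map_sub]
  rw [key, key, h.fderiv_christoffelL_pullback hy, h.fderiv_christoffelL_pullback hy,
    h.fderiv_christoffelL_pullback hy, h.fderiv_christoffelL_pullback hy, hf3s u v w,
    h.contDiffOn.fderiv_fderiv_comm h.isOpen hy u v]
  simp only [map_add]
  abel

omit [FiniteDimensional ℝ E] in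
lemma inner_pullback (u v : E) : G (f y) (fderiv ℝ f y u) (fderiv ℝ f y v) = G' y u v := by
  rw [h.pullback y hy]; rfl

/-- The image of an orthonormal basis under the differential of a local isometry. -/
lemma exists_image_basis {κ : Type*} [Fintype κ] [DecidableEq κ] {e : Basis κ ℝ E}
    (he : IsOrthonormalBasis (G' y) e) : ∃ e' : Basis κ ℝ E, IsOrthonormalBasis (G (f y)) e' ∧
      ∀ a, e' a = fderiv ℝ f y (e a) := by
  let L : E ≃ₗ[ℝ] E := LinearEquiv.ofInjectiveEndo (fderiv ℝ f y).toLinearMap (h.injective y hy)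
  refine ⟨e.map L, fun a b => ?_, fun a => rfl⟩
  have := h.inner_pullback hy (e a) (e b)
  rw [he a b] at this
  exact this

lemma ricci_pullback (v w : E) :
    ricci G' y v w = ricci G (f y) (fderiv ℝ f y v) (fderiv ℝ f y w) := by
  obtain ⟨e, he⟩ := (h.isMetricOn_pullback.inner y hy).exists_isOrthonormalBasis
  obtain ⟨e', he', hee⟩ := h.exists_image_basis hy he
  rw [h.isMetricOn_pullback.ricci_eq_sum hy he, h.isMetricOn.ricci_eq_sum (h.mapsTo hy) he']
  refine Finset.sum_congr rfl fun a _ => ?_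
  rw [← h.inner_pullback hy, h.fderiv_curvature_pullback hy, hee]

lemma metricTrace_ricci_pullback :
    metricTrace (G' y) (ricci G' y) = metricTrace (G (f y)) (ricci G (f y)) := by
  obtain ⟨e, he⟩ := (h.isMetricOn_pullback.inner y hy).exists_isOrthonormalBasis
  obtain ⟨e', he', hee⟩ := h.exists_image_basis hy he
  have h1 := he.metricTrace_eq (h.isMetricOn_pullback.ricciL hy)
  have h2 := he'.metricTrace_eq
    (h.isMetricOn.ricciL (h.mapsTo hy))
  refine h1.trans (Eq.trans ?_ h2.symm)
  refine Finset.sum_congr rfl fun a _ => ?_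
  rw [hee]
  exact h.ricci_pullback hy _ _

/-- The chain rule produces an extra term `dφ(D²f(u, v))`, which is exactly the inhomogeneous term
in the transformation law of the connection. -/
lemma hessian_pullback {φ : E → ℝ} (hφ : ContDiffOn ℝ ∞ φ U) (u v : E) :
    hessian G' (φ ∘ f) y u v = hessian G φ (f y) (fderiv ℝ f y u) (fderiv ℝ f y v) := by
  have hf := h.contDiffOn.hasFDerivAt_top h.isOpen hy
  have hf2 := (h.contDiffOn.fderiv_top h.isOpen).hasFDerivAt_top h.isOpen hy
  have h1 : fderiv ℝ (φ ∘ f) =ᶠ[𝓝 y] fun z => (fderiv ℝ φ (f z)).comp (fderiv ℝ f z) := by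
    filter_upwards [h.isOpen.mem_nhds hy] with z hz
    exact ((hφ.hasFDerivAt_top h.isMetricOn.isOpen (h.mapsTo hz)).comp z
      (h.contDiffOn.hasFDerivAt_top h.isOpen hz)).fderiv
  have h2 := (((hφ.fderiv_top h.isMetricOn.isOpen).hasFDerivAt_top h.isMetricOn.isOpen
    (h.mapsTo hy)).comp y hf).clm_comp hf2
  have h3 := h.fderiv_christoffelL_pullback hy u v
  simp only [hessian]
  rw [h1.fderiv_eq, h1.eq_of_nhds, ← christoffelL_apply, ← christoffelL_apply,
    ContinuousLinearMap.comp_apply, h3, map_add]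
  have h4 := congrArg (fun L => L u v) h2.fderiv
  simp at h4
  rw [h4]
  ring

end IsLocalIsometry

/-- The scalar curvature of a metric depends continuously on the point. -/
lemma IsMetricOn.continuousOn_metricTrace_ricci {U : Set E}
    {G : E → E →L[ℝ] E →L[ℝ] ℝ} (hG : IsMetricOn U G) :
    ContinuousOn (fun y => metricTrace (G y) (ricci G y)) U := by
  have hΓ := hG.contDiffOn_christoffelL
  have hD := hΓ.fderiv_top hG.isOpen
  have hΓ' : ContinuousOn (christoffelL G) U := hΓ.continuousOn
  have hD' : ContinuousOn (fderiv ℝ (christoffelL G)) U := hD.continuousOn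
  refine continuousOn_finsetSum _ fun a _ => continuousOn_finsetSum _ fun b _ =>
    (hG.contDiffOn_gram_inv a b).continuousOn.mul ?_
  refine continuousOn_finsetSum _ fun c _ => ?_
  refine (LinearMap.continuous_of_finiteDimensional ((finBasis ℝ E).coord c)).comp_continuousOn ?_
  refine ContinuousOn.congr ?_ fun y hy => hG.curvature_eq hy _ _ _
  fun_prop

end ChangeOfCoordinates

/-! ### Product and sum rules for second derivatives -/

section SecondDerivatives

variable {E : Type*} [NormedAddCommGroup E] [NormedSpace ℝ E] {W : Set E} (hW : IsOpen W)
  {y : E} (hy : y ∈ W)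

include hW hy

lemma sndFDeriv_mul {φ ψ : E → ℝ} (hφ : ContDiffOn ℝ ∞ φ W) (hψ : ContDiffOn ℝ ∞ ψ W) (u v : E) :
    fderiv ℝ (fderiv ℝ fun x => φ x * ψ x) y u v =
      fderiv ℝ (fderiv ℝ φ) y u v * ψ y + fderiv ℝ φ y u * fderiv ℝ ψ y v
        + fderiv ℝ φ y v * fderiv ℝ ψ y u + φ y * fderiv ℝ (fderiv ℝ ψ) y u v := by
  have h1 : fderiv ℝ (fun x => φ x * ψ x) =ᶠ[𝓝 y]
      fun z => φ z • fderiv ℝ ψ z + ψ z • fderiv ℝ φ z := by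
    filter_upwards [hW.mem_nhds hy] with z hz
    exact ((hφ.hasFDerivAt_top hW hz).mul (hψ.hasFDerivAt_top hW hz)).fderiv
  have h2 := ((hφ.hasFDerivAt_top hW hy).smul ((hψ.fderiv_top hW).hasFDerivAt_top hW hy)).add
    ((hψ.hasFDerivAt_top hW hy).smul ((hφ.fderiv_top hW).hasFDerivAt_top hW hy))
  rw [h1.fderiv_eq]
  have h3 := congrArg (fun L => L u v) h2.fderiv
  simp at h3
  refine Eq.trans ?_ (h3.trans ?_)
  · rfl
  · ring

lemma sndFDeriv_sum {ι : Type*} [Fintype ι] {φ : ι → E → ℝ} (hφ : ∀ i, ContDiffOn ℝ ∞ (φ i) W)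
    (u v : E) : fderiv ℝ (fderiv ℝ fun x => ∑ i, φ i x) y u v =
      ∑ i, fderiv ℝ (fderiv ℝ (φ i)) y u v := by
  have h1 : fderiv ℝ (fun x => ∑ i, φ i x) =ᶠ[𝓝 y] fun z => ∑ i, fderiv ℝ (φ i) z := by
    filter_upwards [hW.mem_nhds hy] with z hz
    exact (HasFDerivAt.fun_sum fun i _ => (hφ i).hasFDerivAt_top hW hz).fderiv
  have h2 := HasFDerivAt.fun_sum (u := Finset.univ) fun i _ =>
    ((hφ i).fderiv_top hW).hasFDerivAt_top hW hy
  rw [h1.fderiv_eq, h2.fderiv]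
  simp

end SecondDerivatives

/-- The coordinate formula for scalar curvature: second derivatives of the metric plus squares of
Christoffel symbols. The basis is constant and orthonormal only at `y`. Summing `hsec` over all
pairs makes the two half-weighted Hessian terms equal up to relabelling, and the inner products of
Christoffel vectors are expanded in the basis. -/
lemma IsMetricOn.metricTrace_ricci_eq {E : Type*} [NormedAddCommGroup E] [NormedSpace ℝ E]
    [FiniteDimensional ℝ E] {U : Set E} {G : E → E →L[ℝ] E →L[ℝ] ℝ} (hG : IsMetricOn U G)
    {y : E} (hy : y ∈ U) {κ : Type*} [Fintype κ] [DecidableEq κ] {e : Basis κ ℝ E}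
    (he : IsOrthonormalBasis (G y) e) :
    metricTrace (G y) (ricci G y) =
      ∑ a, ∑ b, (metricHess G y (e a) (e b) (e a) (e b) - metricHess G y (e a) (e a) (e b) (e b))
      - ∑ c, (∑ a, koszul G y (e a) (e a) (e c)) ^ 2
      + ∑ c, ∑ a, ∑ b, koszul G y (e a) (e b) (e c) ^ 2 := by
  have hsec : ∀ a b, G y (curvature G y (e a) (e b) (e b)) (e a) =
      metricHess G y (e a) (e b) (e a) (e b) - (1 / 2) * metricHess G y (e a) (e a) (e b) (e b)
        - (1 / 2) * metricHess G y (e b) (e b) (e a) (e a)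
        - ∑ c, koszul G y (e a) (e a) (e c) * koszul G y (e b) (e b) (e c)
        + ∑ c, koszul G y (e a) (e b) (e c) ^ 2 := by
    intro a b
    rw [hG.inner_curvature hy, hG.metricHess_symm hy (e a) (e b) (e b) (e a),
      hG.metricHess_comm hy (e b) (e a), hG.metricHess_comm hy (e b) (e a),
      hG.metricHess_symm hy (e a) (e b) (e b) (e a), hG.christoffelL_symm hy (e b) (e a),
      he.inner_eq, he.inner_eq (christoffelL G y (e a) (e b))]
    simp only [hG.inner_christoffelL hy, ← sq]
    ring
  rw [hG.metricTrace_ricci_eq_sum hy he]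
  simp only [hsec, Finset.sum_add_distrib, Finset.sum_sub_distrib]
  have h1 : ∑ b, ∑ a, metricHess G y (e a) (e b) (e a) (e b) =
      ∑ a, ∑ b, metricHess G y (e a) (e b) (e a) (e b) := Finset.sum_comm
  have h2 : ∑ b, ∑ a, (1 / 2) * metricHess G y (e a) (e a) (e b) (e b) =
      (1 / 2) * ∑ a, ∑ b, metricHess G y (e a) (e a) (e b) (e b) := by
    rw [Finset.sum_comm]; simp only [Finset.mul_sum]
  have h3 : ∑ b, ∑ a, (1 / 2) * metricHess G y (e b) (e b) (e a) (e a) =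
      (1 / 2) * ∑ a, ∑ b, metricHess G y (e a) (e a) (e b) (e b) := by
    simp only [Finset.mul_sum]
  have h4 : ∑ b, ∑ a, ∑ c, koszul G y (e a) (e a) (e c) * koszul G y (e b) (e b) (e c) =
      ∑ c, (∑ a, koszul G y (e a) (e a) (e c)) ^ 2 := by
    simp only [sq, Finset.sum_mul_sum]
    rw [Finset.sum_comm]
    refine Eq.trans (Finset.sum_congr rfl fun a _ => Finset.sum_comm) ?_
    exact Finset.sum_comm
  have h5 : ∑ b, ∑ a, ∑ c, koszul G y (e a) (e b) (e c) ^ 2 =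
      ∑ c, ∑ a, ∑ b, koszul G y (e a) (e b) (e c) ^ 2 := by
    rw [Finset.sum_comm]
    refine Eq.trans (Finset.sum_congr rfl fun a _ => Finset.sum_comm) ?_
    exact Finset.sum_comm
  rw [h1, h2, h3, h4, h5]
  ring

/-! ### The algebra of the expression `ρ_i` -/

section Algebra

variable {ι : Type*} [Fintype ι] [DecidableEq ι]

/-- The expression `ρ_i` as a linear function of `z j = Δ_i f_j / f_j` and
`X j k = ⟨grad_i f_j, grad_i f_k⟩ / (f_j f_k)`. -/
def rhoForm (m z : ι → ℝ) (X : ι → ι → ℝ) (i : ι) : ℝ :=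
  -2 * (m i - 1) * z i
    - 2 * (∑ j ∈ Finset.univ.erase i, m j * z j)
    - (m i - 1) * (m i - 4) * X i i
    - 2 * (m i - 2) * (∑ j ∈ Finset.univ.erase i, m j * X i j)
    - (∑ j ∈ Finset.univ.erase i, m j * (m j - 1) * X j j)
    - (∑ j ∈ Finset.univ.erase i, ∑ k ∈ (Finset.univ.erase i).erase j, m j * m k * X j k)

lemma rhoForm_sum {κ : Type*} [Fintype κ] (m : ι → ℝ) (z : κ → ι → ℝ) (X : κ → ι → ι → ℝ)
    (i : ι) : rhoForm m (fun j => ∑ a, z a j) (fun j k => ∑ a, X a j k) i =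
      ∑ a, rhoForm m (z a) (X a) i := by
  simp only [rhoForm, Finset.sum_sub_distrib, Finset.mul_sum]
  congr 1
  · congr 1
    · congr 1
      · congr 2
        exact Finset.sum_comm
      · exact Finset.sum_comm
    · exact Finset.sum_comm
  · rw [Finset.sum_comm]
    refine Finset.sum_congr rfl fun j _ => ?_
    exact Finset.sum_comm

lemma rhoForm_smul (c : ℝ) (m z : ι → ℝ) (X : ι → ι → ℝ) (i : ι) :
    rhoForm m (fun j => c * z j) (fun j k => c * X j k) i = c * rhoForm m z X i := by
  simp only [rhoForm, mul_left_comm _ c, ← Finset.mul_sum]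
  ring

/-- For a single basis vector of factor `i`, with `x j` the logarithmic derivative of `f_j` along
it, the gradient products have rank one. The right side is grouped as the curvature computation
delivers it: two second-derivative terms, the square of a contracted Christoffel symbol, and the sum
of squared Christoffel symbols. Comparing the coefficients of `x i ^ 2` explains the factor `(m i -
1) * (m i - 4)`. -/
lemma rhoForm_mul_self (m x z : ι → ℝ) (i : ι) : rhoForm m z (fun j k => x j * x k) i =
    (2 * x i ^ 2 + 2 * z i) - ∑ j, m j * (2 * x j ^ 2 + 2 * z j) - (2 * x i - ∑ j, m j * x j) ^ 2
      + (3 * ∑ j, m j * x j ^ 2 - 2 * x i ^ 2) := by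
  have hs : ∀ F : ι → ℝ, ∑ j, F j = F i + ∑ j ∈ Finset.univ.erase i, F j := fun F =>
    (Finset.add_sum_erase _ _ (Finset.mem_univ i)).symm
  have h1 : ∑ j ∈ Finset.univ.erase i, ∑ k ∈ (Finset.univ.erase i).erase j,
      m j * m k * (x j * x k) = (∑ j ∈ Finset.univ.erase i, m j * x j) ^ 2
        - ∑ j ∈ Finset.univ.erase i, (m j * x j) ^ 2 := by
    rw [sq, Finset.sum_mul_sum, ← Finset.sum_sub_distrib]
    refine Finset.sum_congr rfl fun j hj => ?_
    rw [← Finset.add_sum_erase _ _ hj, ← sq, add_sub_cancel_left]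
    exact Finset.sum_congr rfl fun k _ => by ring
  have h2 : ∑ j ∈ Finset.univ.erase i, m j * (m j - 1) * (x j * x j) =
      ∑ j ∈ Finset.univ.erase i, (m j * x j) ^ 2 - ∑ j ∈ Finset.univ.erase i, m j * x j ^ 2 := by
    rw [← Finset.sum_sub_distrib]
    exact Finset.sum_congr rfl fun k _ => by ring
  have h3 : ∑ j ∈ Finset.univ.erase i, m j * (x i * x j) =
      x i * ∑ j ∈ Finset.univ.erase i, m j * x j := by
    rw [Finset.mul_sum]
    exact Finset.sum_congr rfl fun k _ => by ring
  have h4 : ∑ j ∈ Finset.univ.erase i, m j * (2 * x j ^ 2 + 2 * z j) =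
      2 * ∑ j ∈ Finset.univ.erase i, m j * x j ^ 2
        + 2 * ∑ j ∈ Finset.univ.erase i, m j * z j := by
    rw [Finset.mul_sum, Finset.mul_sum, ← Finset.sum_add_distrib]
    exact Finset.sum_congr rfl fun k _ => by ring
  rw [rhoForm, h1, h2, h3, hs, hs fun j => m j * x j, hs fun j => m j * x j ^ 2, h4]
  ring

variable {n : ι → ℕ}

omit [DecidableEq ι] in
lemma sum_sigma_fst (F : ι → ℝ) : ∑ a : (Σ k, Fin (n k)), F a.1 = ∑ k, (n k : ℝ) * F k := by
  rw [Fintype.sum_sigma]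
  simp

variable (x : (Σ k, Fin (n k)) → ι → ℝ)

/-- The summands have the shape of the Christoffel symbols of a multiconformal metric in an adapted
orthonormal basis, where `x a k` stands for the derivative of `log f_k` along the vector `a`. -/
lemma sum_koszul_diag (c : Σ k, Fin (n k)) :
    ∑ a : (Σ k, Fin (n k)), ((if a = c then x a a.1 else 0) + (if a = c then x a a.1 else 0)
      - (if a = a then x c a.1 else 0)) = 2 * x c c.1 - ∑ k, (n k : ℝ) * x c k := by
  simp only [Finset.sum_sub_distrib, Finset.sum_add_distrib, Finset.sum_ite_eq', Finset.mem_univ,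
    if_true, sum_sigma_fst (x c)]
  ring

/-- If two of the three index equalities hold then so does the third, so the mixed products
contribute only at `a = b = c`, where they total `-2 x²`. Each of the three squares contributes the
same weighted sum. -/
lemma sum_koszul_sq :
    ∑ c, ∑ a, ∑ b, ((if b = c then x a b.1 else 0) + (if a = c then x b a.1 else 0)
      - (if a = b then x c a.1 else 0)) ^ 2 =
      ∑ c : (Σ k, Fin (n k)), (3 * ∑ k, (n k : ℝ) * x c k ^ 2 - 2 * x c c.1 ^ 2) := by
  have h : ∀ a b c : (Σ k, Fin (n k)), ((if b = c then x a b.1 else 0)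
      + (if a = c then x b a.1 else 0) - (if a = b then x c a.1 else 0)) ^ 2 =
      (if b = c then x a b.1 ^ 2 else 0) + (if a = c then x b a.1 ^ 2 else 0)
        + (if a = b then x c a.1 ^ 2 else 0)
        - (if a = c then (if b = c then 2 * x a a.1 ^ 2 else 0) else 0) := by
    intro a b c
    by_cases h1 : b = c
    · subst h1
      by_cases h2 : a = b
      · subst h2; simp; ring
      · simp [h2]
    · by_cases h2 : a = c
      · subst h2
        simp [h1, Ne.symm h1]
      · by_cases h3 : a = b
        · subst h3; simp [h1]
        · simp [h1, h2, h3]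
  simp only [h, Finset.sum_sub_distrib, Finset.sum_add_distrib]
  have h1 : ∑ c, ∑ a, ∑ b : (Σ k, Fin (n k)), (if b = c then x a b.1 ^ 2 else 0) =
      ∑ c, ∑ k, (n k : ℝ) * x c k ^ 2 := by
    rw [Finset.sum_comm]
    refine Finset.sum_congr rfl fun a _ => ?_
    simp only [Finset.sum_ite_eq', Finset.mem_univ, if_true]
    exact sum_sigma_fst fun k => x a k ^ 2
  have h2 : ∑ c, ∑ a : (Σ k, Fin (n k)), ∑ b, (if a = c then x b a.1 ^ 2 else 0) =
      ∑ c, ∑ k, (n k : ℝ) * x c k ^ 2 := by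
    rw [← h1]
    simp only [Finset.sum_ite_irrel, Finset.sum_const_zero, Finset.sum_ite_eq', Finset.mem_univ,
      if_true]
  have h3 : ∑ c, ∑ a, ∑ b : (Σ k, Fin (n k)), (if a = b then x c a.1 ^ 2 else 0) =
      ∑ c, ∑ k, (n k : ℝ) * x c k ^ 2 := by
    refine Finset.sum_congr rfl fun c _ => ?_
    simp only [Finset.sum_ite_eq, Finset.mem_univ, if_true]
    exact sum_sigma_fst fun k => x c k ^ 2
  rw [h1, h2, h3]
  simp only [Finset.sum_ite_irrel, Finset.sum_const_zero, Finset.sum_ite_eq', Finset.mem_univ,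
    if_true]
  rw [← Finset.mul_sum, ← Finset.mul_sum]
  ring

end Algebra

/-! ### Multiconformal metrics on products of open sets -/

section LocalPartial

variable {ι : Type*} [Fintype ι] [DecidableEq ι] {E : ι → Type*} [∀ i, NormedAddCommGroup (E i)]
  [∀ i, NormedSpace ℝ (E i)] [∀ i, FiniteDimensional ℝ (E i)]

/-- `tr (Ric (P_k ·, P_k ·))` for a metric on an open subset of a product of vector spaces. -/
def localPartialScalar (G : (∀ i, E i) → (∀ i, E i) →L[ℝ] (∀ i, E i) →L[ℝ] ℝ) (k : ι)
    (y : ∀ i, E i) : ℝ :=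
  metricTrace (G y) fun u v => ricci G y (factorProj E k u) (factorProj E k v)

/-- `tr (Hess φ (P_k ·, P_k ·))` for a metric on an open subset of a product of vector spaces. -/
def localPartialLaplacian (G : (∀ i, E i) → (∀ i, E i) →L[ℝ] (∀ i, E i) →L[ℝ] ℝ) (k : ι)
    (φ : (∀ i, E i) → ℝ) (y : ∀ i, E i) : ℝ :=
  metricTrace (G y) fun u v => hessian G φ y (factorProj E k u) (factorProj E k v)

/-- `⟨P_k grad φ, P_k grad ψ⟩` for a metric on an open subset of a product of vector spaces. -/
def localPartialGradInner (G : (∀ i, E i) → (∀ i, E i) →L[ℝ] (∀ i, E i) →L[ℝ] ℝ) (k : ι)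
    (φ ψ : (∀ i, E i) → ℝ) (y : ∀ i, E i) : ℝ :=
  G y (factorProj E k (gradient G φ y)) (factorProj E k (gradient G ψ y))

/-- The function `ρ_k` for a metric on an open subset of a product of vector spaces. -/
def localRho (G : (∀ i, E i) → (∀ i, E i) →L[ℝ] (∀ i, E i) →L[ℝ] ℝ)
    (F : ι → (∀ i, E i) → ℝ) (k : ι) (y : ∀ i, E i) : ℝ :=
  rhoForm (fun j => (finrank ℝ (E j) : ℝ))
    (fun j => localPartialLaplacian G k (F j) y / F j y)
    (fun i j => localPartialGradInner G k (F i) (F j) y / (F i y * F j y)) k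

/-- The metric `∑ k, F_k² G_k` on an open subset of a product of vector spaces. -/
def multiForm (G : ∀ k, E k → E k →L[ℝ] E k →L[ℝ] ℝ) (F : ι → (∀ i, E i) → ℝ) (y : ∀ i, E i) :
    (∀ i, E i) →L[ℝ] (∀ i, E i) →L[ℝ] ℝ :=
  ∑ k, (F k y) ^ 2 • pullbackForm (G k (y k)) (ContinuousLinearMap.proj (R := ℝ) (φ := E) k)

omit [DecidableEq ι] [∀ i, FiniteDimensional ℝ (E i)] in
lemma multiForm_apply (G : ∀ k, E k → E k →L[ℝ] E k →L[ℝ] ℝ) (F : ι → (∀ i, E i) → ℝ)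
    (y u v : ∀ i, E i) : multiForm G F y u v = ∑ k, F k y ^ 2 * G k (y k) (u k) (v k) := by
  simp [multiForm, pullbackForm_apply]

omit [Fintype ι] [∀ i, FiniteDimensional ℝ (E i)] in
lemma factorProj_eq_single (k : ι) (u : ∀ i, E i) : factorProj E k u = Pi.single k (u k) := rfl

/-- The `G_k` are metrics on the open sets `U_k`, and the `F_k` are smooth and positive on the open
subset `W` of the product of the `U_k`. -/
structure IsMultiMetricOn (U : ∀ k, Set (E k)) (W : Set (∀ k, E k))
    (G : ∀ k, E k → E k →L[ℝ] E k →L[ℝ] ℝ) (F : ι → (∀ i, E i) → ℝ) : Prop where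
  isMetricOn : ∀ k, IsMetricOn (U k) (G k)
  isOpen : IsOpen W
  mem : ∀ y ∈ W, ∀ k, y k ∈ U k
  contDiffOn : ∀ k, ContDiffOn ℝ ∞ (F k) W
  pos : ∀ y ∈ W, ∀ k, 0 < F k y

namespace IsMultiMetricOn

variable {U : ∀ k, Set (E k)} {W : Set (∀ k, E k)} {G : ∀ k, E k → E k →L[ℝ] E k →L[ℝ] ℝ}
  {F : ι → (∀ i, E i) → ℝ} (h : IsMultiMetricOn U W G F)

include h

omit [DecidableEq ι] [∀ i, FiniteDimensional ℝ (E i)] in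
lemma one : IsMultiMetricOn U W G (fun _ _ => 1) where
  isMetricOn := h.isMetricOn
  isOpen := h.isOpen
  mem := h.mem
  contDiffOn _ := contDiffOn_const
  pos _ _ _ := one_pos

omit [DecidableEq ι] [∀ i, FiniteDimensional ℝ (E i)] in
lemma contDiffOn_comp_proj (k : ι) (w z : E k) :
    ContDiffOn ℝ ∞ (fun x : ∀ i, E i => G k (x k) w z) W :=
  ((h.isMetricOn k).contDiffOn_apply_apply w z).comp
    (ContinuousLinearMap.proj (R := ℝ) (φ := E) k).contDiff.contDiffOn fun y hy => h.mem y hy k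

omit [DecidableEq ι] in
lemma isMetricOn_multiForm : IsMetricOn W (multiForm G F) where
  isOpen := h.isOpen
  contDiffOn := by
    refine contDiffOn_clm_apply.2 fun v => contDiffOn_clm_apply.2 fun w => ?_
    simp only [multiForm_apply]
    exact ContDiffOn.sum fun k _ => ((h.contDiffOn k).pow 2).mul (h.contDiffOn_comp_proj k _ _)
  inner y hy := by
    have hk := fun k => (h.isMetricOn k).inner (y k) (h.mem y hy k)
    have hnn : ∀ k (v : E k), 0 ≤ G k (y k) v v := fun k v => by
      by_cases hv : v = 0
      · simp [hv]
      · exact ((hk k).pos v hv).le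
    refine ⟨fun u v => ?_, fun v hv => ?_⟩
    · simp only [multiForm_apply]
      exact Finset.sum_congr rfl fun k _ => by rw [(hk k).symm]
    · rw [multiForm_apply]
      obtain ⟨k, hk0⟩ := Function.ne_iff.1 hv
      exact Finset.sum_pos' (fun j _ => mul_nonneg (sq_nonneg _) (hnn j _))
        ⟨k, Finset.mem_univ k, mul_pos (pow_pos (h.pos y hy k) 2) ((hk k).pos _ hk0)⟩

variable {y : ∀ k, E k} (hy : y ∈ W)

include hy

omit [DecidableEq ι] [∀ i, FiniteDimensional ℝ (E i)] in
lemma hasFDerivAt_comp_proj (k : ι) (w z : E k) :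
    HasFDerivAt (fun x : ∀ i, E i => G k (x k) w z)
      ((fderiv ℝ (fun t => G k t w z) (y k)).comp
        (ContinuousLinearMap.proj (R := ℝ) (φ := E) k)) y :=
  HasFDerivAt.comp (g := fun t => G k t w z) y
    (((h.isMetricOn k).contDiffOn_apply_apply w z).hasFDerivAt_top (h.isMetricOn k).isOpen
      (h.mem y hy k)) (ContinuousLinearMap.proj (R := ℝ) (φ := E) k).hasFDerivAt

omit [DecidableEq ι] [∀ i, FiniteDimensional ℝ (E i)] in
lemma sndFDeriv_comp_proj (k : ι) (w z : E k) (u v : ∀ i, E i) :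
    fderiv ℝ (fderiv ℝ fun x : ∀ i, E i => G k (x k) w z) y u v =
      metricHess (G k) (y k) (u k) (v k) w z := by
  have h1 : fderiv ℝ (fun x : ∀ i, E i => G k (x k) w z) =ᶠ[𝓝 y]
      fun x => (fderiv ℝ (fun t => G k t w z) (x k)).comp
        (ContinuousLinearMap.proj (R := ℝ) (φ := E) k) := by
    filter_upwards [h.isOpen.mem_nhds hy] with x hx
    exact (h.hasFDerivAt_comp_proj hx k w z).fderiv
  have h2 := HasFDerivAt.comp (g := fderiv ℝ fun t => G k t w z) y
    ((((h.isMetricOn k).contDiffOn_apply_apply w z).fderiv_top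
      (h.isMetricOn k).isOpen).hasFDerivAt_top (h.isMetricOn k).isOpen (h.mem y hy k))
    (ContinuousLinearMap.proj (R := ℝ) (φ := E) k).hasFDerivAt
  have h3 := h2.clm_comp (hasFDerivAt_const (ContinuousLinearMap.proj (R := ℝ) (φ := E) k) y)
  rw [h1.fderiv_eq]
  have h4 := congrArg (fun L => L u v) h3.fderiv
  simp at h4
  exact h4

variable (hn : ∀ k, fderiv ℝ (G k) (y k) = 0)

include hn

omit [DecidableEq ι] [∀ i, FiniteDimensional ℝ (E i)] in
lemma fderiv_comp_proj (k : ι) (w z : E k) :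
    fderiv ℝ (fun x : ∀ i, E i => G k (x k) w z) y = 0 := by
  ext u
  rw [(h.hasFDerivAt_comp_proj hy k w z).fderiv, ContinuousLinearMap.comp_apply,
    (h.isMetricOn k).fderiv_apply_apply (h.mem y hy k), hn k]
  simp

omit [DecidableEq ι] in
-- Where the first derivatives of all `G_k` vanish, only the conformal factors are differentiated.
lemma fderiv_multiForm (u w z : ∀ i, E i) : fderiv ℝ (multiForm G F) y u w z =
    ∑ k, 2 * F k y * fderiv ℝ (F k) y u * G k (y k) (w k) (z k) := by
  rw [← h.isMetricOn_multiForm.fderiv_apply_apply hy]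
  simp only [multiForm_apply]
  have hd := HasFDerivAt.fun_sum (u := Finset.univ) fun k (_ : k ∈ Finset.univ) =>
    (((h.contDiffOn k).hasFDerivAt_top h.isOpen hy).pow 2).mul
      (((h.contDiffOn_comp_proj k (w k) (z k)).hasFDerivAt_top h.isOpen hy))
  refine (congrArg (fun L => L u) hd.fderiv).trans ?_
  simp only [h.fderiv_comp_proj hy hn]
  simp
  exact Finset.sum_congr rfl fun k _ => by ring

omit [DecidableEq ι] [∀ i, FiniteDimensional ℝ (E i)] in
-- The mixed terms `dF_k · dG_k` vanish, so the second derivatives separate into a part in the `F_k`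
-- and the intrinsic part of each factor.
lemma metricHess_multiForm (u v w z : ∀ i, E i) : metricHess (multiForm G F) y u v w z =
    ∑ k, ((2 * fderiv ℝ (F k) y u * fderiv ℝ (F k) y v
        + 2 * F k y * fderiv ℝ (fderiv ℝ (F k)) y u v) * G k (y k) (w k) (z k)
      + F k y ^ 2 * metricHess (G k) (y k) (u k) (v k) (w k) (z k)) := by
  simp only [metricHess, multiForm_apply]
  rw [sndFDeriv_sum h.isOpen hy
    (fun k => ((h.contDiffOn k).pow 2).mul (h.contDiffOn_comp_proj k (w k) (z k)))]
  refine Finset.sum_congr rfl fun k _ => ?_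
  rw [sndFDeriv_mul h.isOpen hy ((h.contDiffOn k).pow 2) (h.contDiffOn_comp_proj k (w k) (z k)),
    h.fderiv_comp_proj hy hn, h.sndFDeriv_comp_proj hy]
  have h2 := sndFDeriv_mul h.isOpen hy (h.contDiffOn k) (h.contDiffOn k) u v
  simp only [← sq] at h2
  rw [h2]
  simp only [zero_apply, metricHess]
  ring

omit [DecidableEq ι] in
-- Hence, at such a point, Hessians for the product metric are plain second derivatives and its
-- curvature has no quadratic terms.
lemma christoffelL_multiForm_one : christoffelL (multiForm G fun _ _ => 1) y = 0 := by
  ext1 u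
  ext1 v
  refine (h.one.isMetricOn_multiForm.inner y hy).eq_of_inner fun w => ?_
  rw [h.one.isMetricOn_multiForm.inner_christoffelL hy, koszul_apply]
  simp [h.one.fderiv_multiForm hy hn]

end IsMultiMetricOn

end LocalPartial

/-- Passing to vectors scaled by `F_k⁻¹` gives a factor `F_k⁻⁴`; together with the `F_k²` in front
of `G_k` this leaves the `F_k⁻²` that divides `R_k`. -/
lemma metricHess_smul {E : Type*} [NormedAddCommGroup E] [NormedSpace ℝ E]
    (G : E → E →L[ℝ] E →L[ℝ] ℝ) (y u v w z : E) (c : ℝ) :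
    metricHess G y (c • u) (c • v) (c • w) (c • z) = c ^ 4 * metricHess G y u v w z := by
  have h0 : (fun x => G x (c • w) (c • z)) = (c ^ 2) • fun x => G x w z := by
    ext x; simp; ring
  simp only [metricHess]
  have h1 : fderiv ℝ ((c ^ 2) • fderiv ℝ fun x => G x w z) y =
      (c ^ 2) • fderiv ℝ (fderiv ℝ fun x => G x w z) y :=
    congrFun (fderiv_const_smul_field (𝕜 := ℝ) (F := E →L[ℝ] ℝ) (c ^ 2)) y
  rw [h0, fderiv_const_smul_field]
  refine (congrArg (fun L => L (c • u) (c • v)) h1).trans ?_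
  simp
  ring

/-! ### Orthonormal bases adapted to the product -/

section Frames

variable {ι : Type*} [Fintype ι] [DecidableEq ι] {E : ι → Type*} [∀ i, NormedAddCommGroup (E i)]
  [∀ i, NormedSpace ℝ (E i)] {n : ι → ℕ} (e : ∀ k, Basis (Fin (n k)) ℝ (E k))

lemma sum_factorProj_piBasis {A : Type*} [AddCommMonoid A] (k : ι) (φ : (∀ i, E i) → A)
    (h0 : φ 0 = 0) : ∑ a, φ (factorProj E k (Pi.basis e a)) =
      ∑ a : Fin (n k), φ (Pi.basis e ⟨k, a⟩) := by
  rw [Fintype.sum_sigma, Fintype.sum_eq_single k]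
  · refine Finset.sum_congr rfl fun a _ => ?_
    rw [factorProj_eq_single, Pi.basis_apply, Pi.single_eq_same]
  · intro j hj
    refine Finset.sum_eq_zero fun a _ => ?_
    rw [factorProj_eq_single, Pi.basis_apply, Pi.single_eq_of_ne hj.symm, Pi.single_zero, h0]

lemma inner_piBasis {B : ∀ k, E k →L[ℝ] E k →L[ℝ] ℝ}
    (he : ∀ k, IsOrthonormalBasis (B k) (e k)) (k : ι) (a b : Σ k, Fin (n k)) :
    B k (Pi.basis e a k) (Pi.basis e b k) = if a = b then (if a.1 = k then 1 else 0) else 0 := by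
  obtain ⟨i, a⟩ := a
  obtain ⟨j, b⟩ := b
  simp only [Pi.basis_apply]
  by_cases hi : i = k
  · subst hi
    by_cases hj : j = i
    · subst hj
      simp [he _ _ _]
    · rw [Pi.single_eq_of_ne (Ne.symm hj)]
      have : (⟨i, a⟩ : Σ k, Fin (n k)) ≠ ⟨j, b⟩ := fun h => hj (congrArg Sigma.fst h).symm
      simp [this]
  · rw [Pi.single_eq_of_ne (Ne.symm hi)]
    simp [hi]

variable [∀ i, FiniteDimensional ℝ (E i)]

namespace IsMultiMetricOn

variable {U : ∀ k, Set (E k)} {W : Set (∀ k, E k)} {G : ∀ k, E k → E k →L[ℝ] E k →L[ℝ] ℝ}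
  {F : ι → (∀ i, E i) → ℝ} (h : IsMultiMetricOn U W G F) {y : ∀ k, E k}
  (hy : y ∈ W)
  {e} (he : ∀ k, IsOrthonormalBasis (G k (y k)) (e k))

include he

omit [∀ i, FiniteDimensional ℝ (E i)] in
lemma isOrthonormalBasis_one :
    IsOrthonormalBasis (multiForm G (fun _ _ => 1) y) (Pi.basis e) := by
  intro a b
  rw [multiForm_apply]
  simp only [inner_piBasis e he]
  split_ifs <;> simp

include h hy

omit [∀ i, FiniteDimensional ℝ (E i)] in
/-- The basis `F_k⁻¹ e_k`, which is orthonormal for `∑ k, F_k² G_k`. -/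
lemma exists_scaled_basis : ∃ e' : Basis (Σ k, Fin (n k)) ℝ (∀ k, E k),
    IsOrthonormalBasis (multiForm G F y) e' ∧ ∀ a, e' a = (F a.1 y)⁻¹ • Pi.basis e a := by
  have hu : ∀ a : (Σ k, Fin (n k)), IsUnit (F a.1 y)⁻¹ := fun a =>
    (inv_ne_zero (h.pos y hy a.1).ne').isUnit
  refine ⟨(Pi.basis e).isUnitSMul hu, fun a b => ?_, fun a => Basis.isUnitSMul_apply hu a⟩
  rw [Basis.isUnitSMul_apply, Basis.isUnitSMul_apply, multiForm_apply]
  simp only [Pi.smul_apply, map_smul, smul_apply, smul_eq_mul, inner_piBasis e he]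
  split_ifs with hab
  · subst hab
    have := (h.pos y hy a.1).ne'
    simp
    field_simp
  · simp

omit h hy in
lemma localPartialGradInner_eq (k : ι) (φ ψ : (∀ i, E i) → ℝ) :
    localPartialGradInner (multiForm G fun _ _ => 1) k φ ψ y =
      ∑ a : Fin (n k), fderiv ℝ φ y (Pi.basis e ⟨k, a⟩) * fderiv ℝ ψ y (Pi.basis e ⟨k, a⟩) := by
  have ho := isOrthonormalBasis_one (G := G) he
  have hg : ∀ φ : (∀ i, E i) → ℝ, factorProj E k (gradient (multiForm G fun _ _ => 1) φ y) =
      ∑ a : Fin (n k), fderiv ℝ φ y (Pi.basis e ⟨k, a⟩) • Pi.basis e ⟨k, a⟩ := by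
    intro φ
    have h1 : gradient (multiForm G fun _ _ => 1) φ y =
      ∑ a, fderiv ℝ φ y (Pi.basis e a) • Pi.basis e a := ho.sharp_eq (fderiv ℝ φ y).toLinearMap
    rw [h1, map_sum, Fintype.sum_sigma, Fintype.sum_eq_single k]
    · refine Finset.sum_congr rfl fun a _ => ?_
      rw [map_smul]
      congr 1
      rw [factorProj_eq_single, Pi.basis_apply, Pi.single_eq_same]
    · intro j hj
      refine Finset.sum_eq_zero fun a _ => ?_
      rw [map_smul]
      rw [factorProj_eq_single, Pi.basis_apply, Pi.single_eq_of_ne hj.symm, Pi.single_zero,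
        smul_zero]
  rw [localPartialGradInner, hg, hg]
  simp only [map_sum, map_smul, sum_apply, smul_apply, smul_eq_mul, ho _ _]
  simp [mul_comm]

variable (hn : ∀ k, fderiv ℝ (G k) (y k) = 0)

include hn

lemma localPartialLaplacian_eq (k : ι) (φ : (∀ i, E i) → ℝ) :
    localPartialLaplacian (multiForm G fun _ _ => 1) k φ y =
      ∑ a : Fin (n k), fderiv ℝ (fderiv ℝ φ) y (Pi.basis e ⟨k, a⟩) (Pi.basis e ⟨k, a⟩) := by
  have ho := isOrthonormalBasis_one (G := G) he
  have h1 : ∀ u v, hessian (multiForm G fun _ _ => 1) φ y u v =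
      fderiv ℝ (fderiv ℝ φ) y u v := fun u v => by
    rw [hessian, ← christoffelL_apply, h.christoffelL_multiForm_one hy hn]
    simp
  simp only [localPartialLaplacian, h1]
  have h2 := ho.metricTrace_eq (LinearMap.mk₂ ℝ (fun u v => fderiv ℝ (fderiv ℝ φ) y
    (factorProj E k u) (factorProj E k v)) (by simp) (by simp) (by simp) (by simp))
  refine h2.trans ?_
  exact sum_factorProj_piBasis e k (fun u => fderiv ℝ (fderiv ℝ φ) y u u) (by simp)

/-- The second derivatives of a product metric are sums over the factors, and a projected argument
in a metric slot or a differentiation slot leaves only factor `k`. The sums may run over the whole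
product basis because vectors of other factors have zero `k`-th component. -/
lemma localPartialScalar_eq (k : ι) :
    localPartialScalar (multiForm G fun _ _ => 1) k y = ∑ a, ∑ b,
      (metricHess (G k) (y k) (Pi.basis e a k) (Pi.basis e b k) (Pi.basis e a k) (Pi.basis e b k)
      - metricHess (G k) (y k) (Pi.basis e a k) (Pi.basis e a k) (Pi.basis e b k)
        (Pi.basis e b k)) := by
  have hM := h.one.isMetricOn_multiForm
  have ho := isOrthonormalBasis_one (G := G) he
  have h2 := ho.metricTrace_eq ((hM.ricciL hy).compl₁₂ (factorProj E k).toLinearMap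
    (factorProj E k).toLinearMap)
  refine h2.trans ?_
  have hP : ∀ (u : ∀ i, E i) (j : ι), (factorProj E k u) j = if j = k then u j else 0 := by
    intro u j
    rw [factorProj_eq_single]
    by_cases hj : j = k
    · subst hj; simp
    · simp [hj]
  have hH : ∀ u v w z : ∀ i, E i, metricHess (multiForm G fun _ _ => 1) y u v w z =
      ∑ j, metricHess (G j) (y j) (u j) (v j) (w j) (z j) := fun u v w z => by
    rw [h.one.metricHess_multiForm hy hn]
    simp
  have hq : ∀ (w z : ∀ i, E i), metricHess (multiForm G fun _ _ => 1) y z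
      (factorProj E k w) z (factorProj E k w) =
        metricHess (G k) (y k) (z k) (w k) (z k) (w k) := by
    intro w z
    rw [hH, Fintype.sum_eq_single k]
    · simp [hP]
    · intro j hj
      simp [hP, hj, metricHess]
  have hq2 : ∀ (w z : ∀ i, E i), metricHess (multiForm G fun _ _ => 1) y z z
      (factorProj E k w) (factorProj E k w) =
        metricHess (G k) (y k) (z k) (z k) (w k) (w k) := by
    intro w z
    rw [hH, Fintype.sum_eq_single k]
    · simp [hP]
    · intro j hj
      simp [hP, hj, metricHess]
  have hq3 : ∀ (w z : ∀ i, E i), metricHess (multiForm G fun _ _ => 1) y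
      (factorProj E k w) (factorProj E k w) z z =
        metricHess (G k) (y k) (w k) (w k) (z k) (z k) := by
    intro w z
    rw [hH, Fintype.sum_eq_single k]
    · simp [hP]
    · intro j hj
      simp [hP, hj, metricHess]
  have h3 : ∀ a, ricci (multiForm G fun _ _ => 1) y (factorProj E k (Pi.basis e a))
      (factorProj E k (Pi.basis e a)) = ∑ b,
      (metricHess (G k) (y k) (Pi.basis e b k) (Pi.basis e a k) (Pi.basis e b k) (Pi.basis e a k)
      - (1 / 2) * metricHess (G k) (y k) (Pi.basis e b k) (Pi.basis e b k) (Pi.basis e a k)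
        (Pi.basis e a k)
      - (1 / 2) * metricHess (G k) (y k) (Pi.basis e a k) (Pi.basis e a k) (Pi.basis e b k)
        (Pi.basis e b k)) := by
    intro a
    rw [hM.ricci_eq_sum hy ho]
    refine Finset.sum_congr rfl fun b _ => ?_
    rw [hM.inner_curvature hy, h.christoffelL_multiForm_one hy hn,
      hM.metricHess_symm hy (Pi.basis e b) _ _ (Pi.basis e b),
      hM.metricHess_comm hy (factorProj E k (Pi.basis e a)) (Pi.basis e b) _ (Pi.basis e b),
      hM.metricHess_comm hy (factorProj E k (Pi.basis e a)) (Pi.basis e b) (Pi.basis e b),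
      hM.metricHess_symm hy (Pi.basis e b) _ _ (Pi.basis e b), hq, hq2, hq3]
    simp
    ring
  refine (Finset.sum_congr rfl fun a _ => h3 a).trans ?_
  simp only [Finset.sum_sub_distrib, ← Finset.mul_sum]
  rw [Finset.sum_comm, Finset.sum_comm (f := fun a b => metricHess (G k) (y k) (Pi.basis e b k)
    (Pi.basis e b k) (Pi.basis e a k) (Pi.basis e a k))]
  ring

end IsMultiMetricOn

end Frames

/-! ### Scalar curvature where the first derivatives vanish -/

section ScalarCurvatureFormula

variable {ι : Type*} [Fintype ι] [DecidableEq ι] {E : ι → Type*} [∀ i, NormedAddCommGroup (E i)]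
  [∀ i, NormedSpace ℝ (E i)] [∀ i, FiniteDimensional ℝ (E i)]

namespace IsMultiMetricOn

variable {U : ∀ k, Set (E k)} {W : Set (∀ k, E k)} {G : ∀ k, E k → E k →L[ℝ] E k →L[ℝ] ℝ}
  {F : ι → (∀ i, E i) → ℝ} (h : IsMultiMetricOn U W G F) {y : ∀ k, E k}
  (hy : y ∈ W)

include h hy

/-- The scalar curvature of `∑ k, F_k² G_k` at a point where the first derivatives of the `G_k`
vanish. -/
lemma metricTrace_ricci_multiForm_of_fderiv_eq_zero (hn : ∀ k, fderiv ℝ (G k) (y k) = 0) :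
    metricTrace (multiForm G F y) (ricci (multiForm G F) y) =
      ∑ k, (localPartialScalar (multiForm G fun _ _ => 1) k y
        + localRho (multiForm G fun _ _ => 1) F k y) / F k y ^ 2 := by
  choose e he using fun k =>
    ((h.isMetricOn k).inner (y k) (h.mem y hy k)).exists_isOrthonormalBasis
  obtain ⟨e', ho, he'⟩ := h.exists_scaled_basis hy he
  have hF : ∀ k, F k y ≠ 0 := fun k => (h.pos y hy k).ne'
  set b := Pi.basis e with hb
  -- First and second derivatives of the `F_j` along the scaled basis, divided by `F_j`: these are
  -- the arguments of `rhoForm_mul_self`.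
  let x : (Σ k, Fin (finrank ℝ (E k))) → ι → ℝ := fun a j => fderiv ℝ (F j) y (e' a) / F j y
  let z : (Σ k, Fin (finrank ℝ (E k))) → ι → ℝ := fun a j =>
    fderiv ℝ (fderiv ℝ (F j)) y (e' a) (e' a) / F j y
  have hin : ∀ k a c, G k (y k) (e' a k) (e' c k) =
      if a = c then (if a.1 = k then (F k y ^ 2)⁻¹ else 0) else 0 := by
    intro k a c
    rw [he', he']
    simp only [Pi.smul_apply, map_smul, smul_apply, smul_eq_mul, hb, inner_piBasis e he]
    split_ifs with h1 h2
    · subst h1; subst h2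
      have := hF a.1
      field_simp
    · simp
    · simp
  have hD : ∀ a c d, fderiv ℝ (multiForm G F) y (e' a) (e' c) (e' d) =
      if c = d then 2 * x a c.1 else 0 := by
    intro a c d
    rw [h.fderiv_multiForm hy hn]
    simp only [hin]
    split_ifs with h1
    · simp only [mul_ite, mul_zero, Finset.sum_ite_eq, Finset.mem_univ, if_true, x]
      have := hF c.1
      field_simp
    · simp
  have hK : ∀ a c d, koszul (multiForm G F) y (e' a) (e' c) (e' d) =
      (if c = d then x a c.1 else 0) + (if a = d then x c a.1 else 0)
        - (if a = c then x d a.1 else 0) := by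
    intro a c d
    rw [koszul_apply, hD, hD, hD]
    split_ifs <;> ring
  -- The contribution of `G_k` alone, in the unscaled basis; its double sum is the partial scalar
  -- curvature of factor `k`.
  let q : ι → (Σ k, Fin (finrank ℝ (E k))) → (Σ k, Fin (finrank ℝ (E k))) → ℝ := fun k a c =>
    metricHess (G k) (y k) (b a k) (b c k) (b a k) (b c k)
      - metricHess (G k) (y k) (b a k) (b a k) (b c k) (b c k)
  have hek : ∀ a k, e' a k = (F k y)⁻¹ • b a k := by
    intro a k
    rw [he', Pi.smul_apply]
    by_cases hk : a.1 = k
    · rw [hk]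
    · rw [hb, Pi.basis_apply, Pi.single_eq_of_ne (Ne.symm hk), smul_zero, smul_zero]
  have hH : ∀ a c, metricHess (multiForm G F) y (e' a) (e' c) (e' a) (e' c)
      - metricHess (multiForm G F) y (e' a) (e' a) (e' c) (e' c) =
      (if a = c then 2 * x a a.1 ^ 2 + 2 * z a a.1 else 0)
        - (2 * x a c.1 ^ 2 + 2 * z a c.1) + ∑ k, q k a c / F k y ^ 2 := by
    intro a c
    rw [h.metricHess_multiForm hy hn, h.metricHess_multiForm hy hn]
    simp only [hin, if_true, Finset.sum_add_distrib]
    have h1 : ∀ k, F k y ^ 2 * metricHess (G k) (y k) (e' a k) (e' c k) (e' a k) (e' c k)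
        - F k y ^ 2 * metricHess (G k) (y k) (e' a k) (e' a k) (e' c k) (e' c k) =
          q k a c / F k y ^ 2 := by
      intro k
      simp only [hek, metricHess_smul, q]
      have := hF k
      field_simp
    simp only [← h1, Finset.sum_sub_distrib]
    have h2 : ∑ k, (2 * fderiv ℝ (F k) y (e' a) * fderiv ℝ (F k) y (e' c)
        + 2 * F k y * fderiv ℝ (fderiv ℝ (F k)) y (e' a) (e' c))
          * (if a = c then (if a.1 = k then (F k y ^ 2)⁻¹ else 0) else 0) =
        if a = c then 2 * x a a.1 ^ 2 + 2 * z a a.1 else 0 := by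
      split_ifs with hac
      · subst hac
        simp only [mul_ite, mul_zero, Finset.sum_ite_eq, Finset.mem_univ, if_true, x, z]
        have := hF a.1
        field_simp
      · simp
    have h3 : ∑ k, (2 * fderiv ℝ (F k) y (e' a) * fderiv ℝ (F k) y (e' a)
        + 2 * F k y * fderiv ℝ (fderiv ℝ (F k)) y (e' a) (e' a))
          * (if c.1 = k then (F k y ^ 2)⁻¹ else 0) = 2 * x a c.1 ^ 2 + 2 * z a c.1 := by
      simp only [mul_ite, mul_zero, Finset.sum_ite_eq, Finset.mem_univ, if_true, x, z]
      have := hF c.1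
      field_simp
    rw [h2, h3]
    ring
  -- Dividing by `F_k²` replaces the unit vectors of factor `k` by the scaled ones; linearity of
  -- `rhoForm` then splits `ρ_k` into contributions of single basis vectors.
  have hρ : ∀ k, localRho (multiForm G fun _ _ => 1) F k y / F k y ^ 2 =
      ∑ a : Fin (finrank ℝ (E k)), rhoForm (fun j => (finrank ℝ (E j) : ℝ)) (z ⟨k, a⟩)
        (fun i j => x ⟨k, a⟩ i * x ⟨k, a⟩ j) k := by
    intro k
    rw [← rhoForm_sum (fun j => (finrank ℝ (E j) : ℝ)) (fun a : Fin (finrank ℝ (E k)) => z ⟨k, a⟩)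
      (fun a i j => x ⟨k, a⟩ i * x ⟨k, a⟩ j) k, localRho, div_eq_inv_mul, ← rhoForm_smul]
    congr 1
    · ext j
      rw [h.localPartialLaplacian_eq hy he hn, Finset.sum_div, Finset.mul_sum]
      refine Finset.sum_congr rfl fun a _ => ?_
      simp only [z, he', hb, map_smul, smul_apply, smul_eq_mul]
      have := hF k
      field_simp
    · ext i j
      rw [localPartialGradInner_eq he, Finset.sum_div, Finset.mul_sum]
      refine Finset.sum_congr rfl fun a _ => ?_
      simp only [x, he', hb, map_smul, smul_eq_mul]
      have := hF k
      have := hF i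
      have := hF j
      field_simp
  have hS : ∀ k, localPartialScalar (multiForm G fun _ _ => 1) k y / F k y ^ 2 =
      ∑ a, ∑ c, q k a c / F k y ^ 2 := by
    intro k
    rw [h.localPartialScalar_eq hy he hn]
    simp only [Finset.sum_div]
    rfl
  have h6 : ∑ a, ∑ c, ∑ k, q k a c / F k y ^ 2 = ∑ k, ∑ a, ∑ c, q k a c / F k y ^ 2 := by
    refine Eq.trans (Finset.sum_congr rfl fun a _ => Finset.sum_comm) ?_
    exact Finset.sum_comm
  have h7 : ∑ k, ∑ a : Fin (finrank ℝ (E k)), rhoForm (fun j => (finrank ℝ (E j) : ℝ)) (z ⟨k, a⟩)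
        (fun i j => x ⟨k, a⟩ i * x ⟨k, a⟩ j) k =
      ∑ a, ((2 * x a a.1 ^ 2 + 2 * z a a.1)
        - ∑ j, (finrank ℝ (E j) : ℝ) * (2 * x a j ^ 2 + 2 * z a j)
        - (2 * x a a.1 - ∑ j, (finrank ℝ (E j) : ℝ) * x a j) ^ 2
        + (3 * ∑ j, (finrank ℝ (E j) : ℝ) * x a j ^ 2 - 2 * x a a.1 ^ 2)) := by
    rw [Fintype.sum_sigma]
    simp only [rhoForm_mul_self]
  have h8 : ∀ a, ∑ c, ((if a = c then 2 * x a a.1 ^ 2 + 2 * z a a.1 else 0)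
        - (2 * x a c.1 ^ 2 + 2 * z a c.1) + ∑ k, q k a c / F k y ^ 2) =
      (2 * x a a.1 ^ 2 + 2 * z a a.1)
        - ∑ j, (finrank ℝ (E j) : ℝ) * (2 * x a j ^ 2 + 2 * z a j)
        + ∑ c, ∑ k, q k a c / F k y ^ 2 := by
    intro a
    rw [Finset.sum_add_distrib, Finset.sum_sub_distrib,
      sum_sigma_fst (fun j => 2 * x a j ^ 2 + 2 * z a j)]
    simp
  have hKd : ∀ c, ∑ a, koszul (multiForm G F) y (e' a) (e' a) (e' c) =
      2 * x c c.1 - ∑ j, (finrank ℝ (E j) : ℝ) * x c j := fun c =>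
    (Finset.sum_congr rfl fun a _ => hK a a c).trans (sum_koszul_diag x c)
  rw [h.isMetricOn_multiForm.metricTrace_ricci_eq hy ho]
  simp only [hKd]
  simp only [hK, hH, sum_koszul_sq, add_div, hρ, hS, h8]
  rw [Finset.sum_add_distrib, h6, Finset.sum_add_distrib, h7]
  simp only [Finset.sum_add_distrib, Finset.sum_sub_distrib]
  ring

end IsMultiMetricOn

end ScalarCurvatureFormula

/-! ### Removing the assumption on first derivatives -/

section NormalCoordinates

/-- Coordinates in which the first derivatives of the metric vanish at a given point. -/
lemma IsMetricOn.exists_normal_coordinates {E : Type*} [NormedAddCommGroup E] [NormedSpace ℝ E]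
    [FiniteDimensional ℝ E] {U : Set E} {G : E → E →L[ℝ] E →L[ℝ] ℝ} (hG : IsMetricOn U G) {y : E}
    (hy : y ∈ U) : ∃ (V : Set E) (f : E → E), y ∈ V ∧ f y = y ∧
      fderiv ℝ f y = ContinuousLinearMap.id ℝ E ∧ ContDiff ℝ ∞ f ∧
      IsLocalIsometry V (fun z => pullbackForm (G (f z)) (fderiv ℝ f z)) f U G ∧
      fderiv ℝ (fun z => pullbackForm (G (f z)) (fderiv ℝ f z)) y = 0 := by
  set Γ := christoffelL G y with hΓ
  -- The quadratic correction is chosen so that `f` fixes `y`, has identity differential there, and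
  -- has second derivative `-Γ`, which cancels the Christoffel symbols in the transformation law.
  let f : E → E := fun z => z - (1 / 2 : ℝ) • Γ (z - y) (z - y)
  have hf' : ∀ z, HasFDerivAt f (ContinuousLinearMap.id ℝ E - Γ (z - y)) z := by
    intro z
    have h0 : HasFDerivAt (fun z => z - y) (ContinuousLinearMap.id ℝ E) z :=
      (hasFDerivAt_id z).sub_const y
    have h1 : HasFDerivAt (fun z => Γ (z - y)) (Γ.comp (ContinuousLinearMap.id ℝ E)) z :=
      Γ.hasFDerivAt.comp z h0
    have h2 := (hasFDerivAt_id z).sub ((h1.clm_apply h0).const_smul (1 / 2 : ℝ))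
    refine h2.congr_fderiv ?_
    ext u
    change u - (1 / 2 : ℝ) • (Γ (z - y) u + Γ u (z - y)) = u - Γ (z - y) u
    rw [hΓ, hG.christoffelL_symm hy u (z - y), ← two_smul ℝ, smul_smul]
    norm_num
  have hf1 : fderiv ℝ f = fun z => ContinuousLinearMap.id ℝ E - Γ (z - y) :=
    funext fun z => (hf' z).fderiv
  have hf2 : fderiv ℝ (fderiv ℝ f) y = -Γ := by
    rw [hf1]
    have h0 : HasFDerivAt (fun z => z - y) (ContinuousLinearMap.id ℝ E) y :=
      (hasFDerivAt_id y).sub_const y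
    have h1 : HasFDerivAt (fun z => Γ (z - y)) (Γ.comp (ContinuousLinearMap.id ℝ E)) y :=
      Γ.hasFDerivAt.comp y h0
    rw [(h1.const_sub _).fderiv]
    rfl
  have hfc : ContDiff ℝ ∞ f := by
    have h0 : ContDiff ℝ ∞ fun z => z - y := contDiff_id.sub contDiff_const
    exact contDiff_id.sub (((Γ.contDiff.comp h0).clm_apply h0).const_smul _)
  have hfy : f y = y := by simp [f]
  have hfy1 : fderiv ℝ f y = ContinuousLinearMap.id ℝ E := by rw [hf1]; simp
  have hiso : IsLocalIsometry (f ⁻¹' U ∩ {z | IsUnit (fderiv ℝ f z)})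
      (fun z => pullbackForm (G (f z)) (fderiv ℝ f z)) f U G :=
    { isMetricOn := hG
      isOpen := (hG.isOpen.preimage hfc.continuous).inter
        (Units.isOpen.preimage (hfc.continuous_fderiv (by simp)))
      contDiffOn := hfc.contDiffOn
      mapsTo := fun z hz => hz.1
      injective := by
        rintro z ⟨-, u, hu⟩
        rw [← hu]
        intro a b hab
        have : ((↑u⁻¹ : E →L[ℝ] E) * (u : E →L[ℝ] E)) a = ((↑u⁻¹ : E →L[ℝ] E) * ↑u) b :=
          congrArg (fun v => (↑u⁻¹ : E →L[ℝ] E) v) hab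
        rw [Units.inv_mul] at this
        exact this
      pullback := fun z _ => rfl }
  have hyV : y ∈ f ⁻¹' U ∩ {z | IsUnit (fderiv ℝ f z)} := by
    refine ⟨?_, ?_⟩
    · rw [mem_preimage, hfy]; exact hy
    · rw [mem_ofPred_eq, hfy1]; exact isUnit_one
  refine ⟨_, f, hyV, hfy, hfy1, hfc, hiso, ?_⟩
  have hΓ' : ∀ u v, christoffelL (fun z => pullbackForm (G (f z)) (fderiv ℝ f z)) y u v = 0 := by
    intro u v
    have := hiso.fderiv_christoffelL_pullback hyV u v
    rw [hf2, hfy1, hfy] at this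
    simpa [hΓ] using this
  -- Vanishing Christoffel symbols force vanishing first derivatives of the metric, by metric
  -- compatibility.
  ext u v w
  rw [← hiso.isMetricOn_pullback.koszul_add_koszul hyV,
    ← hiso.isMetricOn_pullback.inner_christoffelL hyV,
    ← hiso.isMetricOn_pullback.inner_christoffelL hyV, hΓ', hΓ']
  simp

variable {ι : Type*} [Fintype ι] [DecidableEq ι] {E : ι → Type*} [∀ i, NormedAddCommGroup (E i)]
  [∀ i, NormedSpace ℝ (E i)] [∀ i, FiniteDimensional ℝ (E i)]

namespace IsMultiMetricOn

variable {U : ∀ k, Set (E k)} {W : Set (∀ k, E k)} {G : ∀ k, E k → E k →L[ℝ] E k →L[ℝ] ℝ}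
  {F : ι → (∀ i, E i) → ℝ} (h : IsMultiMetricOn U W G F)

include h

omit [DecidableEq ι] in
/-- Product changes of coordinates are local isometries. -/
lemma isLocalIsometry {V : ∀ k, Set (E k)} {G' : ∀ k, E k → E k →L[ℝ] E k →L[ℝ] ℝ}
    {f : ∀ k, E k → E k} (hf : ∀ k, IsLocalIsometry (V k) (G' k) (f k) (U k) (G k))
    (hfc : ∀ k, ContDiff ℝ ∞ (f k)) :
    IsLocalIsometry ({x : ∀ k, E k | ∀ k, x k ∈ V k} ∩ (fun x k => f k (x k)) ⁻¹' W)
      (multiForm G' fun k x => F k fun k => f k (x k)) (fun x k => f k (x k)) W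
      (multiForm G F) ∧
    IsMultiMetricOn V ({x : ∀ k, E k | ∀ k, x k ∈ V k} ∩ (fun x k => f k (x k)) ⁻¹' W) G'
      (fun k x => F k fun k => f k (x k)) := by
  have hc : ContDiff ℝ ∞ (fun (x : ∀ k, E k) k => f k (x k)) :=
    contDiff_pi.2 fun k => (hfc k).comp (ContinuousLinearMap.proj (R := ℝ) (φ := E) k).contDiff
  have ho : IsOpen ({x : ∀ k, E k | ∀ k, x k ∈ V k} ∩ (fun x k => f k (x k)) ⁻¹' W) := by
    refine IsOpen.inter ?_ (h.isOpen.preimage hc.continuous)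
    simp only [ofPred_forall]
    exact isOpen_iInter_of_finite fun k => (hf k).isOpen.preimage (continuous_apply k)
  have hd : ∀ (x : ∀ k, E k) (u : ∀ k, E k) (k : ι),
      fderiv ℝ (fun (x : ∀ k, E k) k => f k (x k)) x u k = fderiv ℝ (f k) (x k) (u k) := by
    intro x u k
    have h1 : HasFDerivAt (fun (x : ∀ k, E k) k => f k (x k)) (ContinuousLinearMap.pi fun k =>
        (fderiv ℝ (f k) (x k)).comp (ContinuousLinearMap.proj (R := ℝ) (φ := E) k)) x :=
      hasFDerivAt_pi.2 fun k => HasFDerivAt.comp (g := f k) x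
        ((hfc k).differentiable (by simp) (x k)).hasFDerivAt
        (ContinuousLinearMap.proj (R := ℝ) (φ := E) k).hasFDerivAt
    rw [h1.fderiv]
    rfl
  refine ⟨⟨h.isMetricOn_multiForm, ho, hc.contDiffOn, fun x hx => hx.2, ?_, ?_⟩,
    ⟨fun k => (hf k).isMetricOn_pullback, ho, fun x hx => hx.1, fun k => ?_,
      fun x hx k => h.pos _ hx.2 k⟩⟩
  · intro x hx u v huv
    ext k
    have := congrFun huv k
    rw [hd, hd] at this
    rw [(hf k).injective (x k) (hx.1 k) this]
  · intro x hx
    ext u v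
    rw [pullbackForm_apply, multiForm_apply, multiForm_apply]
    refine Finset.sum_congr rfl fun k _ => ?_
    rw [hd, hd, (hf k).pullback _ (hx.1 k), pullbackForm_apply]
  · exact (h.contDiffOn k).comp hc.contDiffOn fun x hx => hx.2

variable {y : ∀ k, E k} (hy : y ∈ W)

include hy

/-- The scalar curvature of `∑ k, F_k² G_k`. -/
theorem metricTrace_ricci_multiForm :
    metricTrace (multiForm G F y) (ricci (multiForm G F) y) =
      ∑ k, (localPartialScalar (multiForm G fun _ _ => 1) k y
        + localRho (multiForm G fun _ _ => 1) F k y) / F k y ^ 2 := by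
  choose V f hyV hfy hfy1 hfc hiso hn using fun k =>
    (h.isMetricOn k).exists_normal_coordinates (h.mem y hy k)
  set G' : ∀ k, E k → E k →L[ℝ] E k →L[ℝ] ℝ := fun k z =>
    pullbackForm (G k (f k z)) (fderiv ℝ (f k) z) with hG'
  obtain ⟨hI, hM⟩ := h.isLocalIsometry (G' := G') hiso hfc
  obtain ⟨hI1, hM1⟩ := h.one.isLocalIsometry (G' := G') hiso hfc
  have hΦy : (fun k => f k (y k)) = y := funext hfy
  have hyW : y ∈ {x : ∀ k, E k | ∀ k, x k ∈ V k} ∩ (fun x k => f k (x k)) ⁻¹' W :=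
    ⟨hyV, by rw [mem_preimage, hΦy]; exact hy⟩
  have hD : fderiv ℝ (fun (x : ∀ k, E k) k => f k (x k)) y =
      ContinuousLinearMap.id ℝ (∀ k, E k) := by
    have h1 : HasFDerivAt (fun (x : ∀ k, E k) k => f k (x k)) (ContinuousLinearMap.pi fun k =>
        (fderiv ℝ (f k) (y k)).comp (ContinuousLinearMap.proj (R := ℝ) (φ := E) k)) y :=
      hasFDerivAt_pi.2 fun k => HasFDerivAt.comp (g := f k) y
        ((hfc k).differentiable (by simp) (y k)).hasFDerivAt
        (ContinuousLinearMap.proj (R := ℝ) (φ := E) k).hasFDerivAt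
    rw [h1.fderiv]
    ext u k
    simp [hfy1]
  -- The coordinate change fixes `y` with identity differential, so every tensor at `y` keeps its
  -- components and the projections onto the factors need no transformation.
  have hval : multiForm G' (fun _ _ => 1) y = multiForm G (fun _ _ => 1) y := by
    have := hI1.pullback y hyW
    rw [hD, hΦy] at this
    exact this
  have hric : ∀ v w, ricci (multiForm G' fun _ _ => 1) y v w =
      ricci (multiForm G fun _ _ => 1) y v w := by
    intro v w
    have := hI1.ricci_pullback hyW v w
    rw [hD, hΦy] at this
    exact this
  have hS : ∀ k, localPartialScalar (multiForm G' fun _ _ => 1) k y =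
      localPartialScalar (multiForm G fun _ _ => 1) k y := by
    intro k
    simp only [localPartialScalar, hval, hric]
  have hL : ∀ k j, localPartialLaplacian (multiForm G' fun _ _ => 1) k
      (fun x => F j fun k => f k (x k)) y =
      localPartialLaplacian (multiForm G fun _ _ => 1) k (F j) y := by
    intro k j
    have hh : ∀ u v, hessian (multiForm G' fun _ _ => 1) (fun x => F j fun k => f k (x k)) y u v =
        hessian (multiForm G fun _ _ => 1) (F j) y u v := by
      intro u v
      have := hI1.hessian_pullback hyW (h.contDiffOn j) u v
      rw [hD, hΦy] at this
      exact this
    simp only [localPartialLaplacian, hval, hh]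
  have hg : ∀ j, gradient (multiForm G' fun _ _ => 1) (fun x => F j fun k => f k (x k)) y =
      gradient (multiForm G fun _ _ => 1) (F j) y := by
    intro j
    have h1 := HasFDerivAt.comp (g := F j) (f := fun (x : ∀ k, E k) k => f k (x k)) y
      ((h.contDiffOn j).hasFDerivAt_top h.isOpen hyW.2)
      (hI.contDiffOn.hasFDerivAt_top hI.isOpen hyW)
    have h2 : fderiv ℝ (fun x => F j fun k => f k (x k)) y = fderiv ℝ (F j) y := by
      refine h1.fderiv.trans ?_
      rw [hD, hΦy]
      rfl
    rw [gradient, gradient, hval, h2]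
  have h1 := hI.metricTrace_ricci_pullback hyW
  rw [hΦy] at h1
  rw [← h1, hM.metricTrace_ricci_multiForm_of_fderiv_eq_zero hyW hn]
  refine Finset.sum_congr rfl fun k _ => ?_
  simp only [hS, localRho, hL, localPartialGradInner, hval, hg, hΦy]

end IsMultiMetricOn

end NormalCoordinates

lemma contDiffAt_of_clm_apply {D E F : Type*} [NormedAddCommGroup D] [NormedSpace ℝ D]
    [NormedAddCommGroup E] [NormedSpace ℝ E] [FiniteDimensional ℝ E] [NormedAddCommGroup F]
    [NormedSpace ℝ F] {n : ℕ∞ω} {f : D → E →L[ℝ] F} {x : D}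
    (h : ∀ y, ContDiffAt ℝ n (fun x => f x y) x) : ContDiffAt ℝ n f x := by
  let e₁ := ContinuousLinearEquiv.ofFinrankEq (finrank_fin_fun ℝ (n := finrank ℝ E)).symm
  let e₂ := (e₁.arrowCongr (1 : F ≃L[ℝ] F)).trans (ContinuousLinearEquiv.piRing (Fin (finrank ℝ E)))
  rw [← Function.id_comp f, ← e₂.symm_comp_self]
  exact e₂.symm.contDiff.contDiffAt.comp x (contDiffAt_pi.mpr fun i => h _)

/-! ### From manifolds to coordinate expressions -/

section ChartMetric

variable {E : Type*} [NormedAddCommGroup E] [NormedSpace ℝ E]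
  {H : Type*} [TopologicalSpace H] {I : ModelWithCorners ℝ E H}
  {M : Type*} [TopologicalSpace M] [ChartedSpace H M] [IsManifold I ∞ M]

/-- The metric at `x` as a bilinear form on the model space. -/
def innerModel (g : RiemannianMetricOn I M) (x : M) : E →L[ℝ] E →L[ℝ] ℝ := g.inner x

lemma innerModel_isInnerForm (g : RiemannianMetricOn I M) (x : M) :
    IsInnerForm (innerModel g x) := ⟨g.symm x, g.pos x⟩

variable (I) in
/-- The differential of the inverse of the chart at `p`, in the model space. -/
def chartSymmDeriv (p : M) (y : E) : E →L[ℝ] E :=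
  mfderivWithin 𝓘(ℝ, E) I (extChartAt I p).symm (range I) y

lemma chartMetric_eq (g : RiemannianMetricOn I M) (p : M) (y : E) :
    chartMetric g p y =
      pullbackForm (innerModel g ((extChartAt I p).symm y)) (chartSymmDeriv I p y) := rfl

lemma chartSymmDeriv_injective {p : M} {y : E} (hy : y ∈ (extChartAt I p).target) :
    Function.Injective (chartSymmDeriv I p y) := by
  have : IsManifold I 1 M := IsManifold.of_le (n := ∞) (by simp)
  exact (isInvertible_mfderivWithin_extChartAt_symm hy).injective

lemma chartMetric_isInnerForm (g : RiemannianMetricOn I M) {p : M} {y : E}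
    (hy : y ∈ (extChartAt I p).target) : IsInnerForm (chartMetric g p y) := by
  rw [chartMetric_eq]
  exact (innerModel_isInnerForm g _).pullback (chartSymmDeriv_injective hy)

variable [I.Boundaryless]

variable (I) in
/-- The coordinate change from the chart at `p` to the chart at `q`. -/
def chartChange (p q : M) (y : E) : E := extChartAt I q ((extChartAt I p).symm y)

variable (I) in
/-- The domain of the coordinate change from the chart at `p` to the chart at `q`. -/
def chartChangeSource (p q : M) : Set E :=
  (extChartAt I p).target ∩ (extChartAt I p).symm ⁻¹' (extChartAt I q).source

omit [IsManifold I ∞ M] in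
lemma isOpen_chartChangeSource (p q : M) : IsOpen (chartChangeSource I p q) :=
  (continuousOn_extChartAt_symm p).isOpen_inter_preimage (isOpen_extChartAt_target p)
    (isOpen_extChartAt_source q)

omit [I.Boundaryless] in
lemma contDiffOn_chartChange (p q : M) :
    ContDiffOn ℝ ∞ (chartChange I p q) (chartChangeSource I p q) := by
  rw [← contMDiffOn_iff_contDiffOn]
  refine (contMDiffOn_extChartAt (x := q)).comp
    ((contMDiffOn_extChartAt_symm p).mono inter_subset_left) fun y hy => ?_
  rw [← extChartAt_source (I := I)]
  exact hy.2

omit [IsManifold I ∞ M] [I.Boundaryless] in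
lemma mapsTo_chartChange (p q : M) :
    MapsTo (chartChange I p q) (chartChangeSource I p q) (chartChangeSource I q p) := by
  rintro y ⟨hy1, hy2⟩
  refine ⟨(extChartAt I q).map_source hy2, ?_⟩
  rw [mem_preimage, chartChange, (extChartAt I q).left_inv hy2]
  exact (extChartAt I p).map_target hy1

omit [IsManifold I ∞ M] [I.Boundaryless] in
lemma chartChange_chartChange {p q : M} {y : E} (hy : y ∈ chartChangeSource I p q) :
    chartChange I q p (chartChange I p q y) = y := by
  rw [chartChange, chartChange, (extChartAt I q).left_inv hy.2, (extChartAt I p).right_inv hy.1]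

omit [IsManifold I ∞ M] [I.Boundaryless] in
lemma symm_chartChange {p q : M} {y : E} (hy : y ∈ chartChangeSource I p q) :
    (extChartAt I q).symm (chartChange I p q y) = (extChartAt I p).symm y :=
  (extChartAt I q).left_inv hy.2

/-- The chain rule for the inverse chart at `p`, factored through the chart at `q`. Without boundary
the derivatives within `range I` are ordinary ones. -/
lemma chartSymmDeriv_comp {p q : M} {y : E} (hy : y ∈ chartChangeSource I p q) :
    (chartSymmDeriv I q (chartChange I p q y)).comp (fderiv ℝ (chartChange I p q) y) =
      chartSymmDeriv I p y := by
  have : IsManifold I 1 M := IsManifold.of_le (n := ∞) (by simp)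
  have hu : range I = univ := I.range_eq_univ
  have h1 : MDifferentiableAt 𝓘(ℝ, E) I (extChartAt I q).symm (chartChange I p q y) := by
    have := mdifferentiableWithinAt_extChartAt_symm (I := I) (mapsTo_chartChange p q hy).1
    rwa [hu, mdifferentiableWithinAt_univ] at this
  have h2 : MDifferentiableAt 𝓘(ℝ, E) 𝓘(ℝ, E) (chartChange I p q) y :=
    ((contDiffOn_chartChange p q).hasFDerivAt_top
      (isOpen_chartChangeSource p q) hy).differentiableAt.mdifferentiableAt
  have h3 := mfderiv_comp y h1 h2
  have h4 : (extChartAt I q).symm ∘ chartChange I p q =ᶠ[𝓝 y] (extChartAt I p).symm := by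
    filter_upwards [(isOpen_chartChangeSource p q).mem_nhds hy] with z hz
    exact symm_chartChange hz
  have h5 : mfderiv 𝓘(ℝ, E) I ((extChartAt I q).symm ∘ chartChange I p q) y =
    mfderiv 𝓘(ℝ, E) I (extChartAt I p).symm y := h4.mfderiv_eq
  unfold chartSymmDeriv
  rw [hu, mfderivWithin_univ, mfderivWithin_univ, ← mfderiv_eq_fderiv]
  exact h3.symm.trans h5

lemma chartMetric_chartChange (g : RiemannianMetricOn I M) {p q : M} {y : E}
    (hy : y ∈ chartChangeSource I p q) : chartMetric g p y =
      pullbackForm (chartMetric g q (chartChange I p q y)) (fderiv ℝ (chartChange I p q) y) := by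
  ext u v
  rw [chartMetric_eq, chartMetric_eq, symm_chartChange hy, pullbackForm_apply, pullbackForm_apply,
    pullbackForm_apply, ← chartSymmDeriv_comp hy]
  rfl

lemma fderiv_chartChange_injective {p q : M} {y : E} (hy : y ∈ chartChangeSource I p q) :
    Function.Injective (fderiv ℝ (chartChange I p q) y) := by
  have h := chartSymmDeriv_injective hy.1
  rw [← chartSymmDeriv_comp hy] at h
  exact Function.Injective.of_comp h

/-- The tangent bundle trivialization at `q` is inverted by the differential of the inverse chart at
`q`. Near the centre, the coordinate expression is therefore the one in which smoothness of the
section `g` is defined. -/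
lemma contDiffAt_chartMetric_self (g : RiemannianMetricOn I M) (q : M) :
    ContDiffAt ℝ ∞ (chartMetric g q) (extChartAt I q q) := by
  have : IsManifold I 1 M := IsManifold.of_le (n := ∞) (by simp)
  have hg := ((contMDiffAt_hom_bundle _).1 (g.contMDiff q)).2
  have hs : ContMDiffAt 𝓘(ℝ, E) I ∞ (extChartAt I q).symm (extChartAt I q q) :=
    (contMDiffOn_extChartAt_symm q).contMDiffAt (extChartAt_target_mem_nhds q)
  have hc := ContMDiffAt.comp_of_eq hg hs (extChartAt_to_inv (I := I) q)
  rw [← contMDiffAt_iff_contDiffAt]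
  refine hc.congr_of_eventuallyEq ?_
  filter_upwards [extChartAt_target_mem_nhds (I := I) q] with y hy
  have hx : (extChartAt I q).symm y ∈ (chartAt H q).source := by
    rw [← extChartAt_source (I := I)]; exact (extChartAt I q).map_target hy
  have hD : ∀ u : E, (trivializationAt E (TangentSpace I) q).symm ((extChartAt I q).symm y) u =
      chartSymmDeriv I q y u := by
    intro u
    rw [← Bundle.Trivialization.symmL_apply (R := ℝ) _ (by simpa using hx),
      TangentBundle.symmL_trivializationAt hx, (extChartAt I q).right_inv hy]
    rfl
  ext u v
  rw [Function.comp_apply,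
    inCoordinates_apply_eq₂ (by simpa using hx) (by simpa using hx) (by simp)]
  simp only [Bundle.Trivial.linearMapAt_trivialization, LinearMap.id_apply,
    Bundle.Trivial.fiberBundle_trivializationAt']
  exact (congrArg₂ (fun a b => innerModel g _ a b) (hD u) (hD v)).symm

variable [FiniteDimensional ℝ E]

lemma isMetricOn_chartMetric (g : RiemannianMetricOn I M) (p : M) :
    IsMetricOn (extChartAt I p).target (chartMetric g p) where
  isOpen := isOpen_extChartAt_target p
  inner y hy := chartMetric_isInnerForm g hy
  contDiffOn := by
    intro y hy
    refine ContDiffAt.contDiffWithinAt ?_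
    -- Smoothness is known at the centre of a chart only; at another point, compare with the chart
    -- centred there.
    set q := (extChartAt I p).symm y with hq
    have hyq : y ∈ chartChangeSource I p q := ⟨hy, mem_extChartAt_source q⟩
    have hnhds := (isOpen_chartChangeSource p q).mem_nhds hyq
    have hc := (contDiffOn_chartChange p q).contDiffAt hnhds
    have hd := ((contDiffOn_chartChange p q).fderiv_top
      (isOpen_chartChangeSource p q)).contDiffAt hnhds
    have hG := (contDiffAt_chartMetric_self g q).comp y hc
    refine ContDiffAt.congr_of_eventuallyEq ?_
      (Filter.eventually_of_mem hnhds fun z hz => chartMetric_chartChange g hz)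
    refine contDiffAt_of_clm_apply fun u => contDiffAt_of_clm_apply fun v => ?_
    exact (hG.clm_apply (hd.clm_apply contDiffAt_const)).clm_apply (hd.clm_apply contDiffAt_const)

lemma isLocalIsometry_chartChange (g : RiemannianMetricOn I M) (p q : M) :
    IsLocalIsometry (chartChangeSource I p q) (chartMetric g p) (chartChange I p q)
      (extChartAt I q).target (chartMetric g q) where
  isMetricOn := isMetricOn_chartMetric g q
  isOpen := isOpen_chartChangeSource p q
  contDiffOn := contDiffOn_chartChange p q
  mapsTo := fun _ hy => (mapsTo_chartChange p q hy).1
  injective := fun _ hy => fderiv_chartChange_injective hy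
  pullback := fun _ hy => chartMetric_chartChange g hy

/-- The scalar curvature can be computed in any chart. -/
lemma scalarCurvature_eq (g : RiemannianMetricOn I M) {p x : M}
    (hx : x ∈ (extChartAt I p).source) : scalarCurvature g x =
      metricTrace (chartMetric g p (extChartAt I p x))
        (ricci (chartMetric g p) (extChartAt I p x)) := by
  have hy : extChartAt I x x ∈ chartChangeSource I x p := by
    refine ⟨mem_extChartAt_target x, ?_⟩
    rw [mem_preimage, extChartAt_to_inv]
    exact hx
  have h := (isLocalIsometry_chartChange g x p).metricTrace_ricci_pullback hy
  rw [chartChange, extChartAt_to_inv] at h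
  exact h

/-- The definition uses a chart that moves with the point; chart independence allows one fixed chart
near `p`. -/
lemma continuous_scalarCurvature (g : RiemannianMetricOn I M) : Continuous (scalarCurvature g) := by
  rw [continuous_iff_continuousAt]
  intro p
  have h1 : ContinuousOn (fun x => metricTrace (chartMetric g p (extChartAt I p x))
      (ricci (chartMetric g p) (extChartAt I p x))) (extChartAt I p).source :=
    (isMetricOn_chartMetric g p).continuousOn_metricTrace_ricci.comp
      (continuousOn_extChartAt p) (extChartAt I p).mapsTo
  exact (h1.congr fun x hx => scalarCurvature_eq g hx).continuousAt (extChartAt_source_mem_nhds p)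

end ChartMetric

/-! ### Product charts and the scalar curvature formula -/

section PiChart

variable {ι : Type*} [Fintype ι]
  {E : ι → Type*} [∀ i, NormedAddCommGroup (E i)] [∀ i, NormedSpace ℝ (E i)]
  {H : ι → Type*} [∀ i, TopologicalSpace (H i)] {I : ∀ i, ModelWithCorners ℝ (E i) (H i)}
  {M : ι → Type*} [∀ i, TopologicalSpace (M i)] [∀ i, ChartedSpace (H i) (M i)]
  [∀ i, IsManifold (I i) ∞ (M i)] [∀ i, (I i).Boundaryless]

omit [∀ i, IsManifold (I i) ∞ (M i)] [∀ i, (I i).Boundaryless] in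
lemma mem_extChartAt_pi_target {p : ∀ i, M i} {y : ∀ i, E i}
    (hy : y ∈ (extChartAt (ModelWithCorners.pi I) p).target) (k : ι) :
    y k ∈ (extChartAt (I k) (p k)).target := by
  have h1 := (extChartAt (ModelWithCorners.pi I) p).map_target hy
  have h2 : (extChartAt (I k) (p k)).symm (y k) ∈ (extChartAt (I k) (p k)).source := by
    rw [extChartAt_source] at h1 ⊢
    exact h1 k (mem_univ k)
  have h3 := congrFun ((extChartAt (ModelWithCorners.pi I) p).right_inv hy) k
  rw [extChartAt_pi_apply, extChartAt_pi_symm_apply] at h3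
  rw [← h3]
  exact (extChartAt (I k) (p k)).map_source h2

/-- Differentiate in two ways the composite of the inverse product chart with the `k`-th projection,
which is also the `k`-th coordinate followed by the inverse chart of that factor. -/
lemma chartSymmDeriv_pi {p : ∀ i, M i} {y : ∀ i, E i}
    (hy : y ∈ (extChartAt (ModelWithCorners.pi I) p).target) (u : ∀ i, E i) (k : ι) :
    chartSymmDeriv (ModelWithCorners.pi I) p y u k = chartSymmDeriv (I k) (p k) (y k) (u k) := by
  have : ∀ i, IsManifold (I i) 1 (M i) := fun i => IsManifold.of_le (n := ∞) (by simp)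
  have hu : range (ModelWithCorners.pi I) = univ := (ModelWithCorners.pi I).range_eq_univ
  have huk : range (I k) = univ := (I k).range_eq_univ
  have h1 : MDifferentiableAt 𝓘(ℝ, ∀ i, E i) (ModelWithCorners.pi I)
      (extChartAt (ModelWithCorners.pi I) p).symm y := by
    have := mdifferentiableWithinAt_extChartAt_symm (I := ModelWithCorners.pi I) hy
    rwa [hu, mdifferentiableWithinAt_univ] at this
  have h2 : MDifferentiableAt 𝓘(ℝ, E k) (I k) (extChartAt (I k) (p k)).symm (y k) := by
    have := mdifferentiableWithinAt_extChartAt_symm (I := I k) (mem_extChartAt_pi_target hy k)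
    rwa [huk, mdifferentiableWithinAt_univ] at this
  have h3 : HasMFDerivAt 𝓘(ℝ, ∀ i, E i) 𝓘(ℝ, E k) (fun z : ∀ i, E i => z k) y
      (ContinuousLinearMap.proj (R := ℝ) (φ := E) k) :=
    (ContinuousLinearMap.proj (R := ℝ) (φ := E) k).hasFDerivAt.hasMFDerivAt
  have h4 : MDifferentiableAt (ModelWithCorners.pi I) (I k) (fun x : ∀ j, M j => x k)
      ((extChartAt (ModelWithCorners.pi I) p).symm y) :=
    (contMDiff_eval (n := ∞) k).mdifferentiableAt (by simp)
  have h5 := mfderiv_comp y h4 h1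
  have h6 := mfderiv_comp (g := (extChartAt (I k) (p k)).symm) y h2 h3.mdifferentiableAt
  rw [h3.mfderiv] at h6
  have h7 := mfderiv_eval ((extChartAt (ModelWithCorners.pi I) p).symm y) k
    (mfderiv 𝓘(ℝ, ∀ i, E i) (ModelWithCorners.pi I)
      (extChartAt (ModelWithCorners.pi I) p).symm y u)
  unfold chartSymmDeriv
  rw [hu, huk, mfderivWithin_univ, mfderivWithin_univ]
  refine h7.symm.trans ?_
  exact congrArg (fun L => L u) (h5.symm.trans h6)

lemma chartMetric_multiconformalMetric (g : ∀ i, RiemannianMetricOn (I i) (M i))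
    (f : ι → (∀ j, M j) → ℝ)
    (hf : ∀ i, ContMDiff (ModelWithCorners.pi I) 𝓘(ℝ, ℝ) ∞ (f i)) (hpos : ∀ i x, 0 < f i x)
    {p : ∀ i, M i} {y : ∀ i, E i} (hy : y ∈ (extChartAt (ModelWithCorners.pi I) p).target) :
    chartMetric (multiconformalMetric g f hf hpos) p y =
      multiForm (fun k => chartMetric (g k) (p k))
        (fun k => f k ∘ (extChartAt (ModelWithCorners.pi I) p).symm) y := by
  ext u v
  rw [multiForm_apply, chartMetric_eq, pullbackForm_apply]
  refine (multiconformalForm_apply g f _ _ _).trans ?_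
  refine Finset.sum_congr rfl fun k _ => ?_
  rw [chartMetric_eq, pullbackForm_apply, ← chartSymmDeriv_pi hy, ← chartSymmDeriv_pi hy]
  rfl

variable [∀ i, FiniteDimensional ℝ (E i)]

lemma isMultiMetricOn_chartMetric (g : ∀ i, RiemannianMetricOn (I i) (M i))
    (f : ι → (∀ j, M j) → ℝ)
    (hf : ∀ i, ContMDiff (ModelWithCorners.pi I) 𝓘(ℝ, ℝ) ∞ (f i)) (hpos : ∀ i x, 0 < f i x)
    (p : ∀ i, M i) : IsMultiMetricOn (fun k => (extChartAt (I k) (p k)).target)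
      (extChartAt (ModelWithCorners.pi I) p).target (fun k => chartMetric (g k) (p k))
      (fun k => f k ∘ (extChartAt (ModelWithCorners.pi I) p).symm) where
  isMetricOn k := isMetricOn_chartMetric (g k) (p k)
  isOpen := isOpen_extChartAt_target p
  mem y hy k := mem_extChartAt_pi_target hy k
  contDiffOn k := by
    rw [← contMDiffOn_iff_contDiffOn]
    exact (hf k).comp_contMDiffOn (contMDiffOn_extChartAt_symm p)
  pos y _ k := hpos k _

/-- The scalar curvature of the metric `f_1² g_1 ⊕ ⋯ ⊕ f_l² g_l`. -/
theorem scalarCurvature_multiconformalMetric [DecidableEq ι]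
    (g : ∀ i, RiemannianMetricOn (I i) (M i)) (f : ι → (∀ j, M j) → ℝ)
    (hf : ∀ i, ContMDiff (ModelWithCorners.pi I) 𝓘(ℝ, ℝ) ∞ (f i)) (hpos : ∀ i x, 0 < f i x)
    (x : ∀ i, M i) : scalarCurvature (multiconformalMetric g f hf hpos) x =
      ∑ k, (partialScalarCurvature (productMetric g) k x + rho (productMetric g) f k x)
        / f k x ^ 2 := by
  set y := extChartAt (ModelWithCorners.pi I) x x with hy
  have hyt : y ∈ (extChartAt (ModelWithCorners.pi I) x).target := mem_extChartAt_target x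
  have hnhds := (isOpen_extChartAt_target (I := ModelWithCorners.pi I) x).mem_nhds hyt
  have h1 : chartMetric (multiconformalMetric g f hf hpos) x =ᶠ[𝓝 y]
      multiForm (fun k => chartMetric (g k) (x k))
        (fun k => f k ∘ (extChartAt (ModelWithCorners.pi I) x).symm) :=
    Filter.eventually_of_mem hnhds fun z hz => chartMetric_multiconformalMetric g f hf hpos hz
  have h2 : chartMetric (productMetric g) x =ᶠ[𝓝 y]
      multiForm (fun k => chartMetric (g k) (x k)) (fun _ _ => 1) :=
    Filter.eventually_of_mem hnhds fun z hz => chartMetric_multiconformalMetric g _ _ _ hz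
  have hfx : ∀ k, (f k ∘ (extChartAt (ModelWithCorners.pi I) x).symm) y = f k x := fun k =>
    congrArg (f k) (extChartAt_to_inv (I := ModelWithCorners.pi I) x)
  have h3 := (isMultiMetricOn_chartMetric g f hf hpos x).metricTrace_ricci_multiForm hyt
  have hS : ∀ k, partialScalarCurvature (productMetric g) k x =
      localPartialScalar (multiForm (fun k => chartMetric (g k) (x k)) fun _ _ => 1) k y := by
    intro k
    simp only [partialScalarCurvature, localPartialScalar, ← hy, h2.eq_of_nhds, ricci_congr h2]
  have hL : ∀ k j, partialLaplacian (productMetric g) k (f j) x =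
      localPartialLaplacian (multiForm (fun k => chartMetric (g k) (x k)) fun _ _ => 1) k
        (f j ∘ (extChartAt (ModelWithCorners.pi I) x).symm) y := by
    intro k j
    simp only [partialLaplacian, localPartialLaplacian, ← hy, h2.eq_of_nhds,
      hessian_congr h2 Filter.EventuallyEq.rfl]
  have hg : ∀ k i j, partialGradInner (productMetric g) k (f i) (f j) x =
      localPartialGradInner (multiForm (fun k => chartMetric (g k) (x k)) fun _ _ => 1) k
        (f i ∘ (extChartAt (ModelWithCorners.pi I) x).symm)
        (f j ∘ (extChartAt (ModelWithCorners.pi I) x).symm) y := by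
    intro k i j
    simp only [partialGradInner, localPartialGradInner, gradient, ← hy, h2.eq_of_nhds]
  have hρ : ∀ k, rho (productMetric g) f k x =
      localRho (multiForm (fun k => chartMetric (g k) (x k)) fun _ _ => 1)
        (fun k => f k ∘ (extChartAt (ModelWithCorners.pi I) x).symm) k y := by
    intro k
    simp only [rho, localRho, rhoForm, hL, hg, hfx, sq]
  simp only [hS, hρ, ← hfx]
  rw [← h3, scalarCurvature, ← hy, h1.eq_of_nhds]
  have h4 : ricci (chartMetric (multiconformalMetric g f hf hpos) x) y =
      ricci (multiForm (fun k => chartMetric (g k) (x k))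
        (fun k => f k ∘ (extChartAt (ModelWithCorners.pi I) x).symm)) y :=
    funext fun u => funext fun v => ricci_congr h1 u v
  rw [h4]

omit [∀ i, (I i).Boundaryless] [∀ i, IsManifold (I i) ∞ (M i)] in
-- The form `∑ k, F_k² G_k` is the pullback of `∑ k, G_k` along the map that scales factor `k` by
-- `F_k`, whose determinant is `∏ F_k ^ m_k`.
lemma gram_multiForm_det (G : ∀ k, E k → E k →L[ℝ] E k →L[ℝ] ℝ) (F : ι → (∀ i, E i) → ℝ)
    (y : ∀ i, E i) : (gram (multiForm G F y)).det =
      (∏ k, F k y ^ finrank ℝ (E k)) ^ 2 * (gram (multiForm G (fun _ _ => 1) y)).det := by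
  classical
  let D : (∀ i, E i) →L[ℝ] (∀ i, E i) :=
    ContinuousLinearMap.pi fun k => F k y • ContinuousLinearMap.proj (R := ℝ) (φ := E) k
  have h1 : multiForm G F y = pullbackForm (multiForm G (fun _ _ => 1) y) D := by
    ext u v
    rw [pullbackForm_apply, multiForm_apply, multiForm_apply]
    refine Finset.sum_congr rfl fun k _ => ?_
    simp [D]
    ring
  have h2 : D.det = ∏ k, F k y ^ finrank ℝ (E k) := by
    let b := Pi.basis fun k => finBasis ℝ (E k)
    have h3 : LinearMap.toMatrix b b D.toLinearMap = Matrix.diagonal fun a => F a.1 y := by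
      ext a c
      rw [LinearMap.toMatrix_apply, Matrix.diagonal_apply]
      have h4 : D.toLinearMap (b c) = F c.1 y • b c := by
        ext k
        simp only [D, b, Pi.basis_apply, ContinuousLinearMap.coe_coe, ContinuousLinearMap.pi_apply,
          smul_apply, ContinuousLinearMap.proj_apply, Pi.smul_apply]
        by_cases hk : c.1 = k
        · subst hk; rfl
        · rw [Pi.single_eq_of_ne (Ne.symm hk), smul_zero, smul_zero]
      rw [h4, map_smul, Basis.repr_self, Finsupp.smul_apply, Finsupp.single_apply, smul_eq_mul]
      by_cases hac : a = c
      · subst hac; simp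
      · simp [hac, Ne.symm hac]
    rw [ContinuousLinearMap.det, ← LinearMap.det_toMatrix b, h3, Matrix.det_diagonal,
      Fintype.prod_sigma]
    simp
  rw [h1, gram_pullbackForm_det, h2]

end PiChart

/-! ### Riemannian volume: densities, chart changes, finiteness -/

section Volume

variable {E : Type*} [NormedAddCommGroup E] [NormedSpace ℝ E] [FiniteDimensional ℝ E]
  [MeasurableSpace E] [BorelSpace E]
  {H : Type*} [TopologicalSpace H] {I : ModelWithCorners ℝ E H} [I.Boundaryless]
  {M : Type*} [TopologicalSpace M] [ChartedSpace H M] [IsManifold I ∞ M]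
  [MeasurableSpace M] [BorelSpace M]

/-- The density of the Riemannian volume in the chart at `p`. -/
def volumeDensity (g : RiemannianMetricOn I M) (p : M) (y : E) : ℝ :=
  Real.sqrt (gram (chartMetric g p y)).det

omit [MeasurableSpace E] [BorelSpace E] [MeasurableSpace M] [BorelSpace M] in
lemma continuousOn_volumeDensity (g : RiemannianMetricOn I M) (p : M) :
    ContinuousOn (volumeDensity g p) (extChartAt I p).target :=
  (contDiffOn_matrix_det (isMetricOn_chartMetric g p).contDiffOn_gram).continuousOn.sqrt

omit [IsManifold I ∞ M] [FiniteDimensional ℝ E] in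
lemma aemeasurable_extChartAt_symm (p : M) (μ : Measure E) :
    AEMeasurable (extChartAt I p).symm (μ.restrict (extChartAt I p).target) :=
  (continuousOn_extChartAt_symm p).aemeasurable (isOpen_extChartAt_target p).measurableSet

omit [MeasurableSpace M] [BorelSpace M] in
lemma aemeasurable_volumeDensity (g : RiemannianMetricOn I M) (p : M) (μ : Measure E) :
    AEMeasurable (fun y => ENNReal.ofReal (volumeDensity g p y))
      (μ.restrict (extChartAt I p).target) :=
  ((continuousOn_volumeDensity g p).aemeasurable
    (isOpen_extChartAt_target p).measurableSet).ennreal_ofReal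

lemma lintegral_chartVolume (g : RiemannianMetricOn I M) (p : M) {φ : M → ENNReal}
    (hφ : Measurable φ) : ∫⁻ x, φ x ∂chartVolume g p =
      ∫⁻ y in (extChartAt I p).target, ENNReal.ofReal (volumeDensity g p y) *
        φ ((extChartAt I p).symm y) ∂(finBasis ℝ E).addHaar := by
  have hm := aemeasurable_extChartAt_symm (I := I) p (finBasis ℝ E).addHaar
  have hd := aemeasurable_volumeDensity g p (finBasis ℝ E).addHaar
  rw [chartVolume, lintegral_map' hφ.aemeasurable
    (hm.mono_ac (withDensity_absolutelyContinuous _ _))]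
  exact lintegral_withDensity_eq_lintegral_mul₀ hd (hφ.comp_aemeasurable hm)

omit [FiniteDimensional ℝ E] [IsManifold I ∞ M] in
lemma measurableSet_target_inter_preimage (p : M) {s : Set M} (hs : MeasurableSet s) :
    MeasurableSet ((extChartAt I p).target ∩ (extChartAt I p).symm ⁻¹' s) := by
  have h : Measurable ((extChartAt I p).target.domRestrict (extChartAt I p).symm) :=
    (continuousOn_iff_continuous_domRestrict.1 (continuousOn_extChartAt_symm (I := I) p)).measurable
  have h2 := (isOpen_extChartAt_target (I := I) p).measurableSet.subtype_image (h hs)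
  convert h2 using 1
  ext y
  refine ⟨fun ⟨h1, h2⟩ => ⟨⟨y, h1⟩, h2, rfl⟩, ?_⟩
  rintro ⟨⟨z, hz⟩, hzs, rfl⟩
  exact ⟨hz, hzs⟩

lemma chartVolume_apply (g : RiemannianMetricOn I M) (p : M) {s : Set M} (hs : MeasurableSet s) :
    chartVolume g p s = ∫⁻ y in (extChartAt I p).target ∩ (extChartAt I p).symm ⁻¹' s,
      ENNReal.ofReal (volumeDensity g p y) ∂(finBasis ℝ E).addHaar := by
  have h := lintegral_chartVolume g p ((measurable_one (α := ENNReal)).indicator hs)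
  rw [lintegral_indicator_one hs] at h
  have hT := (isOpen_extChartAt_target (I := I) p).measurableSet
  rw [h, ← lintegral_indicator hT,
    ← lintegral_indicator (measurableSet_target_inter_preimage p hs)]
  refine lintegral_congr fun y => ?_
  by_cases h1 : y ∈ (extChartAt I p).target
  · by_cases h2 : (extChartAt I p).symm y ∈ s
    · rw [indicator_of_mem h1, indicator_of_mem h2, indicator_of_mem (mem_inter h1 h2),
        Pi.one_apply, mul_one]
    · rw [indicator_of_mem h1, indicator_of_notMem h2, indicator_of_notMem fun h => h2 h.2,
        mul_zero]
  · rw [indicator_of_notMem h1, indicator_of_notMem fun h => h1 h.1]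

/-- The volume measures of two metrics whose densities differ by the factor `ρ`. -/
lemma chartVolume_eq_withDensity (g h : RiemannianMetricOn I M) {ρ : M → ℝ} (hρ : Continuous ρ)
    (hpos : ∀ x, 0 < ρ x) (p : M) (hd : ∀ y ∈ (extChartAt I p).target,
      volumeDensity h p y = ρ ((extChartAt I p).symm y) * volumeDensity g p y) :
    chartVolume h p = (chartVolume g p).withDensity fun x => ENNReal.ofReal (ρ x) := by
  ext s hs
  have hm : Measurable (s.indicator fun x => ENNReal.ofReal (ρ x)) :=
    hρ.measurable.ennreal_ofReal.indicator hs
  have h1 := lintegral_chartVolume h p ((measurable_one (α := ENNReal)).indicator hs)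
  rw [lintegral_indicator_one hs] at h1
  rw [withDensity_apply _ hs, ← lintegral_indicator hs, lintegral_chartVolume g p hm, h1]
  refine setLIntegral_congr_fun (isOpen_extChartAt_target (I := I) p).measurableSet fun y hy => ?_
  by_cases h2 : (extChartAt I p).symm y ∈ s
  · simp only [indicator_of_mem h2, Pi.one_apply, mul_one]
    rw [hd y hy, ENNReal.ofReal_mul (hpos _).le, mul_comm]
  · simp only [indicator_of_notMem h2, mul_zero]

lemma riemannianVolume_eq_withDensity (g h : RiemannianMetricOn I M) {ρ : M → ℝ}
    (hρ : Continuous ρ) (hpos : ∀ x, 0 < ρ x) (hd : ∀ p, ∀ y ∈ (extChartAt I p).target,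
      volumeDensity h p y = ρ ((extChartAt I p).symm y) * volumeDensity g p y) :
    riemannianVolume h = (riemannianVolume g).withDensity fun x => ENNReal.ofReal (ρ x) := by
  -- One inequality follows chart by chart from the definition as a supremum; the converse is the
  -- same inequality with the metrics exchanged and density `ρ⁻¹`.
  have mono : ∀ (g h : RiemannianMetricOn I M) (ρ : M → ℝ), Continuous ρ → (∀ x, 0 < ρ x) →
      (∀ p, ∀ y ∈ (extChartAt I p).target,
        volumeDensity h p y = ρ ((extChartAt I p).symm y) * volumeDensity g p y) →
      riemannianVolume h ≤ (riemannianVolume g).withDensity fun x => ENNReal.ofReal (ρ x) := by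
    intro g h ρ hρ hpos hd
    refine iSup_le fun p => ?_
    rw [chartVolume_eq_withDensity g h hρ hpos p (hd p)]
    refine Measure.le_iff.2 fun s hs => ?_
    rw [withDensity_apply _ hs, withDensity_apply _ hs]
    exact lintegral_mono' (Measure.restrict_mono subset_rfl
      (le_iSup (fun p => chartVolume g p) p)) le_rfl
  refine le_antisymm (mono g h ρ hρ hpos hd) ?_
  have h1 := mono h g (fun x => (ρ x)⁻¹) (hρ.inv₀ fun x => (hpos x).ne')
    (fun x => inv_pos.2 (hpos x)) fun p y hy => by
      rw [hd p y hy, ← mul_assoc, inv_mul_cancel₀ (hpos _).ne', one_mul]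
  have hm : Measurable fun x => ENNReal.ofReal (ρ x) := hρ.measurable.ennreal_ofReal
  have h2 : (fun x => ENNReal.ofReal (ρ x)⁻¹) = (fun x => ENNReal.ofReal (ρ x))⁻¹ := by
    ext x
    rw [Pi.inv_apply, ENNReal.ofReal_inv_of_pos (hpos x)]
  rw [h2] at h1
  refine Measure.le_iff.2 fun s hs => ?_
  rw [withDensity_apply _ hs]
  refine (lintegral_mono' (Measure.restrict_mono subset_rfl h1) le_rfl).trans ?_
  rw [← withDensity_apply _ hs, ← withDensity_mul _ hm.inv hm]
  have h3 : (fun x => ENNReal.ofReal (ρ x))⁻¹ * (fun x => ENNReal.ofReal (ρ x)) = 1 := by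
    ext x
    exact ENNReal.inv_mul_cancel (ENNReal.ofReal_pos.2 (hpos x)).ne' ENNReal.ofReal_ne_top
  rw [h3, withDensity_one]

omit [MeasurableSpace E] [BorelSpace E] [MeasurableSpace M] [BorelSpace M] in
lemma volumeDensity_chartChange (g : RiemannianMetricOn I M) {p q : M} {y : E}
    (hy : y ∈ chartChangeSource I p q) : volumeDensity g p y =
      |(fderiv ℝ (chartChange I p q) y).det| * volumeDensity g q (chartChange I p q y) := by
  rw [volumeDensity, chartMetric_chartChange g hy, gram_pullbackForm_det,
    Real.sqrt_mul (sq_nonneg _), Real.sqrt_sq_eq_abs]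
  rfl

/-- On the domain of the chart at `q`, the volume computed in any chart is at most the volume
computed in the chart at `q`. -/
lemma chartVolume_le (g : RiemannianMetricOn I M) (p q : M) {s : Set M} (hs : MeasurableSet s)
    (hsq : s ⊆ (extChartAt I q).source) : chartVolume g p s ≤ chartVolume g q s := by
  rw [chartVolume_apply g p hs, chartVolume_apply g q hs]
  set A := (extChartAt I p).target ∩ (extChartAt I p).symm ⁻¹' s with hA
  have hAs : A ⊆ chartChangeSource I p q := fun y hy => ⟨hy.1, hsq hy.2⟩
  have hAm : MeasurableSet A := measurableSet_target_inter_preimage p hs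
  -- Invertibility of the coordinate change permits the change of variables formula. The image of
  -- `A` may be smaller than the part of `s` seen by the chart at `q`, hence only an inequality.
  have hinj : InjOn (chartChange I p q) A := fun y hy z hz hyz => by
    rw [← chartChange_chartChange (hAs hy), hyz, chartChange_chartChange (hAs hz)]
  have hd : ∀ y ∈ A, HasFDerivWithinAt (chartChange I p q) (fderiv ℝ (chartChange I p q) y) A y :=
    fun y hy => ((contDiffOn_chartChange p q).hasFDerivAt_top (isOpen_chartChangeSource p q)
      (hAs hy)).hasFDerivWithinAt
  have hcv := lintegral_image_eq_lintegral_abs_det_fderiv_mul (finBasis ℝ E).addHaar hAm hd hinj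
    fun z => ENNReal.ofReal (volumeDensity g q z)
  have h1 : ∫⁻ y in A, ENNReal.ofReal (volumeDensity g p y) ∂(finBasis ℝ E).addHaar =
      ∫⁻ z in chartChange I p q '' A, ENNReal.ofReal (volumeDensity g q z)
        ∂(finBasis ℝ E).addHaar := by
    rw [hcv]
    refine setLIntegral_congr_fun hAm fun y hy => ?_
    rw [volumeDensity_chartChange g (hAs hy), ENNReal.ofReal_mul (abs_nonneg _)]
  rw [h1]
  refine lintegral_mono_set ?_
  rintro _ ⟨y, hy, rfl⟩
  refine ⟨(mapsTo_chartChange p q (hAs hy)).1, ?_⟩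
  rw [mem_preimage, symm_chartChange (hAs hy)]
  exact hy.2

/-- The Riemannian volume of a compact manifold is finite. -/
theorem isFiniteMeasure_riemannianVolume [CompactSpace M] [T2Space M]
    (g : RiemannianMetricOn I M) : IsFiniteMeasure (riemannianVolume g) := by
  have : LocallyCompactSpace M := Manifold.locallyCompact_of_finiteDimensional I
  choose K hKn hKs hKc using fun p : M =>
    local_compact_nhds (extChartAt_source_mem_nhds (I := I) p)
  obtain ⟨t, ht⟩ := CompactSpace.elim_nhds_subcover K hKn
  -- A finite cover by compact sets, each inside a chart domain, dominates every chart volume and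
  -- hence their supremum; on each compact piece the density is continuous.
  have hle : riemannianVolume g ≤ ∑ q ∈ t, (chartVolume g q).restrict (K q) := by
    refine iSup_le fun p => Measure.le_iff.2 fun s hs => ?_
    have h1 : s ⊆ ⋃ q ∈ t, s ∩ K q := by
      intro x hx
      have : x ∈ ⋃ q ∈ t, K q := by rw [ht]; trivial
      simp only [mem_iUnion] at this ⊢
      obtain ⟨q, hq, hxq⟩ := this
      exact ⟨q, hq, hx, hxq⟩
    refine (measure_mono h1).trans ((measure_biUnion_finset_le t _).trans ?_)
    rw [Measure.finsetSum_apply]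
    refine Finset.sum_le_sum fun q _ => ?_
    rw [Measure.restrict_apply hs]
    exact chartVolume_le g p q (hs.inter (hKc q).isClosed.measurableSet)
      (inter_subset_right.trans (hKs q))
  refine ⟨lt_of_le_of_lt (hle univ) ?_⟩
  rw [Measure.finsetSum_apply]
  refine ENNReal.sum_lt_top.2 fun q _ => ?_
  rw [Measure.restrict_apply_univ, chartVolume_apply g q (hKc q).isClosed.measurableSet]
  have hC : (extChartAt I q).target ∩ (extChartAt I q).symm ⁻¹' K q = extChartAt I q '' K q := by
    ext y
    refine ⟨fun ⟨h1, h2⟩ => ⟨_, h2, (extChartAt I q).right_inv h1⟩, ?_⟩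
    rintro ⟨x, hx, rfl⟩
    refine ⟨(extChartAt I q).map_source (hKs q hx), ?_⟩
    rw [mem_preimage, (extChartAt I q).left_inv (hKs q hx)]
    exact hx
  have hcomp : IsCompact (extChartAt I q '' K q) :=
    (hKc q).image_of_continuousOn ((continuousOn_extChartAt q).mono (hKs q))
  rw [hC]
  have hcont : ContinuousOn (volumeDensity g q) (extChartAt I q '' K q) :=
    (continuousOn_volumeDensity g q).mono (by
      rintro _ ⟨x, hx, rfl⟩; exact (extChartAt I q).map_source (hKs q hx))
  have hi : IntegrableOn (volumeDensity g q) (extChartAt I q '' K q) (finBasis ℝ E).addHaar :=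
    hcont.integrableOn_compact hcomp
  exact hi.lintegral_lt_top

end Volume

/-! ### Homogeneity of Hessian and gradient -/

section Scaling

variable {E : Type*} [NormedAddCommGroup E] [NormedSpace ℝ E] [FiniteDimensional ℝ E]

lemma metricTrace_mul (B : E →L[ℝ] E →L[ℝ] ℝ) (c : ℝ) (S : E → E → ℝ) :
    metricTrace B (fun u v => c * S u v) = c * metricTrace B S := by
  simp only [metricTrace, Finset.mul_sum]
  exact Finset.sum_congr rfl fun a _ => Finset.sum_congr rfl fun b _ => by ring

/-- Scaling commutes with `fderiv` over a field without any differentiability assumption, so `φ` is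
arbitrary. -/
lemma hessian_smul (G : E → E →L[ℝ] E →L[ℝ] ℝ) (φ : E → ℝ) (c : ℝ) (y u v : E) :
    hessian G (c • φ) y u v = c * hessian G φ y u v := by
  have h : fderiv ℝ (c • fderiv ℝ φ) = c • fderiv ℝ (fderiv ℝ φ) :=
    fderiv_const_smul_field (𝕜 := ℝ) (F := E →L[ℝ] ℝ) (R := ℝ) (f := fderiv ℝ φ) c
  rw [hessian, fderiv_const_smul_field, h, hessian]
  simp only [smul_apply, Pi.smul_apply, smul_eq_mul]
  ring

lemma gradient_smul (G : E → E →L[ℝ] E →L[ℝ] ℝ) (φ : E → ℝ) (c : ℝ) (y : E) :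
    gradient G (c • φ) y = c • gradient G φ y := by
  rw [gradient, fderiv_const_smul_field, gradient, ← sharp_smul]
  rfl

end Scaling

/-! ### Volume-preserving rescaling of the factors -/

section Degeneration

variable {ι : Type*} [Fintype ι] [DecidableEq ι]
  {E : ι → Type*} [∀ i, NormedAddCommGroup (E i)] [∀ i, NormedSpace ℝ (E i)]
  {H : ι → Type*} [∀ i, TopologicalSpace (H i)] {I : ∀ i, ModelWithCorners ℝ (E i) (H i)}
  {M : ι → Type*} [∀ i, TopologicalSpace (M i)] [∀ i, ChartedSpace (H i) (M i)]
  [∀ i, IsManifold (I i) ∞ (M i)] [∀ i, FiniteDimensional ℝ (E i)]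

lemma partialLaplacian_smul (g : RiemannianMetricOn (ModelWithCorners.pi I) (∀ i, M i)) (i : ι)
    (c : ℝ) (φ : (∀ i, M i) → ℝ) (x : ∀ i, M i) :
    partialLaplacian g i (c • φ) x = c * partialLaplacian g i φ x := by
  simp only [partialLaplacian, ← metricTrace_mul, ← hessian_smul]
  rfl

lemma partialGradInner_smul (g : RiemannianMetricOn (ModelWithCorners.pi I) (∀ i, M i)) (i : ι)
    (a b : ℝ) (φ ψ : (∀ i, M i) → ℝ) (x : ∀ i, M i) :
    partialGradInner g i (a • φ) (b • ψ) x = a * b * partialGradInner g i φ ψ x := by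
  have h : ∀ (c : ℝ) (φ : (∀ i, M i) → ℝ), (c • φ) ∘ (extChartAt (ModelWithCorners.pi I) x).symm =
      c • (φ ∘ (extChartAt (ModelWithCorners.pi I) x).symm) := fun _ _ => rfl
  rw [partialGradInner, h, h, gradient_smul, gradient_smul, map_smul, map_smul, map_smul, map_smul,
    smul_apply, smul_eq_mul, smul_eq_mul, ← mul_assoc, partialGradInner, mul_comm b a]

/-- The functions `ρ_i` do not change if each `f_j` is multiplied by a constant. -/
lemma rho_smul (g : RiemannianMetricOn (ModelWithCorners.pi I) (∀ i, M i))
    (f : ι → (∀ j, M j) → ℝ) {c : ι → ℝ} (hc : ∀ j, c j ≠ 0) (i : ι) (x : ∀ i, M i) :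
    rho g (fun j => c j • f j) i x = rho g f i x := by
  have hL : ∀ j, c j * partialLaplacian g i (f j) x / (c j * f j x) =
      partialLaplacian g i (f j) x / f j x := fun j => mul_div_mul_left _ _ (hc j)
  have hg : ∀ j k, c j * c k * partialGradInner g i (f j) (f k) x / (c j * f j x * (c k * f k x)) =
      partialGradInner g i (f j) (f k) x / (f j x * f k x) := fun j k => by
    rw [mul_mul_mul_comm, mul_div_mul_left _ _ (mul_ne_zero (hc j) (hc k))]
  simp only [rho, sq, Pi.smul_apply, smul_eq_mul, partialLaplacian_smul, partialGradInner_smul,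
    hL, hg]

variable [∀ i, (I i).Boundaryless] [MeasurableSpace (∀ i, E i)] [BorelSpace (∀ i, E i)]
  [MeasurableSpace (∀ i, M i)] [BorelSpace (∀ i, M i)]

omit [DecidableEq ι] in
/-- The volume measure of `f_1² g_1 ⊕ ⋯ ⊕ f_l² g_l` is `f_1^{m_1} ⋯ f_l^{m_l}` times that of
`g_1 ⊕ ⋯ ⊕ g_l`. -/
theorem riemannianVolume_multiconformalMetric (g : ∀ i, RiemannianMetricOn (I i) (M i))
    (f : ι → (∀ j, M j) → ℝ)
    (hf : ∀ i, ContMDiff (ModelWithCorners.pi I) 𝓘(ℝ, ℝ) ∞ (f i)) (hpos : ∀ i x, 0 < f i x) :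
    riemannianVolume (multiconformalMetric g f hf hpos) =
      (riemannianVolume (productMetric g)).withDensity
        fun x => ENNReal.ofReal (∏ k, f k x ^ finrank ℝ (E k)) := by
  refine riemannianVolume_eq_withDensity _ _
    (continuous_finsetProd _ fun k _ => (hf k).continuous.pow _)
    (fun x => Finset.prod_pos fun k _ => pow_pos (hpos k x) _) fun p y hy => ?_
  have h : 0 ≤ ∏ k, (f k ∘ (extChartAt (ModelWithCorners.pi I) p).symm) y ^ finrank ℝ (E k) :=
    Finset.prod_nonneg fun k _ => pow_nonneg (hpos k _).le _
  rw [volumeDensity, volumeDensity, productMetric, chartMetric_multiconformalMetric _ _ _ _ hy,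
    chartMetric_multiconformalMetric _ _ _ _ hy, gram_multiForm_det, Real.sqrt_mul (sq_nonneg _),
    Real.sqrt_sq h]
  rfl

/-- If the integral of `(R_i + ρ_i) / f_i²` with respect to the volume measure of
`f_1² g_1 ⊕ ⋯ ⊕ f_l² g_l` is negative, then the normalized Einstein-Hilbert functional is unbounded
below on the multiconformal class. -/
theorem exists_einsteinHilbert_lt [∀ i, CompactSpace (M i)] [∀ i, T2Space (M i)]
    (g : ∀ i, RiemannianMetricOn (I i) (M i)) (i : ι)
    (hn : 1 ≤ ∑ j ∈ Finset.univ.erase i, finrank ℝ (E j))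
    (f : ι → (∀ j, M j) → ℝ)
    (hf : ∀ i, ContMDiff (ModelWithCorners.pi I) 𝓘(ℝ, ℝ) ∞ (f i)) (hpos : ∀ i x, 0 < f i x)
    (hneg : ∫ x, (partialScalarCurvature (productMetric g) i x + rho (productMetric g) f i x)
        / f i x ^ 2 * ∏ j, f j x ^ finrank ℝ (E j) ∂riemannianVolume (productMetric g) < 0)
    (b : ℝ) : ∃ h ∈ multiconformalClass g, einsteinHilbert h < b := by
  set B : (∀ j, M j) → ℝ := fun x =>
    (partialScalarCurvature (productMetric g) i x + rho (productMetric g) f i x) / f i x ^ 2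
    with hB
  set S : (∀ j, M j) → ℝ := scalarCurvature (multiconformalMetric g f hf hpos) with hS
  set μ := riemannianVolume (multiconformalMetric g f hf hpos) with hμ
  have hprod : ∀ x, 0 < ∏ j, f j x ^ finrank ℝ (E j) := fun x =>
    Finset.prod_pos fun k _ => pow_pos (hpos k x) _
  have hvol := riemannianVolume_multiconformalMetric g f hf hpos
  have hmeas : Measurable fun x => ENNReal.ofReal (∏ k, f k x ^ finrank ℝ (E k)) :=
    (continuous_finsetProd _ fun k _ => (hf k).continuous.pow _).measurable.ennreal_ofReal
  have hA : ∫ x, B x ∂μ < 0 := by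
    rw [hμ, hvol, integral_withDensity_eq_integral_toReal_smul hmeas
      (ae_of_all _ fun _ => ENNReal.ofReal_lt_top)]
    refine lt_of_eq_of_lt (integral_congr_ae (ae_of_all _ fun x => ?_)) hneg
    simp only [ENNReal.toReal_ofReal (hprod x).le, smul_eq_mul]
    exact mul_comm _ _
  have hfin : IsFiniteMeasure μ := isFiniteMeasure_riemannianVolume _
  -- A non-integrable function has Bochner integral zero, so the strict negativity already gives
  -- integrability. The same argument below excludes zero volume.
  have hBi : Integrable B μ := by
    by_contra hcon
    rw [integral_undef hcon] at hA
    exact lt_irrefl _ hA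
  have hSi : Integrable S μ :=
    (continuous_scalarCurvature _).integrable_of_hasCompactSupport
      (HasCompactSupport.of_compactSpace _)
  have hSBi : Integrable (fun x => S x - B x) μ := hSi.sub hBi
  have hV : 0 < μ.real univ := by
    refine lt_of_le_of_ne measureReal_nonneg fun h0 => ?_
    have h1 : μ = 0 := by
      rw [← Measure.measure_univ_eq_zero]
      exact (measureReal_eq_zero_iff).1 h0.symm
    rw [h1, integral_zero_measure] at hA
    exact lt_irrefl _ hA
  set n := ∑ j ∈ Finset.univ.erase i, finrank ℝ (E j) with hn'
  set V := μ.real univ ^ (((finrank ℝ (∀ j, E j) : ℝ) - 2) / (finrank ℝ (∀ j, E j) : ℝ)) with hVd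
  have hV' : 0 < V := Real.rpow_pos_of_pos hV _
  have key : ∀ t : ℝ, 1 ≤ t → ∃ h ∈ multiconformalClass g, einsteinHilbert h =
      ((t ^ n) ^ 2 * ∫ x, B x ∂μ + ((t⁻¹ ^ finrank ℝ (E i)) ^ 2) * ∫ x, (S x - B x) ∂μ) / V := by
    intro t ht
    have ht0 : 0 < t := zero_lt_one.trans_le ht
    -- The exponents are balanced: factor `i` contributes `t ^ (-n m_i)` to the volume and the other
    -- factors together contribute `t ^ (m_i n)`.
    let c : ι → ℝ := fun j => if j = i then t⁻¹ ^ n else t ^ finrank ℝ (E i)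
    have hc : ∀ j, 0 < c j := fun j => by
      by_cases hj : j = i
      · simp only [c, hj, if_true]; positivity
      · simp only [c, hj, if_false]; positivity
    have hci : c i = t⁻¹ ^ n := if_pos rfl
    have hcj : ∀ j ∈ Finset.univ.erase i, c j = t ^ finrank ℝ (E i) := fun j hj =>
      if_neg (Finset.ne_of_mem_erase hj)
    have hF : ∀ j, ContMDiff (ModelWithCorners.pi I) 𝓘(ℝ, ℝ) ∞ (c j • f j) := fun j =>
      (contMDiff_const (c := c j)).mul (hf j)
    have hFpos : ∀ j x, 0 < (c j • f j) x := fun j x => mul_pos (hc j) (hpos j x)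
    have hc1 : ∏ j, c j ^ finrank ℝ (E j) = 1 := by
      rw [← Finset.mul_prod_erase _ _ (Finset.mem_univ i), hci,
        Finset.prod_congr rfl fun j hj => by rw [hcj j hj], Finset.prod_pow_eq_pow_sum, ← hn',
        ← pow_mul, ← pow_mul, mul_comm n, ← mul_pow, inv_mul_cancel₀ ht0.ne', one_pow]
    have hμt : riemannianVolume (multiconformalMetric g (fun j => c j • f j) hF hFpos) = μ := by
      rw [riemannianVolume_multiconformalMetric, hμ, hvol]
      congr 1
      funext x
      simp only [Pi.smul_apply, smul_eq_mul, mul_pow, Finset.prod_mul_distrib, hc1, one_mul]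
    refine ⟨_, ⟨fun j => c j • f j, hF, hFpos, rfl⟩, ?_⟩
    have hScal : ∀ x, scalarCurvature (multiconformalMetric g (fun j => c j • f j) hF hFpos) x =
        (t ^ n) ^ 2 * B x + (t⁻¹ ^ finrank ℝ (E i)) ^ 2 * (S x - B x) := by
      intro x
      have hSx : S x - B x = ∑ k ∈ Finset.univ.erase i,
          (partialScalarCurvature (productMetric g) k x + rho (productMetric g) f k x)
            / f k x ^ 2 := by
        rw [hS, scalarCurvature_multiconformalMetric,
          ← Finset.add_sum_erase _ _ (Finset.mem_univ i), hB, add_sub_cancel_left]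
      rw [scalarCurvature_multiconformalMetric, ← Finset.add_sum_erase _ _ (Finset.mem_univ i), hSx,
        Finset.mul_sum]
      simp only [rho_smul (productMetric g) f fun j => (hc j).ne', Pi.smul_apply, smul_eq_mul]
      congr 1
      · rw [hci, inv_pow, hB]
        field_simp
      · refine Finset.sum_congr rfl fun j hj => ?_
        rw [hcj j hj, inv_pow]
        field_simp
    rw [einsteinHilbert, hμt, integral_congr_ae (ae_of_all _ hScal),
      integral_add (hBi.const_mul _) (hSBi.const_mul _), integral_const_mul,
      integral_const_mul]
  set A := ∫ x, B x ∂μ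
  set C := ∫ x, (S x - B x) ∂μ
  -- The threshold makes `t * A + |C| < b * V`. This suffices, since `t ≤ t ^ (2n)` and `A < 0`,
  -- while the second term is at most `|C|`.
  obtain ⟨t, ht⟩ : ∃ t : ℝ, 1 ≤ t ∧ (|C| - b * V) / (-A) < t :=
    ⟨max 1 ((|C| - b * V) / (-A) + 1), le_max_left _ _,
      (lt_add_one _).trans_le (le_max_right _ _)⟩
  obtain ⟨h, hh, hE⟩ := key t ht.1
  refine ⟨h, hh, ?_⟩
  rw [hE, div_lt_iff₀ hV']
  have h1 : (|C| - b * V) < t * (-A) := (div_lt_iff₀ (neg_pos.2 hA)).1 ht.2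
  have h2 : t ≤ (t ^ n) ^ 2 := by
    rw [← pow_mul]
    exact le_self_pow₀ ht.1 (by positivity)
  have h3 : (t⁻¹ ^ finrank ℝ (E i)) ^ 2 ≤ 1 := by
    rw [← pow_mul]
    exact pow_le_one₀ (by have := ht.1; positivity) (inv_le_one_of_one_le₀ ht.1)
  have h4 : (t⁻¹ ^ finrank ℝ (E i)) ^ 2 * C ≤ |C| := by
    calc _ ≤ (t⁻¹ ^ finrank ℝ (E i)) ^ 2 * |C| :=
          mul_le_mul_of_nonneg_left (le_abs_self C) (sq_nonneg _)
      _ ≤ 1 * |C| := mul_le_mul_of_nonneg_right h3 (abs_nonneg _)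
      _ = |C| := one_mul _
  have h5 : (t ^ n) ^ 2 * A ≤ t * A := mul_le_mul_of_nonpos_right h2 hA.le
  linarith

end Degeneration

end Multiconformal

end

/-! ### The main theorem -/

theorem mainTheorem8 {l : ℕ} (hl : 2 ≤ l) (m : Fin l → ℕ) (hm : ∀ i, 1 ≤ m i)
    (M : Fin l → Type*) [∀ i, TopologicalSpace (M i)]
    [∀ i, ChartedSpace (EuclideanSpace ℝ (Fin (m i))) (M i)]
    [∀ i, IsManifold (𝓡 (m i)) ∞ (M i)]
    [∀ i, CompactSpace (M i)] [∀ i, T2Space (M i)] [∀ i, ConnectedSpace (M i)]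
    [MeasurableSpace (∀ i, M i)] [BorelSpace (∀ i, M i)]
    (g : ∀ i, Multiconformal.RiemannianMetricOn (𝓡 (m i)) (M i))
    (i : Fin l) (f : Fin l → (∀ j, M j) → ℝ)
    (hf : ∀ j, ContMDiff (ModelWithCorners.pi fun k => 𝓡 (m k)) 𝓘(ℝ, ℝ) ∞ (f j))
    (hpos : ∀ j x, 0 < f j x)
    (hneg : ∫ x, (Multiconformal.partialScalarCurvature (Multiconformal.productMetric g) i x
          + Multiconformal.rho (Multiconformal.productMetric g) f i x) / f i x ^ 2
        * ∏ j, f j x ^ m j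
        ∂Multiconformal.riemannianVolume (Multiconformal.productMetric g) < 0) :
    ⨅ h ∈ Multiconformal.multiconformalClass g,
      ((Multiconformal.einsteinHilbert h : ℝ) : EReal) = ⊥ := by
  have hdim : ∀ j, finrank ℝ (EuclideanSpace ℝ (Fin (m j))) = m j := fun j =>
    finrank_euclideanSpace_fin
  -- A second factor of positive dimension makes the exponent of `t` in the `i`-th curvature term
  -- positive; without it the rescaling could not make that term grow.
  have hn : 1 ≤ ∑ j ∈ Finset.univ.erase i, finrank ℝ (EuclideanSpace ℝ (Fin (m j))) := by
    have : Nontrivial (Fin l) := Fin.nontrivial_iff_two_le.2 hl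
    obtain ⟨j, hj⟩ := exists_ne i
    calc 1 ≤ finrank ℝ (EuclideanSpace ℝ (Fin (m j))) := by rw [hdim]; exact hm j
      _ ≤ _ := Finset.single_le_sum
        (f := fun j => finrank ℝ (EuclideanSpace ℝ (Fin (m j)))) (fun _ _ => Nat.zero_le _)
        (Finset.mem_erase.2 ⟨hj, Finset.mem_univ j⟩)
  refine (EReal.eq_bot_iff_forall_lt _).2 fun b => ?_
  obtain ⟨h, hh, hlt⟩ := Multiconformal.exists_einsteinHilbert_lt g i hn f hf hpos
    (by simpa only [hdim] using hneg) b
  exact (iInf₂_le h hh).trans_lt (EReal.coe_lt_coe_iff.2 hlt)
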